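/- **Setting.** A *finite dimensional weak $C^*$-Hopf algebra* $A$ is a finite dimensional $C^*$-algebra with linear maps $\Delta:A\to A\otimes A$, $\varepsilon:A\to\mathbb C$, $S:A\to A$ such that, in Sweedler notation $\Delta(x)=x_{(1)}\otimes x_{(2)}$: $\Delta$ is multiplicative, $*$-preserving and coassociative with counit $\varepsilon$; $(\Delta(1)\otimes 1)(1\otimes\Delta(1))=1_{(1)}\otimes 1_{(2)}\otimes 1_{(3)}$; $\varepsilon(xyz)=\varepsilon(xy_{(1)})\varepsilon(y_{(2)}z)$; $S(x_{(1)})x_{(2)}=1_{(1)}\varepsilon(x1_{(2)})$; $x_{(1)}S(x_{(2)})=\varepsilon(1_{(1)}x)1_{(2)}$; $S(x_{(1)})x_{(2)}S(x_{(3)})=S(x)$. The dual space $\hat A$ is a $*$-algebra with product $(\varphi\psi)(x)=\varphi(x_{(1)})\psi(x_{(2)})$, unit $\hat 1=\varepsilon$, and $\varphi^*(x)=\overline{\varphi(S(x)^*)}$; elements of $A$ are regarded as functionals on $\hat A$. Put $\varepsilon_L(a)=\varepsilon(a\,\cdot)$, $\varepsilon_R(a)=\varepsilon(\cdot\,a)$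 in $\hat A$, and $\hat\varepsilon_L(\varphi)=\varphi(1_{(1)})1_{(2)}$, $\hat\varepsilon_R(\varphi)=1_{(1)}\varphi(1_{(2)})$ in $A$; let $A_L=\hat\varepsilon_L(\hat A)$, $A_R=\hat\varepsilon_R(\hat A)$. Let $\mathcal L(A)=\{l\in A: al=a_{(1)}S(a_{(2)})l\ \ \forall a\in A\}$ be the space of *left integrals* and $\mathcal R(A)=\{r\in A: ra=rS(a_{(1)})a_{(2)}\ \ \forall a\in A\}$ that of right integrals. The *normalized Haar integral* is the unique $h\in\mathcal L(A)\cap\mathcal R(A)$ with $S(h_{(1)})h_{(2)}=h_{(1)}S(h_{(2)})=1$. A left integral $l$ is *positive* if it is a positive functional on $\hat A$ (its value on each $\varphi^*\varphi$ is $\ge0$); *nondegenerate* if the bilinear form $(\varphi,\psi)\mapsto\langle\varphi\psi,l\rangle$ on $\hat A$ is nondegenerate; *normalizable* if $\varepsilon_R(l)$ is invertible in $\hat A$; *normalized* if $\varepsilon_R(l)=\hat 1$. Put $n_\sigma(l)=\hat\varepsilon_\sigma\varepsilon_R(l)$ for $\sigma\in\{L,R\}$ and $d_R(l)=\hat\varepsilon_R\varepsilon_L(l)$.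 An *$A$-module von Neumann algebra* is a von Neumann algebra $M$ on a Hilbert space with a linear left action $\triangleright:A\otimes M\to M$ such that $(ab)\triangleright m=a\triangleright(b\triangleright m)$, $1\triangleright m=m$, $a\triangleright(mn)=(a_{(1)}\triangleright m)(a_{(2)}\triangleright n)$, $(a\triangleright m)^*=S(a)^*\triangleright m^*$, $a\triangleright 1_M=a_{(1)}S(a_{(2)})\triangleright 1_M$, and each $a\triangleright\cdot$ is weakly (that is, ultraweakly) continuous. Put $N=M^A=\{n\in M: a\triangleright n=a_{(1)}S(a_{(2)})\triangleright n\ \ \forall a\in A\}$, let $C(N)$ be its center, and $M_R=A\triangleright 1_M$. The action is *standard* if $a\mapsto a\triangleright 1_M$ is a bijection from $A_L$ onto $M_R$. Let $\mathrm{Hom}({}_NM_N\to{}_NN_N)$ be the space of weakly continuous linear maps $E:M\to N$ with $E(nm)=nE(m)$, $E(mn)=E(m)n$ for $n\in N$, $m\in M$. A linear map $E:M\to M$ is *positive* if $E(m)\ge0$ for $m\ge 0$, *faithful* if $E(m^*m)=0$ implies $m=0$, *normalized* if $E(1_M)=1_M$, and *nondegenerate* if the bilinear map $(m,m')\mapsto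 E(mm')$ is nondegenerate in both arguments. **Theorem 2.26 (Left integrals and conditional expectations).** Let $A$ be a finite dimensional weak $C^*$-Hopf algebra, $M$ an $A$-module von Neumann algebra and $N=M^A$. For $l\in\mathcal L(A)$ put $E_l(m)=l\triangleright m$. 1. $E_l(M)\subset N$, and $E_l$ is a weakly continuous $N$–$N$ bimodule map. 2. For $d_L\in A_L$ and $d_R\in A_R$, the elements $ld_L,\ ld_R$ are left integrals and $E_{ld_L}(m)=E_l((d_L\triangleright1_M)m)$, $E_{ld_R}(m)=E_l(m(d_R\triangleright1_M))$. 3. $E_l(1_M)=n_L(l)\triangleright1_M=n_R(l)\triangleright1_M\in C(N)\cap M_R$. If $l$ is normalizable, then $E_l(1_M)$ is invertible. If $l$ is normalized, then $E_l(1_M)=1_M$, $E_l$ is the identity on $N$, and $E_l(M)=N$. 4. The normalized Haar integral $h$ exists. If $l$ is positive, then $E_l$ is positive, $d_R(l)\ge0$, and $E_l(m)=E_h(z_l^*mz_l)$ for all $m\in M$, where $z_l=d_R(l)^{1/2}\triangleright1_M$. If in addition $l$ is nondegenerate, then $E_l$ is faithful. 5. If the action is standard and $N'\cap M=M_R$,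 then $l\mapsto E_l$ is a linear bijection from $\mathcal L(A)$ onto $\mathrm{Hom}({}_NM_N\to{}_NN_N)$. In this case $E_l$ is normalized (respectively nondegenerate, positive) if and only if $l$ is normalized (respectively nondegenerate, positive). -/

import Mathlib

open scoped TensorProduct InnerProductSpace ComplexOrder
open Coalgebra

noncomputable section

/-- A weak C⋆-Hopf algebra structure on a C⋆-algebra `A` (finite dimensionality is a separate
assumption): a coalgebra structure whose coproduct is a (possibly non-unital) ⋆-homomorphism, with
weakened unit and counit axioms, and an antipode.  In Sweedler notation `Δ x = x₁ ⊗ x₂`. -/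
class WeakCStarHopfAlgebra (A : Type*) [CStarAlgebra A] extends Coalgebra ℂ A where
  /-- the antipode -/
  antipode : A →ₗ[ℂ] A
  /-- `Δ(xy) = Δ(x) Δ(y)` -/
  comul_mul' : ∀ x y : A, comul (x * y) = comul x * comul y
  /-- `Δ(x⋆) = Δ(x)⋆` -/
  comul_star' : ∀ x : A, comul (star x) = star (comul x)
  /-- `(Δ(1) ⊗ 1)(1 ⊗ Δ(1)) = 1₁ ⊗ 1₂ ⊗ 1₃` -/
  comul_one_mul_comul_one :
    TensorProduct.assoc ℂ A A A (comul (1 : A) ⊗ₜ[ℂ] (1 : A)) *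
        ((1 : A) ⊗ₜ[ℂ] comul (1 : A)) =
      TensorProduct.map LinearMap.id (comul) (comul (1 : A))
  /-- `ε(xyz) = ε(x y₁) ε(y₂ z)` -/
  counit_mul_mul : ∀ x y z : A,
    counit (x * y * z) =
      LinearMap.mul' ℂ ℂ (TensorProduct.map
        (counit ∘ₗ LinearMap.mulLeft ℂ x) (counit ∘ₗ LinearMap.mulRight ℂ z)
        (comul y))
  /-- `S(x₁) x₂ = 1₁ ε(x 1₂)` -/
  antipode_mul_id : ∀ x : A,
    LinearMap.mul' ℂ A (TensorProduct.map antipode LinearMap.id (comul x)) =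
      TensorProduct.rid ℂ A (TensorProduct.map LinearMap.id
        (counit ∘ₗ LinearMap.mulLeft ℂ x) (comul (1 : A)))
  /-- `x₁ S(x₂) = ε(1₁ x) 1₂` -/
  id_mul_antipode : ∀ x : A,
    LinearMap.mul' ℂ A (TensorProduct.map LinearMap.id antipode (comul x)) =
      TensorProduct.lid ℂ A (TensorProduct.map
        (counit ∘ₗ LinearMap.mulRight ℂ x) LinearMap.id (comul (1 : A)))
  /-- `S(x₁) x₂ S(x₃) = S(x)` -/
  antipode_mul_id_mul_antipode : ∀ x : A,
    LinearMap.mul' ℂ A (TensorProduct.map antipode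
      (LinearMap.mul' ℂ A ∘ₗ TensorProduct.map LinearMap.id antipode ∘ₗ comul)
      (comul x)) = antipode x

namespace WeakHopf

section Algebra

variable {A : Type*} [CStarAlgebra A] [WeakCStarHopfAlgebra A]

/-- The antipode `S`. -/
abbrev S : A →ₗ[ℂ] A := WeakCStarHopfAlgebra.antipode

/-- `a ↦ a₁ S(a₂)`. -/
def idConvS : A →ₗ[ℂ] A :=
  LinearMap.mul' ℂ A ∘ₗ TensorProduct.map LinearMap.id S ∘ₗ comul (R := ℂ)

/-- `a ↦ S(a₁) a₂`. -/
def sConvId : A →ₗ[ℂ] A :=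
  LinearMap.mul' ℂ A ∘ₗ TensorProduct.map S LinearMap.id ∘ₗ comul (R := ℂ)

/-- The product of the dual algebra `Â`: `⟨φψ | x⟩ = ⟨φ ⊗ ψ | Δ x⟩`. Its unit is the counit `ε`. -/
def dualMul (φ ψ : Module.Dual ℂ A) : Module.Dual ℂ A :=
  LinearMap.mul' ℂ ℂ ∘ₗ TensorProduct.map φ ψ ∘ₗ comul (R := ℂ)

/-- The ⋆-structure of the dual algebra `Â`: `⟨φ⋆ | x⟩` is the complex conjugate of
`⟨φ | S(x)⋆⟩`. -/
def dualStar (φ : Module.Dual ℂ A) : Module.Dual ℂ A where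
  toFun x := star (φ (star (S x)))
  map_add' x y := by simp
  map_smul' c x := by simp

/-- `ε_L(a) = 1̂ ↼ a`, that is `⟨ε_L(a) | b⟩ = ε(ab)`. -/
def epsL (a : A) : Module.Dual ℂ A := counit (R := ℂ) ∘ₗ LinearMap.mulLeft ℂ a

/-- `ε_R(a) = a ⇀ 1̂`, that is `⟨ε_R(a) | b⟩ = ε(ba)`. -/
def epsR (a : A) : Module.Dual ℂ A := counit (R := ℂ) ∘ₗ LinearMap.mulRight ℂ a

/-- `ε̂_L(φ) = (φ ⊗ id)(Δ(1))`, characterized by `⟨ψ | ε̂_L(φ)⟩ = ⟨φψ | 1⟩`. -/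
def hatEpsL (φ : Module.Dual ℂ A) : A :=
  TensorProduct.lid ℂ A (TensorProduct.map φ LinearMap.id (comul (R := ℂ) (1 : A)))

/-- `ε̂_R(φ) = (id ⊗ φ)(Δ(1))`, characterized by `⟨ψ | ε̂_R(φ)⟩ = ⟨ψφ | 1⟩`. -/
def hatEpsR (φ : Module.Dual ℂ A) : A :=
  TensorProduct.rid ℂ A (TensorProduct.map LinearMap.id φ (comul (R := ℂ) (1 : A)))

variable (A) in
/-- The left subalgebra `A_L = {(φ ⊗ id)(Δ(1))}`. -/
def leftSubalg : Set A := Set.range (hatEpsL (A := A))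

variable (A) in
/-- The right subalgebra `A_R = {(id ⊗ φ)(Δ(1))}`. -/
def rightSubalg : Set A := Set.range (hatEpsR (A := A))

variable (A) in
/-- The space of left integrals: `a l = a₁ S(a₂) l` for all `a`. -/
def leftIntegrals : Submodule ℂ A where
  carrier := {l | ∀ a : A, a * l = idConvS a * l}
  add_mem' hx hy a := by rw [mul_add, mul_add, hx a, hy a]
  zero_mem' a := by simp
  smul_mem' c x hx a := by rw [mul_smul_comm, mul_smul_comm, hx a]

variable (A) in
/-- The space of right integrals: `r a = r S(a₁) a₂` for all `a`. -/
def rightIntegrals : Submodule ℂ A where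
  carrier := {r | ∀ a : A, r * a = r * sConvId a}
  add_mem' hx hy a := by rw [add_mul, add_mul, hx a, hy a]
  zero_mem' a := by simp
  smul_mem' c x hx a := by rw [smul_mul_assoc, smul_mul_assoc, hx a]

/-- `h` is the normalized Haar integral: a two-sided integral with `S(h₁) h₂ = h₁ S(h₂) = 1`.
There is at most one such element. -/
structure IsHaarIntegral (h : A) : Prop where
  left : h ∈ leftIntegrals A
  right : h ∈ rightIntegrals A
  sConvId_eq : sConvId h = 1
  idConvS_eq : idConvS h = 1

/-- `l` is positive as a functional on the ⋆-algebra `Â`: `⟨φ⋆φ | l⟩ ≥ 0` for all `φ`. -/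
def IsPositiveIntegral (l : A) : Prop :=
  ∀ φ : Module.Dual ℂ A, 0 ≤ dualMul (dualStar φ) φ l

/-- `l` is nondegenerate as a functional on the algebra `Â`: the bilinear form
`(φ, ψ) ↦ ⟨φψ | l⟩` is nondegenerate. -/
def IsNondegenerateIntegral (l : A) : Prop :=
  (∀ φ : Module.Dual ℂ A, (∀ ψ : Module.Dual ℂ A, dualMul φ ψ l = 0) → φ = 0) ∧
  (∀ ψ : Module.Dual ℂ A, (∀ φ : Module.Dual ℂ A, dualMul φ ψ l = 0) → ψ = 0)

/-- `l` is normalized: `ε_R(l) = 1̂`. -/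
def IsNormalizedIntegral (l : A) : Prop := epsR l = counit (R := ℂ)

/-- `l` is normalizable: `ε_R(l)` is invertible in the algebra `Â`. -/
def IsNormalizableIntegral (l : A) : Prop :=
  ∃ ψ : Module.Dual ℂ A,
    dualMul (epsR l) ψ = counit (R := ℂ) ∧ dualMul ψ (epsR l) = counit (R := ℂ)

/-- `n_L(l) = ε̂_L(ε_R(l))`. -/
def nL (l : A) : A := hatEpsL (epsR l)

/-- `n_R(l) = ε̂_R(ε_R(l))`. -/
def nR (l : A) : A := hatEpsR (epsR l)

/-- The Radon-Nikodym derivative `d_R(l) = ε̂_R(ε_L(l))` of a left integral with respect to the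
Haar integral. -/
def dR (l : A) : A := hatEpsR (epsL l)

end Algebra

section Ultraweak

variable {H : Type*} [NormedAddCommGroup H] [InnerProductSpace ℂ H] [CompleteSpace H]

/-- The ultraweak (σ-weak) topology on a von Neumann algebra: the coarsest topology making the
functionals `x ↦ ∑ₙ ⟪ξₙ, x ηₙ⟫` continuous, for all sequences of vectors with
`∑ₙ ‖ξₙ‖² < ∞` and `∑ₙ ‖ηₙ‖² < ∞`. -/
@[reducible]
def ultraweakTopology (M : VonNeumannAlgebra H) : TopologicalSpace M.toStarSubalgebra :=
  ⨅ (ξ : ℕ → H) (η : ℕ → H) (_ : Summable fun n => ‖ξ n‖ ^ 2) (_ : Summable fun n => ‖η n‖ ^ 2),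
    TopologicalSpace.induced
      (fun x : M.toStarSubalgebra => ∑' n, ⟪ξ n, (x : H →L[ℂ] H) (η n)⟫_ℂ) inferInstance

/-- Continuity of a map `M → M` for the ultraweak topology. -/
def IsUltraweaklyContinuous (M : VonNeumannAlgebra H)
    (f : M.toStarSubalgebra → M.toStarSubalgebra) : Prop :=
  @Continuous _ _ (ultraweakTopology M) (ultraweakTopology M) f

theorem isUltraweaklyContinuous_iff (M : VonNeumannAlgebra H)
    (f : M.toStarSubalgebra → M.toStarSubalgebra) :
    IsUltraweaklyContinuous M f ↔ ∀ ξ η : ℕ → H, Summable (fun n => ‖ξ n‖ ^ 2) →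
      Summable (fun n => ‖η n‖ ^ 2) →
      @Continuous _ _ (ultraweakTopology M) inferInstance
        (fun x => ∑' n, ⟪ξ n, (f x : H →L[ℂ] H) (η n)⟫_ℂ) := by
  unfold IsUltraweaklyContinuous
  constructor
  · intro h ξ η hξ hη
    let := ultraweakTopology M
    have h2 : Continuous (fun x : M.toStarSubalgebra =>
        ∑' n, ⟪ξ n, (x : H →L[ℂ] H) (η n)⟫_ℂ) := by
      rw [continuous_iff_le_induced]
      exact (iInf_le_of_le ξ <| iInf_le_of_le η <| iInf_le_of_le hξ <| iInf_le_of_le hη le_rfl)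
    exact h2.comp h
  · intro h
    refine continuous_iff_le_induced.2 ?_
    unfold ultraweakTopology
    simp only [induced_iInf, le_iInf_iff, induced_compose]
    intro ξ η hξ hη
    exact continuous_iff_le_induced.1 (h ξ η hξ hη)

theorem summable_inner_apply {ξ η : ℕ → H} (hξ : Summable fun n => ‖ξ n‖ ^ 2)
    (hη : Summable fun n => ‖η n‖ ^ 2) (x : H →L[ℂ] H) :
    Summable fun n => ⟪ξ n, x (η n)⟫_ℂ := by
  refine Summable.of_norm_bounded ((hξ.add hη).mul_left ‖x‖) fun n => ?_
  have h1 : ‖⟪ξ n, x (η n)⟫_ℂ‖ ≤ ‖ξ n‖ * (‖x‖ * ‖η n‖) :=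
    (norm_inner_le_norm _ _).trans (by gcongr; exact x.le_opNorm _)
  have h2 : ‖ξ n‖ * ‖η n‖ ≤ ‖ξ n‖ ^ 2 + ‖η n‖ ^ 2 := by
    nlinarith [sq_nonneg (‖ξ n‖ - ‖η n‖), sq_nonneg ‖ξ n‖, sq_nonneg ‖η n‖]
  calc _ ≤ ‖ξ n‖ * (‖x‖ * ‖η n‖) := h1
    _ = ‖x‖ * (‖ξ n‖ * ‖η n‖) := by ring
    _ ≤ _ := by gcongr

theorem IsUltraweaklyContinuous.add {M : VonNeumannAlgebra H}
    {f g : M.toStarSubalgebra → M.toStarSubalgebra} (hf : IsUltraweaklyContinuous M f)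
    (hg : IsUltraweaklyContinuous M g) : IsUltraweaklyContinuous M (f + g) := by
  rw [isUltraweaklyContinuous_iff] at *
  intro ξ η hξ hη
  let := ultraweakTopology M
  have := (hf ξ η hξ hη).add (hg ξ η hξ hη)
  refine this.congr fun x => ?_
  simp only [Pi.add_apply]
  rw [← (summable_inner_apply hξ hη _).tsum_add (summable_inner_apply hξ hη _)]
  simp

theorem IsUltraweaklyContinuous.const_smul {M : VonNeumannAlgebra H}
    {f : M.toStarSubalgebra → M.toStarSubalgebra} (c : ℂ) (hf : IsUltraweaklyContinuous M f) :
    IsUltraweaklyContinuous M (c • f) := by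
  rw [isUltraweaklyContinuous_iff] at *
  intro ξ η hξ hη
  let := ultraweakTopology M
  have := (hf ξ η hξ hη).const_smul c
  refine this.congr fun x => ?_
  simp only [Pi.smul_apply]
  rw [smul_eq_mul, ← tsum_mul_left]
  simp

theorem isUltraweaklyContinuous_zero (M : VonNeumannAlgebra H) :
    IsUltraweaklyContinuous M 0 := by
  let := ultraweakTopology M
  exact continuous_const (X := M.toStarSubalgebra)

end Ultraweak

/-- A von Neumann algebra `M` with a left action `a ⊗ m ↦ a ▷ m` of the weak C⋆-Hopf algebra `A`,
making it an `A`-module algebra. -/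
structure VNModuleAlgebra (A : Type*) [CStarAlgebra A] [WeakCStarHopfAlgebra A]
    {H : Type*} [NormedAddCommGroup H] [InnerProductSpace ℂ H] [CompleteSpace H]
    (M : VonNeumannAlgebra H) where
  /-- the action, `act a m = a ▷ m` -/
  act : A →ₗ[ℂ] M.toStarSubalgebra →ₗ[ℂ] M.toStarSubalgebra
  /-- `(ab) ▷ m = a ▷ (b ▷ m)` -/
  mul_act : ∀ a b m, act (a * b) m = act a (act b m)
  /-- `1 ▷ m = m` -/
  one_act : ∀ m, act 1 m = m
  /-- `a ▷ (mn) = (a₁ ▷ m)(a₂ ▷ n)` -/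
  act_mul : ∀ a m n, act a (m * n) =
    LinearMap.mul' ℂ M.toStarSubalgebra
      (TensorProduct.map (act.flip m) (act.flip n) (comul (R := ℂ) a))
  /-- `(a ▷ m)⋆ = S(a)⋆ ▷ m⋆` -/
  star_act : ∀ a m, star (act a m) = act (star (S a)) (star m)
  /-- `a ▷ 1 = a₁ S(a₂) ▷ 1` -/
  act_one : ∀ a, act a 1 = act (idConvS a) 1
  /-- each `a ▷ ·` is weakly continuous -/
  continuous_act : ∀ a, IsUltraweaklyContinuous M (act a)

namespace VNModuleAlgebra

variable {A : Type*} [CStarAlgebra A] [WeakCStarHopfAlgebra A]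
  {H : Type*} [NormedAddCommGroup H] [InnerProductSpace ℂ H] [CompleteSpace H]
  {M : VonNeumannAlgebra H} (T : VNModuleAlgebra A M)

/-- The invariant subalgebra `N = M^A`: those `n` with `a ▷ n = a₁ S(a₂) ▷ n` for all `a`. -/
def fixedPoints : Set M.toStarSubalgebra := {n | ∀ a : A, T.act a n = T.act (idConvS a) n}

/-- `M_R = A ▷ 1`. -/
def MR : Set M.toStarSubalgebra := Set.range fun a : A => T.act a 1

/-- The action is standard: `a ↦ a ▷ 1` is a bijection (hence an isomorphism of ⋆-algebras)
from `A_L` onto `M_R`. -/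
def IsStandard : Prop := Set.BijOn (fun a : A => T.act a 1) (leftSubalg A) T.MR

/-- The map `E_l : m ↦ l ▷ m`. -/
def E (l : A) : M.toStarSubalgebra →ₗ[ℂ] M.toStarSubalgebra := T.act l

/-- `Hom(ₙMₙ → ₙNₙ)`: the weakly continuous linear `N`-`N` bimodule maps from `M` to `N`. -/
def bimoduleHom : Submodule ℂ (M.toStarSubalgebra →ₗ[ℂ] M.toStarSubalgebra) where
  carrier := {F | (∀ m, F m ∈ T.fixedPoints) ∧
    (∀ n ∈ T.fixedPoints, ∀ m, F (n * m) = n * F m ∧ F (m * n) = F m * n) ∧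
    IsUltraweaklyContinuous M F}
  add_mem' := by
    rintro F G ⟨hF1, hF2, hF3⟩ ⟨hG1, hG2, hG3⟩
    refine ⟨fun m a => ?_, fun n hn m => ⟨?_, ?_⟩, hF3.add hG3⟩
    · simp only [LinearMap.add_apply, map_add]
      rw [hF1 m a, hG1 m a]
    · simp [(hF2 n hn m).1, (hG2 n hn m).1, mul_add]
    · simp [(hF2 n hn m).2, (hG2 n hn m).2, add_mul]
  zero_mem' := ⟨fun m a => by simp, fun n _ m => by simp, isUltraweaklyContinuous_zero M⟩
  smul_mem' := by
    rintro c F ⟨hF1, hF2, hF3⟩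
    refine ⟨fun m a => ?_, fun n hn m => ⟨?_, ?_⟩, hF3.const_smul c⟩
    · simp only [LinearMap.smul_apply, map_smul]
      rw [hF1 m a]
    · simp [(hF2 n hn m).1]
    · simp [(hF2 n hn m).2]

end VNModuleAlgebra

section Maps

variable {H : Type*} [NormedAddCommGroup H] [InnerProductSpace ℂ H] [CompleteSpace H]
  {M : VonNeumannAlgebra H}

/-- `F` maps positive operators to positive operators. -/
def IsPositiveMap (F : M.toStarSubalgebra →ₗ[ℂ] M.toStarSubalgebra) : Prop :=
  ∀ m : M.toStarSubalgebra,
    (m : H →L[ℂ] H).IsPositive → (F m : H →L[ℂ] H).IsPositive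

/-- `F` is faithful: `F(m⋆m) = 0` only for `m = 0`. -/
def IsFaithfulMap (F : M.toStarSubalgebra →ₗ[ℂ] M.toStarSubalgebra) : Prop :=
  ∀ m : M.toStarSubalgebra, F (star m * m) = 0 → m = 0

/-- `F` is nondegenerate: the bilinear map `(m, m') ↦ F(mm')` is nondegenerate. -/
def IsNondegenerateMap (F : M.toStarSubalgebra →ₗ[ℂ] M.toStarSubalgebra) : Prop :=
  (∀ m : M.toStarSubalgebra, (∀ m' : M.toStarSubalgebra, F (m * m') = 0) → m = 0) ∧
  (∀ m' : M.toStarSubalgebra, (∀ m : M.toStarSubalgebra, F (m * m') = 0) → m' = 0)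

end Maps

end WeakHopf

end

/-! Everything rests on the Haar integral `h`, its positivity and faithfulness, and the identity `l
= h * dR l`, which reduces every left integral to an element of `A_R`.

The maps `idConvS` and `epsR` have the same kernel, which is a left ideal. In a finite dimensional
C⋆-algebra such an ideal is the left annihilator of a self-adjoint projection `h`, and this
projection is the Haar integral (`exists_isHaarProjection`, `IsHaarProjection.isHaarIntegral`). To
see that `h` is positive and nondegenerate on the dual, write a functional as `tr(b ·)` with a
faithful, antipode-invariant trace. The exchange rule `(1 ⊗ x) Δ(l) = (S(x) ⊗ 1) Δ(l)` then turns
`⟨φ⋆φ, h⟩` into `(tr ⊗ tr)(w w⋆)` with `w = (S(b) ⊗ 1) Δ(h)` (`dualMul_dualStar_self`).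

An integral is positive exactly when `(S ⊗ id) Δ(l)` is a finite sum of `a⋆ ⊗ a`. Consequently `l ▷
(x⋆y) = ∑ (aᵢ ▷ x)⋆ (aᵢ ▷ y)` (`act_star_mul`). This gives positivity of `E_l`, and also
faithfulness when `l` is nondegenerate, because the `aᵢ` then span `A`. For a standard action,
properties of `E_l` become properties of `dR l`: nondegeneracy is invertibility, and positivity is
`0 ≤ dR l`, tested on the negative part.

Surjectivity of `l ↦ E_l` is a self-duality statement: each map `F` in the bimodule Hom space is
`E_h(y ·)` for some `y` in `M` (`IsGramDecomposition.exists_eq_apply_mul`). Such an `F` is dominated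
by `E_h`, so Riesz representation on square-summable sequences in the Hilbert space produces vectors
`κ(ξ)`. Uniqueness makes `κ` linear and equivariant under the commutant, so it is given by elements
`yᵢ` of `M`. An approximation argument merges these into one element. Left `N`-linearity of `F` puts
`y` in `N' ∩ M = M_R`, hence `y = b ▷ 1` with `b` in `A_L`, and `F = E_{hb}`. -/

set_option linter.unusedSectionVars false

noncomputable section

namespace WeakHopf

section

open TensorProduct

/-! ### Convolution of linear maps from a coalgebra to an algebra -/

section Convolution

variable {C B : Type*} [AddCommGroup C] [Module ℂ C] [Coalgebra ℂ C] [Ring B] [Algebra ℂ B]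

/-- The convolution product of linear maps from a coalgebra to an algebra. -/
def conv (f g : C →ₗ[ℂ] B) : C →ₗ[ℂ] B :=
  LinearMap.mul' ℂ B ∘ₗ TensorProduct.map f g ∘ₗ comul (R := ℂ)

theorem conv_apply (f g : C →ₗ[ℂ] B) (x : C) :
    conv f g x = LinearMap.mul' ℂ B (TensorProduct.map f g (comul (R := ℂ) x)) := rfl

theorem conv_assoc (f g k : C →ₗ[ℂ] B) : conv (conv f g) k = conv f (conv g k) :=
  congrArg WithConv.ofConv
    (mul_assoc (WithConv.toConv f) (WithConv.toConv g) (WithConv.toConv k))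

/-- Two weak convolution inverses of the same map with the same source and range maps agree. -/
theorem eq_of_conv_eq {m a b : C →ₗ[ℂ] B} (hl : conv a m = conv b m) (hr : conv m a = conv m b)
    (ha : conv (conv a m) a = a) (hb : conv (conv b m) b = b) : a = b := by
  rw [← ha, conv_assoc, hr, ← conv_assoc, hl, hb]

end Convolution

/-! ### Counit identities and the maps onto the left and right subalgebras -/

section Algebra

variable {A : Type*} [CStarAlgebra A] [WeakCStarHopfAlgebra A]

theorem lid_map_counit_comul (x : A) :
    TensorProduct.lid ℂ A (TensorProduct.map (counit (R := ℂ)) LinearMap.id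
      (comul (R := ℂ) x)) = x := by
  have h := Coalgebra.rTensor_counit_comul (R := ℂ) x
  rw [LinearMap.rTensor] at h
  rw [h]; simp

theorem rid_map_counit_comul (x : A) :
    TensorProduct.rid ℂ A (TensorProduct.map LinearMap.id (counit (R := ℂ))
      (comul (R := ℂ) x)) = x := by
  have h := Coalgebra.lTensor_counit_comul (R := ℂ) x
  rw [LinearMap.lTensor] at h
  rw [h]; simp

/-- Since `Δ` preserves `⋆`, the functional `e(x) = conj ε(x⋆)` is a left counit. A left counit and
a right counit agree, as one sees by evaluating `(e ⊗ ε) Δ(x)` in both orders. -/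
theorem counit_star (x : A) : counit (R := ℂ) (star x) = star (counit (R := ℂ) x) := by
  let e : A →ₗ[ℂ] ℂ :=
    { toFun := fun x => star (counit (R := ℂ) (star x))
      map_add' := fun x y => by simp
      map_smul' := fun c x => by simp }
  have h1 : ∀ t : A ⊗[ℂ] A, TensorProduct.lid ℂ A (TensorProduct.map e LinearMap.id t) =
      star (TensorProduct.lid ℂ A (TensorProduct.map (counit (R := ℂ)) LinearMap.id (star t))) := by
    intro t
    induction t using TensorProduct.induction_on with
    | zero => simp
    | tmul a b => simp [e]
    | add a b ha hb => simp [ha, hb]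
  have h2 : ∀ t : A ⊗[ℂ] A,
      counit (R := ℂ) (TensorProduct.lid ℂ A (TensorProduct.map e LinearMap.id t)) =
      e (TensorProduct.rid ℂ A (TensorProduct.map LinearMap.id (counit (R := ℂ)) t)) := by
    intro t
    induction t using TensorProduct.induction_on with
    | zero => simp
    | tmul a b => simp [mul_comm]
    | add a b ha hb => simp only [map_add, ha, hb]
  have h3 := h2 (comul (R := ℂ) x)
  rw [h1, ← WeakCStarHopfAlgebra.comul_star', lid_map_counit_comul, star_star,
    rid_map_counit_comul] at h3
  rw [h3]
  simp [e]

theorem star_comul_one : star (comul (R := ℂ) (1 : A)) = comul (R := ℂ) (1 : A) := by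
  rw [← WeakCStarHopfAlgebra.comul_star', star_one]

theorem comul_one_mul_comul (x : A) :
    comul (R := ℂ) (1 : A) * comul (R := ℂ) x = comul (R := ℂ) x := by
  rw [← WeakCStarHopfAlgebra.comul_mul', one_mul]

theorem comul_mul_comul_one (x : A) :
    comul (R := ℂ) x * comul (R := ℂ) (1 : A) = comul (R := ℂ) x := by
  rw [← WeakCStarHopfAlgebra.comul_mul', mul_one]

theorem apply_hatEpsL (φ ψ : Module.Dual ℂ A) : ψ (hatEpsL φ) = dualMul φ ψ 1 := by
  have : ∀ t : A ⊗[ℂ] A, ψ (TensorProduct.lid ℂ A (TensorProduct.map φ LinearMap.id t)) =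
      LinearMap.mul' ℂ ℂ (TensorProduct.map φ ψ t) := by
    intro t
    induction t using TensorProduct.induction_on with
    | zero => simp
    | tmul a b => simp
    | add a b ha hb => simp only [map_add, ha, hb]
  exact this _

theorem apply_hatEpsR (φ ψ : Module.Dual ℂ A) : ψ (hatEpsR φ) = dualMul ψ φ 1 := by
  have : ∀ t : A ⊗[ℂ] A, ψ (TensorProduct.rid ℂ A (TensorProduct.map LinearMap.id φ t)) =
      LinearMap.mul' ℂ ℂ (TensorProduct.map ψ φ t) := by
    intro t
    induction t using TensorProduct.induction_on with
    | zero => simp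
    | tmul a b => simp [mul_comm]
    | add a b ha hb => simp only [map_add, ha, hb]
  exact this _

theorem idConvS_eq_conv : idConvS (A := A) = conv LinearMap.id S := rfl

theorem sConvId_eq_conv : sConvId (A := A) = conv S LinearMap.id := rfl

theorem idConvS_eq_hatEpsL (x : A) : idConvS x = hatEpsL (epsR x) :=
  WeakCStarHopfAlgebra.id_mul_antipode x

theorem sConvId_eq_hatEpsR (x : A) : sConvId x = hatEpsR (epsL x) :=
  WeakCStarHopfAlgebra.antipode_mul_id x

@[simp] theorem epsL_apply (a b : A) : epsL a b = counit (R := ℂ) (a * b) := rfl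

@[simp] theorem epsR_apply (a b : A) : epsR a b = counit (R := ℂ) (b * a) := rfl

theorem dualMul_epsL_epsR_one (x z : A) :
    dualMul (epsL x) (epsR z) 1 = counit (R := ℂ) (x * z) := by
  have := WeakCStarHopfAlgebra.counit_mul_mul x 1 z
  rw [mul_one] at this
  exact this.symm

/-- The counit axiom provides only one order of the two legs. Conjugating it at `y = 1`, where
`Δ(1)` is self-adjoint, supplies the opposite order. -/
theorem dualMul_epsR_epsL_one (x z : A) :
    dualMul (epsR z) (epsL x) 1 = counit (R := ℂ) (x * z) := by
  have h : ∀ t : A ⊗[ℂ] A, LinearMap.mul' ℂ ℂ (TensorProduct.map (epsR z) (epsL x) (star t)) =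
      star (LinearMap.mul' ℂ ℂ (TensorProduct.map (epsL (star z)) (epsR (star x)) t)) := by
    intro t
    induction t using TensorProduct.induction_on with
    | zero => simp
    | tmul a b =>
      simp only [TensorProduct.star_tmul, TensorProduct.map_tmul, LinearMap.mul'_apply, epsL_apply,
        epsR_apply, star_mul', ← counit_star, star_mul, star_star]
    | add a b ha hb => simp [ha, hb]
  have h2 := h (comul (R := ℂ) 1)
  rw [star_comul_one] at h2
  have h3 := dualMul_epsL_epsR_one (star z) (star x)
  rw [← star_mul, counit_star] at h3
  refine h2.trans ?_
  rw [← star_star (counit (R := ℂ) (x * z)), ← h3]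
  rfl

theorem counit_mul_idConvS (x w : A) : counit (R := ℂ) (x * idConvS w) = counit (R := ℂ) (x * w) := by
  rw [← dualMul_epsR_epsL_one x w, ← apply_hatEpsL, idConvS_eq_hatEpsL]; rfl

theorem counit_sConvId_mul (x w : A) : counit (R := ℂ) (sConvId x * w) = counit (R := ℂ) (x * w) := by
  rw [← dualMul_epsR_epsL_one x w, ← apply_hatEpsR, sConvId_eq_hatEpsR]; rfl

theorem counit_mul_nR (x w : A) : counit (R := ℂ) (x * nR w) = counit (R := ℂ) (x * w) := by
  rw [← dualMul_epsL_epsR_one x w, ← apply_hatEpsR]; rfl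

theorem epsR_idConvS (w : A) : epsR (idConvS w) = epsR w := by
  ext x; exact counit_mul_idConvS x w

theorem idConvS_eq_of_epsR_eq {x y : A} (h : ∀ z, counit (R := ℂ) (z * x) = counit (R := ℂ) (z * y)) :
    idConvS x = idConvS y := by
  rw [idConvS_eq_hatEpsL, idConvS_eq_hatEpsL]
  congr 1
  ext z; exact h z

theorem sConvId_eq_of_epsL_eq {x y : A} (h : ∀ z, counit (R := ℂ) (x * z) = counit (R := ℂ) (y * z)) :
    sConvId x = sConvId y := by
  rw [sConvId_eq_hatEpsR, sConvId_eq_hatEpsR]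
  congr 1
  ext z; exact h z

/-- Each of `idConvS x` and `epsR x` determines the other. The kernel described here is the left
ideal from which the Haar integral is built. -/
theorem idConvS_eq_zero_iff (x : A) : idConvS x = 0 ↔ ∀ y, counit (R := ℂ) (y * x) = 0 := by
  constructor
  · intro h y
    rw [← counit_mul_idConvS, h, mul_zero, map_zero]
  · intro h
    rw [← map_zero (idConvS (A := A))]
    exact idConvS_eq_of_epsR_eq fun z => by rw [h]; simp

theorem sConvId_eq_zero_iff (x : A) : sConvId x = 0 ↔ ∀ y, counit (R := ℂ) (x * y) = 0 := by
  constructor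
  · intro h y
    rw [← counit_sConvId_mul, h, zero_mul, map_zero]
  · intro h
    rw [← map_zero (sConvId (A := A))]
    exact sConvId_eq_of_epsL_eq fun z => by rw [h]; simp

theorem idConvS_mul_idConvS (x y : A) : idConvS (x * idConvS y) = idConvS (x * y) :=
  idConvS_eq_of_epsR_eq fun z => by rw [← mul_assoc, ← mul_assoc, counit_mul_idConvS]

theorem sConvId_sConvId_mul (x y : A) : sConvId (sConvId x * y) = sConvId (x * y) :=
  sConvId_eq_of_epsL_eq fun z => by rw [mul_assoc, mul_assoc, counit_sConvId_mul]

theorem idConvS_mem (x : A) : idConvS x ∈ leftSubalg A := ⟨_, (idConvS_eq_hatEpsL x).symm⟩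

theorem sConvId_mem (x : A) : sConvId x ∈ rightSubalg A := ⟨_, (sConvId_eq_hatEpsR x).symm⟩

/-! ### The coproduct on the left and right subalgebras -/

/-- `φ ⊗ id ⊗ id`. -/
def sliceLeft (φ : Module.Dual ℂ A) : A ⊗[ℂ] (A ⊗[ℂ] A) →ₗ[ℂ] A ⊗[ℂ] A :=
  (TensorProduct.lid ℂ (A ⊗[ℂ] A)).toLinearMap ∘ₗ TensorProduct.map φ LinearMap.id

/-- `id ⊗ id ⊗ ψ`. -/
def sliceRight (ψ : Module.Dual ℂ A) : A ⊗[ℂ] (A ⊗[ℂ] A) →ₗ[ℂ] A ⊗[ℂ] A :=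
  TensorProduct.map LinearMap.id
    ((TensorProduct.rid ℂ A).toLinearMap ∘ₗ TensorProduct.map LinearMap.id ψ)

@[simp] theorem sliceLeft_tmul (φ : Module.Dual ℂ A) (a : A) (t : A ⊗[ℂ] A) :
    sliceLeft φ (a ⊗ₜ t) = φ a • t := by simp [sliceLeft]

@[simp] theorem sliceRight_tmul (ψ : Module.Dual ℂ A) (a b c : A) :
    sliceRight ψ (a ⊗ₜ (b ⊗ₜ c)) = ψ c • (a ⊗ₜ b) := by simp [sliceRight]

/-- This is the adjoint of the unit axiom, using that `Δ(1)` is self-adjoint. It shows that the two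
factors commute. -/
theorem comul_one_mul_comul_one' :
    ((1 : A) ⊗ₜ[ℂ] comul (R := ℂ) (1 : A)) *
      TensorProduct.assoc ℂ A A A (comul (R := ℂ) (1 : A) ⊗ₜ[ℂ] (1 : A)) =
      TensorProduct.map LinearMap.id (comul (R := ℂ)) (comul (R := ℂ) (1 : A)) := by
  have h1 : ∀ t : A ⊗[ℂ] A, star (TensorProduct.assoc ℂ A A A (t ⊗ₜ[ℂ] (1 : A))) =
      TensorProduct.assoc ℂ A A A (star t ⊗ₜ[ℂ] (1 : A)) := by
    intro t
    induction t using TensorProduct.induction_on with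
    | zero => simp
    | tmul a b => simp
    | add a b ha hb => simp [ha, hb, TensorProduct.add_tmul]
  have h2 : ∀ t : A ⊗[ℂ] A, star (TensorProduct.map LinearMap.id (comul (R := ℂ)) t) =
      TensorProduct.map LinearMap.id (comul (R := ℂ)) (star t) := by
    intro t
    induction t using TensorProduct.induction_on with
    | zero => simp
    | tmul a b => simp [WeakCStarHopfAlgebra.comul_star']
    | add a b ha hb => simp [ha, hb]
  have := congrArg star (WeakCStarHopfAlgebra.comul_one_mul_comul_one (A := A))
  rw [star_mul, h1, h2, star_comul_one, TensorProduct.star_tmul, star_one, star_comul_one] at this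
  exact this

theorem comul_hatEpsL (φ : Module.Dual ℂ A) : comul (R := ℂ) (hatEpsL φ) =
    sliceLeft φ (TensorProduct.map LinearMap.id (comul (R := ℂ)) (comul (R := ℂ) (1 : A))) := by
  have : ∀ t : A ⊗[ℂ] A, comul (R := ℂ)
      (TensorProduct.lid ℂ A (TensorProduct.map φ LinearMap.id t)) =
      sliceLeft φ (TensorProduct.map LinearMap.id (comul (R := ℂ)) t) := by
    intro t
    induction t using TensorProduct.induction_on with
    | zero => simp
    | tmul a b => simp
    | add a b ha hb => simp only [map_add, ha, hb]
  exact this _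

theorem comul_hatEpsR (ψ : Module.Dual ℂ A) : comul (R := ℂ) (hatEpsR ψ) =
    sliceRight ψ (TensorProduct.map LinearMap.id (comul (R := ℂ)) (comul (R := ℂ) (1 : A))) := by
  have h1 : ∀ (t : A ⊗[ℂ] A) (c : A),
      sliceRight ψ (TensorProduct.assoc ℂ A A A (t ⊗ₜ c)) = ψ c • t := by
    intro t c
    induction t using TensorProduct.induction_on with
    | zero => simp
    | tmul a b => simp
    | add a b ha hb => simp [ha, hb, TensorProduct.add_tmul]
  have h2 : ∀ t : A ⊗[ℂ] A, comul (R := ℂ)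
      (TensorProduct.rid ℂ A (TensorProduct.map LinearMap.id ψ t)) =
      sliceRight ψ (TensorProduct.assoc ℂ A A A
        (TensorProduct.map (comul (R := ℂ)) LinearMap.id t)) := by
    intro t
    induction t using TensorProduct.induction_on with
    | zero => simp
    | tmul a b => simp [h1]
    | add a b ha hb => simp only [map_add, ha, hb]
  have h3 := Coalgebra.coassoc_apply (R := ℂ) (1 : A)
  rw [LinearMap.rTensor, LinearMap.lTensor] at h3
  rw [← h3]
  exact h2 _

theorem sliceLeft_assoc_mul (φ : Module.Dual ℂ A) (t s : A ⊗[ℂ] A) :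
    sliceLeft φ (TensorProduct.assoc ℂ A A A (t ⊗ₜ[ℂ] (1 : A)) * ((1 : A) ⊗ₜ[ℂ] s)) =
      (TensorProduct.lid ℂ A (TensorProduct.map φ LinearMap.id t) ⊗ₜ[ℂ] (1 : A)) * s := by
  induction t using TensorProduct.induction_on with
  | zero => simp
  | tmul a b => simp [← TensorProduct.smul_tmul']
  | add a b ha hb => simp only [map_add, TensorProduct.add_tmul, add_mul, ha, hb]

theorem sliceLeft_mul_assoc (φ : Module.Dual ℂ A) (t s : A ⊗[ℂ] A) :
    sliceLeft φ (((1 : A) ⊗ₜ[ℂ] s) * TensorProduct.assoc ℂ A A A (t ⊗ₜ[ℂ] (1 : A))) =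
      s * (TensorProduct.lid ℂ A (TensorProduct.map φ LinearMap.id t) ⊗ₜ[ℂ] (1 : A)) := by
  induction t using TensorProduct.induction_on with
  | zero => simp
  | tmul a b => simp [← TensorProduct.smul_tmul']
  | add a b ha hb => simp only [map_add, TensorProduct.add_tmul, mul_add, ha, hb]

theorem sliceRight_assoc_mul (ψ : Module.Dual ℂ A) (t s : A ⊗[ℂ] A) :
    sliceRight ψ (TensorProduct.assoc ℂ A A A (t ⊗ₜ[ℂ] (1 : A)) * ((1 : A) ⊗ₜ[ℂ] s)) =
      t * ((1 : A) ⊗ₜ[ℂ] TensorProduct.rid ℂ A (TensorProduct.map LinearMap.id ψ s)) := by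
  induction s using TensorProduct.induction_on with
  | zero => simp
  | tmul a b =>
    induction t using TensorProduct.induction_on with
    | zero => simp
    | tmul c d => simp
    | add c d hc hd => simp only [map_add, TensorProduct.add_tmul, add_mul, hc, hd]
  | add a b ha hb => simp only [map_add, TensorProduct.tmul_add, mul_add, ha, hb]

theorem sliceRight_mul_assoc (ψ : Module.Dual ℂ A) (t s : A ⊗[ℂ] A) :
    sliceRight ψ (((1 : A) ⊗ₜ[ℂ] s) * TensorProduct.assoc ℂ A A A (t ⊗ₜ[ℂ] (1 : A))) =
      ((1 : A) ⊗ₜ[ℂ] TensorProduct.rid ℂ A (TensorProduct.map LinearMap.id ψ s)) * t := by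
  induction s using TensorProduct.induction_on with
  | zero => simp
  | tmul a b =>
    induction t using TensorProduct.induction_on with
    | zero => simp
    | tmul c d => simp
    | add c d hc hd => simp only [map_add, TensorProduct.add_tmul, mul_add, hc, hd]
  | add a b ha hb => simp only [map_add, TensorProduct.tmul_add, add_mul, ha, hb]

/-- Apply `φ ⊗ id ⊗ id` to the unit axiom. The adjoint axiom gives the version with the factors
reversed, so `b ⊗ 1` commutes with `Δ(1)`. -/
theorem comul_of_mem_left {b : A} (hb : b ∈ leftSubalg A) :
    comul (R := ℂ) b = (b ⊗ₜ[ℂ] (1 : A)) * comul (R := ℂ) (1 : A) := by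
  obtain ⟨φ, rfl⟩ := hb
  rw [comul_hatEpsL, ← WeakCStarHopfAlgebra.comul_one_mul_comul_one, sliceLeft_assoc_mul]
  rfl

theorem comul_of_mem_left' {b : A} (hb : b ∈ leftSubalg A) :
    comul (R := ℂ) b = comul (R := ℂ) (1 : A) * (b ⊗ₜ[ℂ] (1 : A)) := by
  obtain ⟨φ, rfl⟩ := hb
  rw [comul_hatEpsL, ← comul_one_mul_comul_one', sliceLeft_mul_assoc]
  rfl

theorem comul_of_mem_right {c : A} (hc : c ∈ rightSubalg A) :
    comul (R := ℂ) c = ((1 : A) ⊗ₜ[ℂ] c) * comul (R := ℂ) (1 : A) := by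
  obtain ⟨φ, rfl⟩ := hc
  rw [comul_hatEpsR, ← comul_one_mul_comul_one', sliceRight_mul_assoc]
  rfl

theorem comul_of_mem_right' {c : A} (hc : c ∈ rightSubalg A) :
    comul (R := ℂ) c = comul (R := ℂ) (1 : A) * ((1 : A) ⊗ₜ[ℂ] c) := by
  obtain ⟨φ, rfl⟩ := hc
  rw [comul_hatEpsR, ← WeakCStarHopfAlgebra.comul_one_mul_comul_one, sliceRight_assoc_mul]
  rfl

theorem comul_left_mul {b : A} (hb : b ∈ leftSubalg A) (x : A) :
    comul (R := ℂ) (b * x) = (b ⊗ₜ[ℂ] (1 : A)) * comul (R := ℂ) x := by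
  rw [WeakCStarHopfAlgebra.comul_mul', comul_of_mem_left hb, mul_assoc, comul_one_mul_comul]

theorem comul_mul_left {b : A} (hb : b ∈ leftSubalg A) (x : A) :
    comul (R := ℂ) (x * b) = comul (R := ℂ) x * (b ⊗ₜ[ℂ] (1 : A)) := by
  rw [WeakCStarHopfAlgebra.comul_mul', comul_of_mem_left' hb, ← mul_assoc, comul_mul_comul_one]

theorem comul_right_mul {c : A} (hc : c ∈ rightSubalg A) (x : A) :
    comul (R := ℂ) (c * x) = ((1 : A) ⊗ₜ[ℂ] c) * comul (R := ℂ) x := by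
  rw [WeakCStarHopfAlgebra.comul_mul', comul_of_mem_right hc, mul_assoc, comul_one_mul_comul]

theorem comul_mul_right {c : A} (hc : c ∈ rightSubalg A) (x : A) :
    comul (R := ℂ) (x * c) = comul (R := ℂ) x * ((1 : A) ⊗ₜ[ℂ] c) := by
  rw [WeakCStarHopfAlgebra.comul_mul', comul_of_mem_right' hc, ← mul_assoc, comul_mul_comul_one]

theorem lid_map_counit_tmul_mul (b : A) (t : A ⊗[ℂ] A) :
    TensorProduct.lid ℂ A (TensorProduct.map (counit (R := ℂ)) LinearMap.id
      ((b ⊗ₜ[ℂ] (1 : A)) * t)) =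
    TensorProduct.lid ℂ A (TensorProduct.map (epsL b) LinearMap.id t) := by
  induction t using TensorProduct.induction_on with
  | zero => simp
  | tmul a b => simp
  | add a b ha hb => simp only [mul_add, map_add, ha, hb]

theorem lid_map_counit_mul_tmul (b : A) (t : A ⊗[ℂ] A) :
    TensorProduct.lid ℂ A (TensorProduct.map (counit (R := ℂ)) LinearMap.id
      (t * (b ⊗ₜ[ℂ] (1 : A)))) =
    TensorProduct.lid ℂ A (TensorProduct.map (epsR b) LinearMap.id t) := by
  induction t using TensorProduct.induction_on with
  | zero => simp
  | tmul a b => simp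
  | add a b ha hb => simp only [add_mul, map_add, ha, hb]

theorem rid_map_counit_tmul_mul (b : A) (t : A ⊗[ℂ] A) :
    TensorProduct.rid ℂ A (TensorProduct.map LinearMap.id (counit (R := ℂ))
      (((1 : A) ⊗ₜ[ℂ] b) * t)) =
    TensorProduct.rid ℂ A (TensorProduct.map LinearMap.id (epsL b) t) := by
  induction t using TensorProduct.induction_on with
  | zero => simp
  | tmul a b => simp
  | add a b ha hb => simp only [mul_add, map_add, ha, hb]

theorem rid_map_counit_mul_tmul (b : A) (t : A ⊗[ℂ] A) :
    TensorProduct.rid ℂ A (TensorProduct.map LinearMap.id (counit (R := ℂ))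
      (t * ((1 : A) ⊗ₜ[ℂ] b))) =
    TensorProduct.rid ℂ A (TensorProduct.map LinearMap.id (epsR b) t) := by
  induction t using TensorProduct.induction_on with
  | zero => simp
  | tmul a b => simp
  | add a b ha hb => simp only [add_mul, map_add, ha, hb]

/-- Applying `ε ⊗ id` recovers `b` from its coproduct. Thus the coproduct formula characterizes
`A_L`, and closure under products and `⋆` can be read off from it. -/
theorem mem_left_of_comul {b : A}
    (h : comul (R := ℂ) b = (b ⊗ₜ[ℂ] (1 : A)) * comul (R := ℂ) (1 : A)) : b ∈ leftSubalg A :=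
  ⟨epsL b, by
    rw [hatEpsL, ← lid_map_counit_tmul_mul, ← h, lid_map_counit_comul]⟩

theorem mem_left_of_comul' {b : A}
    (h : comul (R := ℂ) b = comul (R := ℂ) (1 : A) * (b ⊗ₜ[ℂ] (1 : A))) : b ∈ leftSubalg A :=
  ⟨epsR b, by
    rw [hatEpsL, ← lid_map_counit_mul_tmul, ← h, lid_map_counit_comul]⟩

theorem mem_right_of_comul {b : A}
    (h : comul (R := ℂ) b = ((1 : A) ⊗ₜ[ℂ] b) * comul (R := ℂ) (1 : A)) : b ∈ rightSubalg A :=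
  ⟨epsL b, by
    rw [hatEpsR, ← rid_map_counit_tmul_mul, ← h, rid_map_counit_comul]⟩

theorem mem_right_of_comul' {b : A}
    (h : comul (R := ℂ) b = comul (R := ℂ) (1 : A) * ((1 : A) ⊗ₜ[ℂ] b)) : b ∈ rightSubalg A :=
  ⟨epsR b, by
    rw [hatEpsR, ← rid_map_counit_mul_tmul, ← h, rid_map_counit_comul]⟩

variable (A) in
/-- The left subalgebra as a `⋆`-subalgebra. -/
def leftStarSubalgebra : StarSubalgebra ℂ A where
  carrier := leftSubalg A
  mul_mem' {a b} ha hb := mem_left_of_comul <| by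
    rw [comul_left_mul ha, comul_of_mem_left hb, ← mul_assoc]; simp
  one_mem' := mem_left_of_comul <| by rw [← Algebra.TensorProduct.one_def, one_mul]
  add_mem' {a b} ha hb := mem_left_of_comul <| by
    rw [map_add, comul_of_mem_left ha, comul_of_mem_left hb, TensorProduct.add_tmul, add_mul]
  zero_mem' := mem_left_of_comul <| by simp
  algebraMap_mem' r := mem_left_of_comul <| by
    rw [Algebra.algebraMap_eq_smul_one, map_smul, ← TensorProduct.smul_tmul',
      ← Algebra.TensorProduct.one_def, smul_mul_assoc, one_mul]
  star_mem' {a} ha := mem_left_of_comul' <| by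
    rw [WeakCStarHopfAlgebra.comul_star', comul_of_mem_left ha, star_mul, star_comul_one]; simp

variable (A) in
/-- The right subalgebra as a `⋆`-subalgebra. -/
def rightStarSubalgebra : StarSubalgebra ℂ A where
  carrier := rightSubalg A
  mul_mem' {a b} ha hb := mem_right_of_comul <| by
    rw [comul_right_mul ha, comul_of_mem_right hb, ← mul_assoc]; simp
  one_mem' := mem_right_of_comul <| by rw [← Algebra.TensorProduct.one_def, one_mul]
  add_mem' {a b} ha hb := mem_right_of_comul <| by
    rw [map_add, comul_of_mem_right ha, comul_of_mem_right hb, TensorProduct.tmul_add, add_mul]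
  zero_mem' := mem_right_of_comul <| by simp
  algebraMap_mem' r := mem_right_of_comul <| by
    rw [Algebra.algebraMap_eq_smul_one, map_smul, TensorProduct.tmul_smul,
      ← Algebra.TensorProduct.one_def, smul_mul_assoc, one_mul]
  star_mem' {a} ha := mem_right_of_comul' <| by
    rw [WeakCStarHopfAlgebra.comul_star', comul_of_mem_right ha, star_mul, star_comul_one]; simp

/-- Slice the identity `(b ⊗ 1) Δ(1) = Δ(1) (b ⊗ 1)` by the functional that defines `c`. -/
theorem left_mul_right_comm {b c : A} (hb : b ∈ leftSubalg A) (hc : c ∈ rightSubalg A) :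
    b * c = c * b := by
  obtain ⟨φ, rfl⟩ := hb
  obtain ⟨ψ, rfl⟩ := hc
  have h1 : ∀ t : A ⊗[ℂ] A, TensorProduct.rid ℂ A (TensorProduct.map LinearMap.id ψ
      ((hatEpsL φ ⊗ₜ[ℂ] (1 : A)) * t)) =
      hatEpsL φ * TensorProduct.rid ℂ A (TensorProduct.map LinearMap.id ψ t) := by
    intro t
    induction t using TensorProduct.induction_on with
    | zero => simp
    | tmul a b => simp
    | add a b ha hb => simp only [mul_add, map_add, ha, hb]
  have h2 : ∀ t : A ⊗[ℂ] A, TensorProduct.rid ℂ A (TensorProduct.map LinearMap.id ψ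
      (t * (hatEpsL φ ⊗ₜ[ℂ] (1 : A)))) =
      TensorProduct.rid ℂ A (TensorProduct.map LinearMap.id ψ t) * hatEpsL φ := by
    intro t
    induction t using TensorProduct.induction_on with
    | zero => simp
    | tmul a b => simp
    | add a b ha hb => simp only [add_mul, map_add, ha, hb]
  rw [hatEpsR, ← h1, ← h2, ← comul_of_mem_left ⟨φ, rfl⟩, ← comul_of_mem_left' ⟨φ, rfl⟩]

end Algebra

/-! ### Convolution identities for the antipode -/

section Antipode

variable {A : Type*} [CStarAlgebra A] [WeakCStarHopfAlgebra A]

theorem conv_S_idConvS : conv S idConvS = (S : A →ₗ[ℂ] A) :=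
  LinearMap.ext WeakCStarHopfAlgebra.antipode_mul_id_mul_antipode

theorem conv_sConvId_S : conv sConvId S = (S : A →ₗ[ℂ] A) := by
  rw [sConvId_eq_conv, conv_assoc, ← idConvS_eq_conv, conv_S_idConvS]

/-- Inserting `S(y₁) y₂ = 1₁ ε(y 1₂)` gives `x₁ 1₁ ε(x₂ 1₂) = (id ⊗ ε)(Δ(x) Δ(1)) = x`. -/
theorem conv_id_sConvId : conv LinearMap.id sConvId = (LinearMap.id : A →ₗ[ℂ] A) := by
  have h1 : ∀ (a y : A) (s : A ⊗[ℂ] A), a * TensorProduct.rid ℂ A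
      (TensorProduct.map LinearMap.id (epsL y) s) = TensorProduct.rid ℂ A
      (TensorProduct.map LinearMap.id (counit (R := ℂ)) ((a ⊗ₜ[ℂ] y) * s)) := by
    intro a y s
    induction s using TensorProduct.induction_on with
    | zero => simp
    | tmul c d => simp
    | add c d hc hd => simp only [mul_add, map_add, hc, hd]
  have h2 : ∀ t : A ⊗[ℂ] A, LinearMap.mul' ℂ A (TensorProduct.map LinearMap.id sConvId t) =
      TensorProduct.rid ℂ A (TensorProduct.map LinearMap.id (counit (R := ℂ))
        (t * comul (R := ℂ) 1)) := by
    intro t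
    induction t using TensorProduct.induction_on with
    | zero => simp
    | tmul a y =>
      rw [← h1, TensorProduct.map_tmul, LinearMap.mul'_apply, sConvId_eq_hatEpsR]; rfl
    | add c d hc hd => simp only [add_mul, map_add, hc, hd]
  ext x
  rw [conv_apply, h2, comul_mul_comul_one, rid_map_counit_comul, LinearMap.id_apply]

theorem conv_idConvS_id : conv idConvS LinearMap.id = (LinearMap.id : A →ₗ[ℂ] A) := by
  rw [idConvS_eq_conv, conv_assoc, ← sConvId_eq_conv, conv_id_sConvId]

theorem idConvS_left_mul {b : A} (hb : b ∈ leftSubalg A) (x : A) :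
    idConvS (b * x) = b * idConvS x := by
  have : ∀ t : A ⊗[ℂ] A, LinearMap.mul' ℂ A (TensorProduct.map LinearMap.id S
      ((b ⊗ₜ[ℂ] (1 : A)) * t)) = b * LinearMap.mul' ℂ A (TensorProduct.map LinearMap.id S t) := by
    intro t
    induction t using TensorProduct.induction_on with
    | zero => simp
    | tmul c d => simp [mul_assoc]
    | add c d hc hd => simp only [mul_add, map_add, hc, hd]
  rw [idConvS_eq_conv, conv_apply, comul_left_mul hb, this]; rfl

theorem sConvId_mul_right {c : A} (hc : c ∈ rightSubalg A) (x : A) :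
    sConvId (x * c) = sConvId x * c := by
  have : ∀ t : A ⊗[ℂ] A, LinearMap.mul' ℂ A (TensorProduct.map S LinearMap.id
      (t * ((1 : A) ⊗ₜ[ℂ] c))) = LinearMap.mul' ℂ A (TensorProduct.map S LinearMap.id t) * c := by
    intro t
    induction t using TensorProduct.induction_on with
    | zero => simp
    | tmul c d => simp [mul_assoc]
    | add c d hc hd => simp only [add_mul, map_add, hc, hd]
  rw [sConvId_eq_conv, conv_apply, comul_mul_right hc, this]; rfl

theorem idConvS_one : idConvS (1 : A) = 1 := by
  have : epsR (1 : A) = counit (R := ℂ) := by ext; simp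
  rw [idConvS_eq_hatEpsL, this, hatEpsL, lid_map_counit_comul]

theorem sConvId_one : sConvId (1 : A) = 1 := by
  have : epsL (1 : A) = counit (R := ℂ) := by ext; simp
  rw [sConvId_eq_hatEpsR, this, hatEpsR, rid_map_counit_comul]

theorem idConvS_of_mem {b : A} (hb : b ∈ leftSubalg A) : idConvS b = b := by
  simpa [idConvS_one] using idConvS_left_mul hb 1

theorem sConvId_of_mem {c : A} (hc : c ∈ rightSubalg A) : sConvId c = c := by
  simpa [sConvId_one] using sConvId_mul_right hc 1

/-- `(id ⊗ f)(Δ(1))` depends only on the restriction of `f` to the left subalgebra. -/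
theorem map_id_idConvS_comul_one : TensorProduct.map LinearMap.id idConvS (comul (R := ℂ) (1 : A)) =
    comul (R := ℂ) (1 : A) := by
  let mid : A ⊗[ℂ] (A ⊗[ℂ] A) →ₗ[ℂ] A ⊗[ℂ] A := TensorProduct.map LinearMap.id
    ((TensorProduct.lid ℂ A).toLinearMap ∘ₗ TensorProduct.map (counit (R := ℂ)) LinearMap.id)
  have h1 : ∀ t : A ⊗[ℂ] A, mid (TensorProduct.map LinearMap.id (comul (R := ℂ)) t) = t := by
    intro t
    induction t using TensorProduct.induction_on with
    | zero => simp
    | tmul c d => simp [mid, lid_map_counit_comul]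
    | add c d hc hd => simp only [map_add, hc, hd]
  have h0 : ∀ (a y : A) (s : A ⊗[ℂ] A),
      mid (((1 : A) ⊗ₜ[ℂ] s) * (a ⊗ₜ[ℂ] (y ⊗ₜ[ℂ] (1 : A)))) =
      a ⊗ₜ TensorProduct.lid ℂ A (TensorProduct.map (epsR y) LinearMap.id s) := by
    intro a y s
    rw [← lid_map_counit_mul_tmul]
    simp [mid]
  have h2 : ∀ t : A ⊗[ℂ] A, mid (((1 : A) ⊗ₜ[ℂ] comul (R := ℂ) (1 : A)) *
      TensorProduct.assoc ℂ A A A (t ⊗ₜ[ℂ] (1 : A))) = TensorProduct.map LinearMap.id idConvS t := by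
    intro t
    induction t using TensorProduct.induction_on with
    | zero => simp
    | tmul a y =>
      rw [TensorProduct.assoc_tmul, h0, TensorProduct.map_tmul, idConvS_eq_hatEpsL]; rfl
    | add c d hc hd => simp only [map_add, TensorProduct.add_tmul, mul_add, hc, hd]
  -- For `t = Δ(1)` the product in `h2` is the iterated coproduct of `1`, and applying `ε` to its
  -- middle leg returns `Δ(1)`.
  rw [← h2, comul_one_mul_comul_one', h1]

theorem map_id_comul_one_congr {V : Type*} [AddCommGroup V] [Module ℂ V] {f g : A →ₗ[ℂ] V}
    (h : ∀ b ∈ leftSubalg A, f b = g b) :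
    TensorProduct.map (LinearMap.id : A →ₗ[ℂ] A) f (comul (R := ℂ) (1 : A)) =
      TensorProduct.map LinearMap.id g (comul (R := ℂ) (1 : A)) := by
  have h1 : f ∘ₗ idConvS = g ∘ₗ idConvS := LinearMap.ext fun x => h _ (idConvS_mem x)
  have h2 : ∀ k : A →ₗ[ℂ] V,
      TensorProduct.map (LinearMap.id : A →ₗ[ℂ] A) k (comul (R := ℂ) (1 : A)) =
      TensorProduct.map LinearMap.id (k ∘ₗ idConvS) (comul (R := ℂ) (1 : A)) := by
    intro k
    conv_lhs => rw [← map_id_idConvS_comul_one]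
    rw [← LinearMap.comp_apply, ← TensorProduct.map_comp, LinearMap.comp_id]
  rw [h2 f, h2 g, h1]

/-! ### The antipode is antimultiplicative -/

/-- Multiplication `A ⊗ A → A` intertwines the coproducts because `Δ` is multiplicative; no
compatibility with counits is needed. -/
theorem conv_comp_mul (f g : A →ₗ[ℂ] A) :
    conv (f ∘ₗ LinearMap.mul' ℂ A) (g ∘ₗ LinearMap.mul' ℂ A) = conv f g ∘ₗ LinearMap.mul' ℂ A := by
  have : ∀ t s : A ⊗[ℂ] A, LinearMap.mul' ℂ A (TensorProduct.map (f ∘ₗ LinearMap.mul' ℂ A)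
      (g ∘ₗ LinearMap.mul' ℂ A) (TensorProduct.AlgebraTensorModule.tensorTensorTensorComm ℂ ℂ ℂ ℂ
        A A A A (t ⊗ₜ s))) = LinearMap.mul' ℂ A (TensorProduct.map f g (t * s)) := by
    intro t s
    induction t using TensorProduct.induction_on with
    | zero => simp
    | tmul a b =>
      induction s using TensorProduct.induction_on with
      | zero => simp
      | tmul c d => simp
      | add c d hc hd => simp only [map_add, TensorProduct.tmul_add, mul_add, hc, hd]
    | add c d hc hd => simp only [map_add, TensorProduct.add_tmul, add_mul, hc, hd]
  refine TensorProduct.ext' fun x y => ?_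
  rw [conv_apply, TensorProduct.comul_tmul, this, ← WeakCStarHopfAlgebra.comul_mul']
  rfl

/-- `x ⊗ y ↦ ε(y) f(x)`. -/
def onLeft (f : A →ₗ[ℂ] A) : A ⊗[ℂ] A →ₗ[ℂ] A :=
  (TensorProduct.rid ℂ A).toLinearMap ∘ₗ TensorProduct.map f (counit (R := ℂ))

/-- `x ⊗ y ↦ ε(x) f(y)`. -/
def onRight (f : A →ₗ[ℂ] A) : A ⊗[ℂ] A →ₗ[ℂ] A :=
  (TensorProduct.lid ℂ A).toLinearMap ∘ₗ TensorProduct.map (counit (R := ℂ)) f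

@[simp] theorem onLeft_tmul (f : A →ₗ[ℂ] A) (x y : A) :
    onLeft f (x ⊗ₜ y) = counit (R := ℂ) y • f x := by simp [onLeft]

@[simp] theorem onRight_tmul (f : A →ₗ[ℂ] A) (x y : A) :
    onRight f (x ⊗ₜ y) = counit (R := ℂ) x • f y := by simp [onRight]

theorem conv_tmul_eq {f g : A ⊗[ℂ] A →ₗ[ℂ] A} {k : A ⊗[ℂ] A →ₗ[ℂ] A ⊗[ℂ] A →ₗ[ℂ] A}
    (h : ∀ a b c d, f (a ⊗ₜ c) * g (b ⊗ₜ d) = k (a ⊗ₜ b) (c ⊗ₜ d)) (x y : A) :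
    conv f g (x ⊗ₜ y) = k (comul (R := ℂ) x) (comul (R := ℂ) y) := by
  have : ∀ t s : A ⊗[ℂ] A, LinearMap.mul' ℂ A (TensorProduct.map f g
      (TensorProduct.AlgebraTensorModule.tensorTensorTensorComm ℂ ℂ ℂ ℂ
        A A A A (t ⊗ₜ s))) = k t s := by
    intro t s
    induction t using TensorProduct.induction_on with
    | zero => simp
    | tmul a b =>
      induction s using TensorProduct.induction_on with
      | zero => simp
      | tmul c d => simp [h]
      | add c d hc hd => simp only [map_add, TensorProduct.tmul_add, hc, hd]
    | add c d hc hd => simp only [map_add, TensorProduct.add_tmul, hc, hd, LinearMap.add_apply]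
  rw [conv_apply, TensorProduct.comul_tmul, this]

/-- The counit on the unused leg is a convolution idempotent, so `onLeft` is a convolution
homomorphism although `ε` need not be multiplicative. -/
theorem conv_onLeft_onLeft (f g : A →ₗ[ℂ] A) :
    conv (onLeft f) (onLeft g) = onLeft (conv f g) := by
  refine TensorProduct.ext' fun x y => ?_
  rw [conv_tmul_eq (k := (LinearMap.mul ℂ A).compl₁₂
    (LinearMap.mul' ℂ A ∘ₗ TensorProduct.map f g)
    (Algebra.linearMap ℂ A ∘ₗ counit (R := ℂ) ∘ₗ (TensorProduct.rid ℂ A).toLinearMap ∘ₗ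
      TensorProduct.map LinearMap.id (counit (R := ℂ))))]
  · simp [rid_map_counit_comul, conv_apply, Algebra.algebraMap_eq_smul_one]
  · intro a b c d
    simp [Algebra.algebraMap_eq_smul_one, smul_smul, mul_comm]

theorem conv_onRight_onRight (f g : A →ₗ[ℂ] A) :
    conv (onRight f) (onRight g) = onRight (conv f g) := by
  refine TensorProduct.ext' fun x y => ?_
  rw [conv_tmul_eq (k := (LinearMap.mul ℂ A).compl₁₂
    (Algebra.linearMap ℂ A ∘ₗ counit (R := ℂ) ∘ₗ (TensorProduct.rid ℂ A).toLinearMap ∘ₗ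
      TensorProduct.map LinearMap.id (counit (R := ℂ)))
    (LinearMap.mul' ℂ A ∘ₗ TensorProduct.map f g))]
  · simp [rid_map_counit_comul, conv_apply, Algebra.algebraMap_eq_smul_one]
  · intro a b c d
    simp [Algebra.algebraMap_eq_smul_one, smul_smul, mul_comm]

theorem conv_onLeft_onRight_tmul (f g : A →ₗ[ℂ] A) (x y : A) :
    conv (onLeft f) (onRight g) (x ⊗ₜ y) = f x * g y := by
  rw [conv_tmul_eq (k := (LinearMap.mul ℂ A).compl₁₂
    (f ∘ₗ (TensorProduct.rid ℂ A).toLinearMap ∘ₗ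
      TensorProduct.map LinearMap.id (counit (R := ℂ)))
    (g ∘ₗ (TensorProduct.lid ℂ A).toLinearMap ∘ₗ
      TensorProduct.map (counit (R := ℂ)) LinearMap.id))]
  · simp [rid_map_counit_comul, lid_map_counit_comul]
  · intro a b c d
    simp [smul_smul, mul_comm]

theorem conv_onRight_onLeft_tmul (f g : A →ₗ[ℂ] A) (x y : A) :
    conv (onRight f) (onLeft g) (x ⊗ₜ y) = f y * g x := by
  rw [conv_tmul_eq (k := ((LinearMap.mul ℂ A).compl₁₂
    (f ∘ₗ (TensorProduct.rid ℂ A).toLinearMap ∘ₗ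
      TensorProduct.map LinearMap.id (counit (R := ℂ)))
    (g ∘ₗ (TensorProduct.lid ℂ A).toLinearMap ∘ₗ
      TensorProduct.map (counit (R := ℂ)) LinearMap.id)).flip)]
  · simp [rid_map_counit_comul, lid_map_counit_comul]
  · intro a b c d
    simp [smul_smul, mul_comm]

/-- In the convolution algebra of maps `A ⊗ A → A`, both `x ⊗ y ↦ S(xy)` and `x ⊗ y ↦ S(y) S(x)` are
weak inverses of the multiplication with the same source and range maps, so `eq_of_conv_eq`
identifies them. -/
theorem S_mul (x y : A) : S (x * y) = S y * S x := by
  have hβ : ∀ a b : A, conv (onRight S) (onLeft S) (a ⊗ₜ b) = S b * S a :=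
    conv_onRight_onLeft_tmul S S
  have hm : LinearMap.mul' ℂ A = conv (onLeft LinearMap.id) (onRight LinearMap.id) :=
    TensorProduct.ext' fun a b => by rw [conv_onLeft_onRight_tmul]; simp
  have hα : S ∘ₗ LinearMap.mul' ℂ A = conv (onRight S) (onLeft S) := by
    refine eq_of_conv_eq (m := LinearMap.mul' ℂ A) ?_ ?_ ?_ ?_
    · have h1 := conv_comp_mul S (LinearMap.id : A →ₗ[ℂ] A)
      rw [LinearMap.id_comp] at h1
      rw [h1, ← sConvId_eq_conv]
      refine TensorProduct.ext' fun x y => ?_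
      -- The inner factor `S(x₁) x₂` lies in `A_R` and is absorbed into the second leg of `Δ(y)`,
      -- giving `sConvId (sConvId x * y)`.
      have h2 : ∀ t s : A ⊗[ℂ] A,
          LinearMap.mul' ℂ A (TensorProduct.map S LinearMap.id
            (((1 : A) ⊗ₜ LinearMap.mul' ℂ A (TensorProduct.map S LinearMap.id t)) * s)) =
          LinearMap.mul' ℂ A (TensorProduct.map (conv (onRight S) (onLeft S)) (LinearMap.mul' ℂ A)
            (TensorProduct.AlgebraTensorModule.tensorTensorTensorComm ℂ ℂ ℂ ℂ
              A A A A (t ⊗ₜ s))) := by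
        intro t s
        induction t using TensorProduct.induction_on with
        | zero => simp
        | tmul a b =>
          induction s using TensorProduct.induction_on with
          | zero => simp
          | tmul c d => simp [hβ, mul_assoc]
          | add c d hc hd => simp only [map_add, TensorProduct.tmul_add, mul_add, hc, hd]
        | add c d hc hd =>
          simp only [map_add, TensorProduct.add_tmul, TensorProduct.tmul_add, add_mul, hc, hd]
      rw [conv_apply, TensorProduct.comul_tmul, ← h2, ← conv_apply, ← sConvId_eq_conv,
        ← comul_right_mul (sConvId_mem x), ← conv_apply, ← sConvId_eq_conv, sConvId_sConvId_mul]
      rfl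
    · have h1 := conv_comp_mul (LinearMap.id : A →ₗ[ℂ] A) S
      rw [LinearMap.id_comp] at h1
      rw [h1, ← idConvS_eq_conv]
      refine TensorProduct.ext' fun x y => ?_
      have h2 : ∀ t s : A ⊗[ℂ] A,
          LinearMap.mul' ℂ A (TensorProduct.map LinearMap.id S
            (t * (LinearMap.mul' ℂ A (TensorProduct.map LinearMap.id S s) ⊗ₜ (1 : A)))) =
          LinearMap.mul' ℂ A (TensorProduct.map (LinearMap.mul' ℂ A) (conv (onRight S) (onLeft S))
            (TensorProduct.AlgebraTensorModule.tensorTensorTensorComm ℂ ℂ ℂ ℂ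
              A A A A (t ⊗ₜ s))) := by
        intro t s
        induction t using TensorProduct.induction_on with
        | zero => simp
        | tmul a b =>
          induction s using TensorProduct.induction_on with
          | zero => simp
          | tmul c d => simp [hβ, mul_assoc]
          | add c d hc hd =>
            simp only [map_add, TensorProduct.tmul_add, TensorProduct.add_tmul, mul_add, hc, hd]
        | add c d hc hd =>
          simp only [map_add, TensorProduct.add_tmul, add_mul, hc, hd]
      rw [conv_apply, TensorProduct.comul_tmul, ← h2, ← conv_apply, ← idConvS_eq_conv,
        ← comul_mul_left (idConvS_mem y), ← conv_apply, ← idConvS_eq_conv, idConvS_mul_idConvS]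
      rfl
    · have h1 := conv_comp_mul S (LinearMap.id : A →ₗ[ℂ] A)
      rw [LinearMap.id_comp] at h1
      rw [h1, ← sConvId_eq_conv, conv_comp_mul, conv_sConvId_S]
    -- Commutation of `A_L` with `A_R` swaps the two middle factors, after which each outer `S`
    -- absorbs its neighbour.
    · have hc : conv (onLeft sConvId) (onRight idConvS) =
          conv (onRight idConvS) (onLeft (sConvId : A →ₗ[ℂ] A)) :=
        TensorProduct.ext' fun a b => by
          rw [conv_onLeft_onRight_tmul, conv_onRight_onLeft_tmul,
            left_mul_right_comm (idConvS_mem b) (sConvId_mem a)]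
      calc conv (conv (conv (onRight S) (onLeft S)) (LinearMap.mul' ℂ A))
              (conv (onRight S) (onLeft S))
          = conv (onRight S) (conv (conv (onLeft (conv S LinearMap.id))
              (onRight (conv LinearMap.id S))) (onLeft S)) := by
            rw [hm, ← conv_onLeft_onLeft, ← conv_onRight_onRight]
            simp only [conv_assoc]
        _ = conv (onRight (conv S idConvS)) (onLeft (conv sConvId S)) := by
            rw [← sConvId_eq_conv, ← idConvS_eq_conv, hc, ← conv_onLeft_onLeft,
              ← conv_onRight_onRight]
            simp only [conv_assoc]
        _ = _ := by rw [conv_S_idConvS, conv_sConvId_S]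
  have := LinearMap.congr_fun hα (x ⊗ₜ y)
  rwa [hβ, LinearMap.comp_apply, LinearMap.mul'_apply] at this

/-- From `Δ(b) = Δ(1)(b ⊗ 1)` one gets `S(b₁) b₂ = S(b) S(1₁) 1₂ = S(b)`. -/
theorem S_of_mem_left {b : A} (hb : b ∈ leftSubalg A) : S b = sConvId b := by
  have : ∀ t : A ⊗[ℂ] A, LinearMap.mul' ℂ A (TensorProduct.map S LinearMap.id
      (t * (b ⊗ₜ[ℂ] (1 : A)))) = S b * LinearMap.mul' ℂ A (TensorProduct.map S LinearMap.id t) := by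
    intro t
    induction t using TensorProduct.induction_on with
    | zero => simp
    | tmul c d => simp [S_mul, mul_assoc]
    | add c d hc hd => simp only [add_mul, mul_add, map_add, hc, hd]
  rw [sConvId_eq_conv, conv_apply, comul_of_mem_left' hb, this, ← conv_apply, ← sConvId_eq_conv,
    sConvId_one, mul_one]

theorem S_of_mem_right {c : A} (hc : c ∈ rightSubalg A) : S c = idConvS c := by
  have : ∀ t : A ⊗[ℂ] A, LinearMap.mul' ℂ A (TensorProduct.map LinearMap.id S
      (((1 : A) ⊗ₜ[ℂ] c) * t)) = LinearMap.mul' ℂ A (TensorProduct.map LinearMap.id S t) * S c := by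
    intro t
    induction t using TensorProduct.induction_on with
    | zero => simp
    | tmul c d => simp [S_mul, mul_assoc]
    | add c d hc hd => simp only [add_mul, mul_add, map_add, hc, hd]
  rw [idConvS_eq_conv, conv_apply, comul_of_mem_right hc, this, ← conv_apply, ← idConvS_eq_conv,
    idConvS_one, one_mul]

theorem idConvS_star_sConvId_star (x : A) : idConvS (star (sConvId (star x))) = idConvS x :=
  idConvS_eq_of_epsR_eq fun z => by
    rw [← star_star z, ← star_mul, counit_star, counit_sConvId_mul, ← counit_star, star_mul,
      star_star, star_star]

theorem sConvId_star_idConvS_star (x : A) : sConvId (star (idConvS (star x))) = sConvId x :=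
  sConvId_eq_of_epsL_eq fun z => by
    rw [← star_star z, ← star_mul, counit_star, counit_mul_idConvS, ← counit_star, star_mul,
      star_star, star_star]

/-- `x ↦ S(f(x⋆)⋆)`. -/
def conjS (f : A →ₗ[ℂ] A) : A →ₗ[ℂ] A where
  toFun x := S (star (f (star x)))
  map_add' x y := by simp
  map_smul' c x := by simp

@[simp] theorem conjS_apply (f : A →ₗ[ℂ] A) (x : A) : conjS f x = S (star (f (star x))) := rfl

/-- The composite of `⋆` and `S`, both antimultiplicative, is multiplicative. -/
theorem conjS_conv (f g : A →ₗ[ℂ] A) : conjS (conv f g) = conv (conjS f) (conjS g) := by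
  have : ∀ t : A ⊗[ℂ] A, S (star (LinearMap.mul' ℂ A (TensorProduct.map f g (star t)))) =
      LinearMap.mul' ℂ A (TensorProduct.map (conjS f) (conjS g) t) := by
    intro t
    induction t using TensorProduct.induction_on with
    | zero => simp
    | tmul a b => simp [S_mul]
    | add a b ha hb => simp only [star_add, map_add, ha, hb]
  ext x
  rw [conjS_apply, conv_apply, conv_apply, WeakCStarHopfAlgebra.comul_star', this]

/-- The operation `conjS` sends `id` to `S` and exchanges `sConvId` with `idConvS`. Applied to `S *
idConvS = S` (convolution), it gives `conjS S = (conjS S * S) * id = idConvS * id = id`. -/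
theorem S_star_S_star (x : A) : S (star (S (star x))) = x := by
  have h0 : conjS LinearMap.id = (S : A →ₗ[ℂ] A) := by ext; simp
  have hR : conjS (sConvId : A →ₗ[ℂ] A) = idConvS := LinearMap.ext fun y => by
    rw [conjS_apply, S_of_mem_right ((rightStarSubalgebra A).star_mem' (sConvId_mem _)),
      idConvS_star_sConvId_star]
  have hL : conjS (idConvS : A →ₗ[ℂ] A) = sConvId := LinearMap.ext fun y => by
    rw [conjS_apply, S_of_mem_left ((leftStarSubalgebra A).star_mem' (idConvS_mem _)),
      sConvId_star_idConvS_star]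
  have h1 : conv (conjS S) S = (idConvS : A →ₗ[ℂ] A) := by
    rw [← hR, sConvId_eq_conv, conjS_conv, h0]
  have h3 : conjS S = (LinearMap.id : A →ₗ[ℂ] A) := by
    have h4 := congrArg conjS (conv_S_idConvS (A := A))
    rw [conjS_conv, hL, sConvId_eq_conv, ← conv_assoc, h1, conv_idConvS_id] at h4
    exact h4.symm
  exact LinearMap.congr_fun h3 x

theorem S_star_S (x : A) : S (star (S x)) = star x := by
  simpa using S_star_S_star (star x)

theorem star_S_star_S (x : A) : star (S (star (S x))) = x := by
  rw [S_star_S, star_star]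

theorem S_surjective : Function.Surjective (S : A →ₗ[ℂ] A) := fun x => ⟨_, S_star_S_star x⟩

theorem S_injective : Function.Injective (S : A →ₗ[ℂ] A) := fun x y h => by
  rw [← star_S_star_S x, h, star_S_star_S]

/-! ### Integrals -/

/-- Write `sConvId x₁ = 1₁ ε(x₁ 1₂)`. The second leg of `Δ(1)` may be taken in `A_L`, and for `b`
there `ε(x₁ b) x₂` is the counit applied to `Δ(xb)`, that is `xb`. -/
theorem map_sConvId_id_comul (x : A) :
    TensorProduct.map sConvId LinearMap.id (comul (R := ℂ) x) =
      ((1 : A) ⊗ₜ[ℂ] x) * comul (R := ℂ) (1 : A) := by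
  let f : A ⊗[ℂ] A →ₗ[ℂ] A →ₗ[ℂ] A := LinearMap.mk₂ ℂ
    (fun t b => TensorProduct.lid ℂ A (TensorProduct.map (counit (R := ℂ)) LinearMap.id
      (t * (b ⊗ₜ[ℂ] (1 : A)))))
    (by intros; simp [add_mul]) (by intros; simp) (by intros; simp [mul_add, TensorProduct.add_tmul])
    (by intros; simp [← TensorProduct.smul_tmul'])
  have h1 : ∀ (a y : A) (s : A ⊗[ℂ] A), TensorProduct.rid ℂ A
      (TensorProduct.map LinearMap.id (epsL a) s) ⊗ₜ[ℂ] y =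
      TensorProduct.map LinearMap.id (f (a ⊗ₜ y)) s := by
    intro a y s
    induction s using TensorProduct.induction_on with
    | zero => simp
    | tmul c d => simp [f, TensorProduct.smul_tmul]
    | add c d hc hd => simp only [TensorProduct.add_tmul, map_add, hc, hd]
  have h2 : ∀ t : A ⊗[ℂ] A, TensorProduct.map sConvId LinearMap.id t =
      TensorProduct.map LinearMap.id (f t) (comul (R := ℂ) (1 : A)) := by
    intro t
    induction t using TensorProduct.induction_on with
    | zero => simp
    | tmul a y => rw [← h1, TensorProduct.map_tmul, sConvId_eq_hatEpsR]; rfl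
    | add c d hc hd =>
      simp only [map_add, hc, hd, TensorProduct.map_add_right, LinearMap.add_apply]
  have h3 : ∀ s : A ⊗[ℂ] A, TensorProduct.map LinearMap.id (LinearMap.mulLeft ℂ x) s =
      ((1 : A) ⊗ₜ[ℂ] x) * s := by
    intro s
    induction s using TensorProduct.induction_on with
    | zero => simp
    | tmul a y => simp
    | add c d hc hd => simp only [map_add, hc, hd, mul_add]
  rw [h2, ← h3]
  refine map_id_comul_one_congr fun b hb => ?_
  change TensorProduct.lid ℂ A (TensorProduct.map (counit (R := ℂ)) LinearMap.id
      (comul (R := ℂ) x * (b ⊗ₜ[ℂ] (1 : A)))) = _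
  rw [← comul_mul_left hb, lid_map_counit_comul]
  rfl

/-- Expand `S(x)` as `S(x₁) idConvS(x₂)`. The integral property replaces `idConvS(x₂) ⊗ 1` before
`Δ(l)` by `Δ(x₂)`, and `S(x₁) x₂ ⊗ x₃ = (1 ⊗ x) Δ(1)`. The maps `i1` and `i2` embed the two legs, so
that this is a computation with convolutions into `A ⊗ A`. -/
theorem tmul_comul_leftIntegral {l : A} (hl : l ∈ leftIntegrals A) (x : A) :
    ((1 : A) ⊗ₜ[ℂ] x) * comul (R := ℂ) l = (S x ⊗ₜ[ℂ] (1 : A)) * comul (R := ℂ) l := by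
  let i1 : A →ₗ[ℂ] A ⊗[ℂ] A := (TensorProduct.mk ℂ A A).flip 1
  let i2 : A →ₗ[ℂ] A ⊗[ℂ] A := TensorProduct.mk ℂ A A 1
  have hi : ∀ f g : A →ₗ[ℂ] A, conv (i1 ∘ₗ f) (i1 ∘ₗ g) = i1 ∘ₗ conv f g := by
    intro f g
    have : ∀ t : A ⊗[ℂ] A, LinearMap.mul' ℂ _ (TensorProduct.map (i1 ∘ₗ f) (i1 ∘ₗ g) t) =
        i1 (LinearMap.mul' ℂ A (TensorProduct.map f g t)) := by
      intro t
      induction t using TensorProduct.induction_on with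
      | zero => simp
      | tmul a y => simp [i1]
      | add c d hc hd => simp only [map_add, hc, hd]
    exact LinearMap.ext fun x => this _
  have hi2 : ∀ f : A →ₗ[ℂ] A, ∀ t : A ⊗[ℂ] A,
      LinearMap.mul' ℂ _ (TensorProduct.map (i1 ∘ₗ f) i2 t) =
      TensorProduct.map f LinearMap.id t := by
    intro f t
    induction t using TensorProduct.induction_on with
    | zero => simp
    | tmul a y => simp [i1, i2]
    | add c d hc hd => simp only [map_add, hc, hd]
  have h12 : conv i1 i2 = comul (R := ℂ) := LinearMap.ext fun y => by
    rw [conv_apply, ← LinearMap.comp_id i1, hi2, TensorProduct.map_id, LinearMap.id_apply]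
  have h3 : ∀ t : A ⊗[ℂ] A,
      LinearMap.mul' ℂ _ (TensorProduct.map (i1 ∘ₗ S) (i1 ∘ₗ idConvS) t) * comul (R := ℂ) l =
      LinearMap.mul' ℂ _ (TensorProduct.map (i1 ∘ₗ S) (comul (R := ℂ)) t) * comul (R := ℂ) l := by
    intro t
    induction t using TensorProduct.induction_on with
    | zero => simp
    | tmul a y =>
      have : i1 (idConvS y) * comul (R := ℂ) l = comul (R := ℂ) y * comul (R := ℂ) l := by
        rw [← WeakCStarHopfAlgebra.comul_mul', hl y, comul_left_mul (idConvS_mem y)]; rfl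
      simp [mul_assoc, this]
    | add c d hc hd => simp only [map_add, hc, hd, add_mul]
  have h4 : conv (i1 ∘ₗ S) (comul (R := ℂ)) x = ((1 : A) ⊗ₜ[ℂ] x) * comul (R := ℂ) (1 : A) := by
    have h6 := hi S LinearMap.id
    rw [LinearMap.comp_id, ← sConvId_eq_conv] at h6
    have h7 : conv (i1 ∘ₗ S) (comul (R := ℂ)) = conv (i1 ∘ₗ sConvId) i2 := by
      rw [← h12, ← conv_assoc, h6]
    rw [h7, conv_apply, hi2, map_sConvId_id_comul]
  have h5 : S x ⊗ₜ[ℂ] (1 : A) = conv (i1 ∘ₗ S) (i1 ∘ₗ idConvS) x := by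
    rw [hi, conv_S_idConvS]; rfl
  rw [h5, conv_apply, h3, ← conv_apply, h4, mul_assoc, comul_one_mul_comul]

end Antipode

/-! ### Positive tensors and finite dimensional inner products -/

section LinearAlgebra

theorem posSemidef_of_forall_nonneg {n : Type*} [Fintype n] [DecidableEq n] {M : Matrix n n ℂ}
    (h : ∀ v : n → ℂ, 0 ≤ star v ⬝ᵥ (M.mulVec v)) : M.PosSemidef := by
  rw [← Matrix.isPositive_toEuclideanLin_iff, LinearMap.isPositive_iff_complex]
  intro x
  have h1 : ⟪M.toEuclideanLin x, x⟫_ℂ = star (star x.ofLp ⬝ᵥ (M.mulVec x.ofLp)) := by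
    rw [EuclideanSpace.inner_eq_star_dotProduct]
    change x.ofLp ⬝ᵥ star (M.mulVec x.ofLp) = _
    simp [dotProduct]
  obtain ⟨h2, h3⟩ := Complex.nonneg_iff.1 (h x.ofLp)
  rw [h1]
  refine ⟨Complex.ext ?_ ?_, ?_⟩
  · simp
  · simp [← h3]
  · simpa using h2

/-- A tensor which is positive as a sesquilinear form on the dual is a sum of `a⋆ ⊗ a`. -/
theorem exists_eq_sum_star_tmul {A : Type*} [Ring A] [StarRing A] [Algebra ℂ A] [StarModule ℂ A]
    [FiniteDimensional ℂ A] (t : A ⊗[ℂ] A) (Q : Module.Dual ℂ A → A ⊗[ℂ] A →ₗ[ℂ] ℂ)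
    (hQ : ∀ φ a b, Q φ (a ⊗ₜ b) = star (φ (star a)) * φ b) (h : ∀ φ, 0 ≤ Q φ t) :
    ∃ (m : ℕ) (a : Fin m → A), t = ∑ i, star (a i) ⊗ₜ[ℂ] a i := by
  classical
  let b := Module.finBasis ℂ A
  have h1 : ∀ s : A ⊗[ℂ] A, ∃ M : Matrix _ _ ℂ, s = ∑ i, ∑ j, M i j • (star (b i) ⊗ₜ[ℂ] b j) := by
    intro s
    induction s using TensorProduct.induction_on with
    | zero => exact ⟨0, by simp⟩
    | tmul x y =>
      refine ⟨fun i j => star (b.repr (star x) i) * b.repr y j, ?_⟩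
      have hx : x = ∑ i, star (b.repr (star x) i) • star (b i) := by
        have := congrArg star (b.sum_repr (star x))
        simp only [star_sum, star_smul, star_star] at this
        exact this.symm
      conv_lhs => rw [hx, ← b.sum_repr y]
      simp only [TensorProduct.sum_tmul, TensorProduct.tmul_sum, TensorProduct.smul_tmul_smul]
      exact Finset.sum_comm
    | add s s' hs hs' =>
      obtain ⟨M, hM⟩ := hs
      obtain ⟨M', hM'⟩ := hs'
      refine ⟨M + M', ?_⟩
      rw [hM, hM']
      simp [add_smul, Finset.sum_add_distrib]
  obtain ⟨M, rfl⟩ := h1 t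
  -- Functionals correspond to coordinate vectors through `b.constr`, and the form `Q φ` becomes the
  -- quadratic form of `M`.
  have hM : M.PosSemidef := by
    refine posSemidef_of_forall_nonneg fun v => ?_
    have h2 := h (b.constr ℂ v)
    simp only [map_sum, map_smul, hQ, star_star, Module.Basis.constr_basis, smul_eq_mul] at h2
    convert h2 using 1
    simp only [dotProduct, Matrix.mulVec, Finset.mul_sum, Pi.star_apply]
    refine Finset.sum_congr rfl fun i _ => Finset.sum_congr rfl fun j _ => by ring
  obtain ⟨m, u, rfl⟩ := Matrix.posSemidef_iff_eq_sum_vecMulVec.1 hM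
  refine ⟨m, fun k => ∑ j, star (u k j) • b j, ?_⟩
  simp only [star_sum, star_smul, star_star, TensorProduct.sum_tmul, TensorProduct.tmul_sum,
    TensorProduct.smul_tmul_smul, Matrix.sum_apply, Matrix.vecMulVec_apply, Pi.star_apply,
    Finset.sum_smul]
  rw [Finset.sum_comm]
  exact (Finset.sum_congr rfl fun _ _ => Finset.sum_comm).trans Finset.sum_comm

/-- A finite dimensional space with a definite inner product has an orthonormal basis. -/
theorem exists_orthonormal_basis_of_core {V : Type*} [AddCommGroup V] [Module ℂ V]
    [FiniteDimensional ℂ V] (c : InnerProductSpace.Core ℂ V) :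
    ∃ (n : ℕ) (b : Module.Basis (Fin n) ℂ V), ∀ i j, c.inner (b i) (b j) = if i = j then 1 else 0 := by
  let _ : NormedAddCommGroup V := c.toNormedAddCommGroup
  let _ : InnerProductSpace ℂ V := InnerProductSpace.ofCore c.toCore
  refine ⟨_, (stdOrthonormalBasis ℂ V).toBasis, fun i j => ?_⟩
  have := orthonormal_iff_ite.1 (stdOrthonormalBasis ℂ V).orthonormal i j
  simpa using this

end LinearAlgebra

/-! ### Finite dimensional C⋆-algebras: finite spectra and projections -/

section FiniteDimensionalCStar

variable {A : Type*} [CStarAlgebra A] [FiniteDimensional ℂ A]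

/-- An element is invertible once left multiplication by it is, so the spectrum sits inside that of
an endomorphism. Finiteness makes every function continuous on the spectrum for the functional
calculus. -/
theorem finite_spectrum_of_finiteDimensional (a : A) : (spectrum ℂ a).Finite := by
  refine (Module.End.finite_spectrum (LinearMap.mulLeft ℂ a)).subset fun z hz => ?_
  rw [spectrum.mem_iff] at hz ⊢
  intro h
  apply hz
  have h1 : algebraMap ℂ (Module.End ℂ A) z - LinearMap.mulLeft ℂ a =
      LinearMap.mulLeft ℂ (algebraMap ℂ A z - a) := by
    ext x; simp [sub_mul, Algebra.algebraMap_eq_smul_one]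
  rw [h1, Module.End.isUnit_iff] at h
  obtain ⟨x, hx⟩ := h.2 1
  have hx : (algebraMap ℂ A z - a) * x = 1 := hx
  refine ⟨⟨_, x, hx, h.1 ?_⟩, rfl⟩
  simp only [LinearMap.mulLeft_apply]
  rw [← mul_assoc, hx, one_mul, mul_one]

theorem finite_real_spectrum_of_finiteDimensional (a : A) : (spectrum ℝ a).Finite := by
  have : spectrum ℝ a = (algebraMap ℝ ℂ) ⁻¹' (spectrum ℂ a) := by
    ext x; exact (spectrum.algebraMap_mem_iff ℂ).symm
  rw [this]
  exact (finite_spectrum_of_finiteDimensional a).preimage (FaithfulSMul.algebraMap_injective ℝ ℂ).injOn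

variable [PartialOrder A] [StarOrderedRing A]

theorem eq_zero_of_sum_star_mul_self_eq_zero {ι : Type*} [Fintype ι] {x : ι → A}
    (h : ∑ i, star (x i) * x i = 0) (i : ι) : x i = 0 := by
  have := (Finset.sum_eq_zero_iff_of_nonneg (fun i _ => star_mul_self_nonneg (x i))).1 h i
    (Finset.mem_univ i)
  exact CStarRing.star_mul_self_eq_zero_iff _ |>.1 this

/-- Every left ideal of a finite dimensional C⋆-algebra is generated by a projection. -/
theorem exists_projection_of_leftIdeal (J : Submodule ℂ A) (hJ : ∀ a, ∀ x ∈ J, a * x ∈ J) :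
    ∃ h : A, star h = h ∧ h * h = h ∧ ∀ x, x ∈ J ↔ x * h = 0 := by
  let b := Module.finBasis ℂ J
  -- The element `c` lies in `J` and has the common kernel of all `b i`; `h` will be its spectral
  -- projection at `0`.
  let c : A := ∑ i, star (b i : A) * b i
  have hc : IsSelfAdjoint c := by
    simp [IsSelfAdjoint, c]
  have hcJ : c ∈ J := J.sum_mem fun i _ => hJ _ _ (b i).2
  have hcont : ∀ f : ℝ → ℝ, ContinuousOn f (spectrum ℝ c) := fun f =>
    (finite_real_spectrum_of_finiteDimensional c).continuousOn f
  let f : ℝ → ℝ := fun x => if x = 0 then 1 else 0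
  let h := cfc f c
  have hstar : star h = h := (cfc_predicate f c : IsSelfAdjoint (cfc f c))
  have hch : c * h = 0 := by
    have h1 : cfc (fun x : ℝ => x * f x) c = c * h := by
      rw [cfc_mul _ _ _ (hcont _) (hcont _), cfc_id' ℝ c]
    rw [← h1]
    have : (fun x : ℝ => x * f x) = fun _ => 0 := by
      ext x; by_cases hx : x = 0 <;> simp [f, hx]
    rw [this, cfc_const_zero]
  have hhh : h * h = h := by
    rw [← cfc_mul _ _ _ (hcont _) (hcont _)]
    congr 1
    ext x; by_cases hx : x = 0 <;> simp [f, hx]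
  have h1h : 1 - h ∈ J := by
    -- With the convention `0⁻¹ = 0`, the function `x⁻¹ * x` is the indicator of `x ≠ 0`.
    have h1 : 1 - h = cfc (fun x : ℝ => x⁻¹) c * c := by
      have h2 : cfc (fun x : ℝ => x⁻¹ * x) c = cfc (fun x : ℝ => x⁻¹) c * c := by
        rw [cfc_mul _ _ _ (hcont _) (hcont _), cfc_id' ℝ c]
      rw [← h2, ← cfc_const_one ℝ c, ← cfc_sub _ _ _ (hcont _) (hcont _)]
      congr 1
      ext x; by_cases hx : x = 0 <;> simp [f, hx]
    rw [h1]
    exact hJ _ _ hcJ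
  have hb : ∀ i, (b i : A) * h = 0 := by
    apply eq_zero_of_sum_star_mul_self_eq_zero
    calc ∑ i, star ((b i : A) * h) * (b i * h) = star h * (c * h) := by
          simp only [c, star_mul, Finset.mul_sum, Finset.sum_mul, mul_assoc]
      _ = 0 := by rw [hch, mul_zero]
  refine ⟨h, hstar, hhh, fun x => ⟨fun hx => ?_, fun hx => ?_⟩⟩
  · have : x = ∑ i, b.repr ⟨x, hx⟩ i • (b i : A) := by
      have := congrArg J.subtype (b.sum_repr ⟨x, hx⟩)
      rw [map_sum] at this
      exact this.symm
    rw [this, Finset.sum_mul]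
    simp [hb]
  · have : x = x * (1 - h) := by rw [mul_sub, mul_one, hx, sub_zero]
    rw [this]
    exact hJ _ _ h1h

/-! ### A faithful trace -/

variable (A) in
/-- The sum of the traces of the left and right regular representations. -/
def regTrace : A →ₗ[ℂ] ℂ :=
  LinearMap.trace ℂ A ∘ₗ (LinearMap.mul ℂ A + (LinearMap.mul ℂ A).flip)

theorem regTrace_apply (x : A) : regTrace A x =
    LinearMap.trace ℂ A (LinearMap.mulLeft ℂ x) + LinearMap.trace ℂ A (LinearMap.mulRight ℂ x) := by
  simp only [regTrace, LinearMap.comp_apply, LinearMap.add_apply, map_add]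
  rfl

theorem regTrace_mul_comm (x y : A) : regTrace A (x * y) = regTrace A (y * x) := by
  rw [regTrace_apply, regTrace_apply, LinearMap.mulLeft_mul, LinearMap.mulLeft_mul,
    LinearMap.mulRight_mul, LinearMap.mulRight_mul]
  congr 1
  · exact LinearMap.trace_mul_comm ℂ (LinearMap.mulLeft ℂ x) (LinearMap.mulLeft ℂ y)
  · exact LinearMap.trace_mul_comm ℂ (LinearMap.mulRight ℂ y) (LinearMap.mulRight ℂ x)

theorem roots_charpoly_nonneg {f : Module.End ℂ A} {b : A} (hb : 0 ≤ b)
    (hf : ∀ z : ℂ, IsUnit (algebraMap ℂ A z - b) → Function.Injective (algebraMap ℂ (Module.End ℂ A) z - f)) :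
    ∀ z ∈ f.charpoly.roots, 0 ≤ z := by
  intro z hz
  have h1 := (Polynomial.mem_roots'.1 hz).2
  rw [← Module.End.mem_spectrum_iff_isRoot_charpoly] at h1
  refine spectrum_nonneg_of_nonneg hb ?_
  rw [spectrum.mem_iff] at h1 ⊢
  intro h2
  exact h1 ((Module.End.isUnit_iff _).2
    ⟨hf z h2, LinearMap.injective_iff_surjective.1 (hf z h2)⟩)

theorem trace_eq_sum_roots (f : Module.End ℂ A) :
    LinearMap.trace ℂ A f = f.charpoly.roots.sum :=
  Module.End.trace_eq_sum_roots_charpoly_of_splits (IsAlgClosed.splits _)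

theorem mulLeft_injective_of_isUnit {b : A} (z : ℂ) (h : IsUnit (algebraMap ℂ A z - b)) :
    Function.Injective (algebraMap ℂ (Module.End ℂ A) z - LinearMap.mulLeft ℂ b) := by
  have h1 : algebraMap ℂ (Module.End ℂ A) z - LinearMap.mulLeft ℂ b =
      LinearMap.mulLeft ℂ (algebraMap ℂ A z - b) := by
    ext x; simp [sub_mul, Algebra.algebraMap_eq_smul_one]
  rw [h1]
  exact h.mul_right_injective

theorem mulRight_injective_of_isUnit {b : A} (z : ℂ) (h : IsUnit (algebraMap ℂ A z - b)) :
    Function.Injective (algebraMap ℂ (Module.End ℂ A) z - LinearMap.mulRight ℂ b) := by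
  have h1 : algebraMap ℂ (Module.End ℂ A) z - LinearMap.mulRight ℂ b =
      LinearMap.mulRight ℂ (algebraMap ℂ A z - b) := by
    ext x; simp [mul_sub, Algebra.algebraMap_eq_smul_one]
  rw [h1]
  exact h.mul_left_injective

theorem regTrace_nonneg {b : A} (hb : 0 ≤ b) : 0 ≤ regTrace A b := by
  rw [regTrace_apply, trace_eq_sum_roots, trace_eq_sum_roots]
  exact add_nonneg
    (Multiset.sum_nonneg (roots_charpoly_nonneg hb mulLeft_injective_of_isUnit))
    (Multiset.sum_nonneg (roots_charpoly_nonneg hb mulRight_injective_of_isUnit))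

/-- A vanishing sum of nonnegative eigenvalues makes left multiplication by `b` nilpotent, so `b` is
nilpotent. A self-adjoint nilpotent is zero by the C⋆-identity, applied to the power `2 ^ k ≥ k`. -/
theorem eq_zero_of_regTrace_eq_zero {b : A} (hb : 0 ≤ b) (h : regTrace A b = 0) : b = 0 := by
  have hL := roots_charpoly_nonneg hb mulLeft_injective_of_isUnit
  have hR := roots_charpoly_nonneg hb mulRight_injective_of_isUnit
  rw [regTrace_apply, trace_eq_sum_roots, trace_eq_sum_roots,
    add_eq_zero_iff_of_nonneg (Multiset.sum_nonneg hL) (Multiset.sum_nonneg hR)] at h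
  have h1 : ∀ z ∈ (LinearMap.mulLeft ℂ b).charpoly.roots, z = 0 := by
    intro z hz
    refine le_antisymm ?_ (hL z hz)
    rw [← h.1]
    exact Multiset.single_le_sum hL z hz
  have h2 : (LinearMap.mulLeft ℂ b).charpoly = Polynomial.X ^ (Module.finrank ℂ A) := by
    have h3 := (IsAlgClosed.splits (LinearMap.mulLeft ℂ b).charpoly).eq_prod_roots_of_monic
      (LinearMap.charpoly_monic _)
    rw [h3, Multiset.map_congr rfl (g := fun _ => Polynomial.X) (fun z hz => by rw [h1 z hz]; simp),
      Multiset.map_const', Multiset.prod_replicate]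
    congr 1
    rw [← LinearMap.charpoly_natDegree (LinearMap.mulLeft ℂ b)]
    exact ((IsAlgClosed.splits _).natDegree_eq_card_roots).symm
  rw [← LinearMap.isNilpotent_iff_charpoly] at h2
  obtain ⟨k, hk⟩ := h2
  have h4 : b ^ k = 0 := by
    have := LinearMap.congr_fun hk 1
    rwa [LinearMap.pow_mulLeft, LinearMap.mulLeft_apply, mul_one] at this
  have hsa : IsSelfAdjoint b := IsSelfAdjoint.of_nonneg hb
  have h5 := hsa.nnnorm_pow_two_pow k
  rw [← Nat.sub_add_cancel k.lt_two_pow_self.le, pow_add b, h4, mul_zero, nnnorm_zero] at h5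
  exact nnnorm_eq_zero.1 (eq_zero_of_pow_eq_zero h5.symm)

/-- Polarization: the trace is real on `y⋆y` for `y = 1`, `x`, `1 + x` and `1 + ix`. -/
theorem regTrace_star (x : A) : regTrace A (star x) = star (regTrace A x) := by
  have hre : ∀ y : A, star (regTrace A (star y * y)) = regTrace A (star y * y) := fun y =>
    (IsSelfAdjoint.of_nonneg (regTrace_nonneg (star_mul_self_nonneg y)))
  have h0 := hre x
  have h1 := hre 1
  have h2 := hre (1 + x)
  have h3 := hre (1 + Complex.I • x)
  have e2 : regTrace A (star (1 + x) * (1 + x)) = regTrace A (star 1 * 1) + regTrace A (star x) +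
      regTrace A x + regTrace A (star x * x) := by
    simp only [star_add, star_one, mul_add, add_mul, one_mul, mul_one, map_add]; ring
  have e3 : regTrace A (star (1 + Complex.I • x) * (1 + Complex.I • x)) =
      regTrace A (star 1 * 1) - Complex.I * regTrace A (star x) +
      Complex.I * regTrace A x + regTrace A (star x * x) := by
    simp only [star_add, star_one, star_smul, Complex.star_def, Complex.conj_I, mul_add, add_mul,
      one_mul, mul_one, map_add, smul_mul_assoc, mul_smul_comm, map_smul, smul_eq_mul, neg_smul,
      map_neg, neg_mul]
    linear_combination (-regTrace A (star x * x)) * Complex.I_mul_I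
  rw [e2] at h2
  rw [e3] at h3
  simp only [star_add, star_sub, star_mul', Complex.star_def, Complex.conj_I] at h0 h1 h2 h3 ⊢
  refine (starRingEnd ℂ).injective ?_
  rw [Complex.conj_conj]
  linear_combination (1 / 2 : ℂ) * (h2 - h0 - h1) - (Complex.I / 2) * (h3 - h0 - h1) +
    (1 / 2 : ℂ) * ((starRingEnd ℂ) (regTrace A (star x)) - (starRingEnd ℂ) (regTrace A x)
      + regTrace A (star x) - regTrace A x) * Complex.I_mul_I

theorem exists_regTrace_mul_eq (φ : Module.Dual ℂ A) : ∃ b : A, ∀ x, φ x = regTrace A (b * x) := by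
  let f : A →ₗ[ℂ] Module.Dual ℂ A := (LinearMap.mul ℂ A).compr₂ (regTrace A)
  have hf : Function.Injective f := by
    rw [injective_iff_map_eq_zero]
    intro b hb
    have h1 : regTrace A (b * star b) = 0 := LinearMap.congr_fun hb (star b)
    have h2 := eq_zero_of_regTrace_eq_zero (mul_star_self_nonneg b) h1
    exact (CStarRing.mul_star_self_eq_zero_iff b).1 h2
  have hs : Function.Surjective f :=
    (LinearMap.injective_iff_surjective_of_finrank_eq_finrank
      (Subspace.dual_finrank_eq).symm).1 hf
  obtain ⟨b, rfl⟩ := hs φ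
  exact ⟨b, fun x => rfl⟩

/-- The square of the regular trace, on `A ⊗ A`. -/
def regTrace₂ : A ⊗[ℂ] A →ₗ[ℂ] ℂ := LinearMap.mul' ℂ ℂ ∘ₗ TensorProduct.map (regTrace A) (regTrace A)

@[simp] theorem regTrace₂_tmul (x y : A) :
    regTrace₂ (x ⊗ₜ[ℂ] y) = regTrace A x * regTrace A y := by simp [regTrace₂]

theorem regTrace₂_mul_comm (s t : A ⊗[ℂ] A) : regTrace₂ (s * t) = regTrace₂ (t * s) := by
  induction s using TensorProduct.induction_on with
  | zero => simp
  | tmul a b =>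
    induction t using TensorProduct.induction_on with
    | zero => simp
    | tmul c d => simp [regTrace_mul_comm a c, regTrace_mul_comm b d]
    | add s s' hs hs' => simp only [mul_add, add_mul, map_add, hs, hs']
  | add s s' hs hs' => simp only [mul_add, add_mul, map_add, hs, hs']

theorem exists_regTrace_orthonormal_basis : ∃ (n : ℕ) (b : Module.Basis (Fin n) ℂ A),
    ∀ i j, regTrace A (star (b i) * b j) = if i = j then 1 else 0 := by
  refine exists_orthonormal_basis_of_core
    { inner := fun x y => regTrace A (star x * y)
      conj_inner_symm := fun x y => ?_
      re_inner_nonneg := fun x => (Complex.nonneg_iff.1 (regTrace_nonneg (star_mul_self_nonneg x))).1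
      add_left := fun x y z => by simp [add_mul]
      smul_left := fun x y r => by simp
      definite := fun x hx =>
        (CStarRing.star_mul_self_eq_zero_iff x).1
          (eq_zero_of_regTrace_eq_zero (star_mul_self_nonneg x) hx) }
  change star (regTrace A (star y * x)) = _
  rw [← regTrace_star]; simp

/-- Expanding the second leg in a trace-orthonormal basis turns the value into `∑ tr(xᵢ⋆ xᵢ)`, so no
C⋆-norm on `A ⊗ A` is involved. -/
theorem regTrace₂_mul_star_self (w : A ⊗[ℂ] A) :
    0 ≤ regTrace₂ (w * star w) ∧ (regTrace₂ (w * star w) = 0 → w = 0) := by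
  obtain ⟨n, b, hb⟩ := exists_regTrace_orthonormal_basis (A := A)
  obtain ⟨x, rfl⟩ : ∃ x : Fin n → A, w = ∑ i, x i ⊗ₜ[ℂ] b i := by
    induction w using TensorProduct.induction_on with
    | zero => exact ⟨0, by simp⟩
    | tmul c d =>
      refine ⟨fun i => b.repr d i • c, ?_⟩
      conv_lhs => rw [← b.sum_repr d]
      simp only [TensorProduct.tmul_sum, TensorProduct.smul_tmul]
    | add s s' hs hs' =>
      obtain ⟨x, rfl⟩ := hs
      obtain ⟨x', rfl⟩ := hs'
      exact ⟨x + x', by simp [TensorProduct.add_tmul, Finset.sum_add_distrib]⟩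
  have h : regTrace₂ ((∑ i, x i ⊗ₜ[ℂ] b i) * star (∑ i, x i ⊗ₜ[ℂ] b i)) =
      ∑ i, regTrace A (star (x i) * x i) := by
    simp only [star_sum, TensorProduct.star_tmul, Finset.sum_mul, Finset.mul_sum,
      Algebra.TensorProduct.tmul_mul_tmul, map_sum, regTrace₂_tmul]
    refine Finset.sum_congr rfl fun i _ => ?_
    simp only [regTrace_mul_comm (b _) (star _), hb, mul_ite, mul_one, mul_zero,
      Finset.sum_ite_eq, Finset.mem_univ, if_true]
    rw [regTrace_mul_comm]
  have h0 : ∀ i ∈ Finset.univ, 0 ≤ regTrace A (star (x i) * x i) := fun i _ =>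
    regTrace_nonneg (star_mul_self_nonneg _)
  rw [h]
  refine ⟨Finset.sum_nonneg h0, fun h1 => Finset.sum_eq_zero fun i hi => ?_⟩
  have h2 := eq_zero_of_regTrace_eq_zero (star_mul_self_nonneg _)
    ((Finset.sum_eq_zero_iff_of_nonneg h0).1 h1 i hi)
  rw [(CStarRing.star_mul_self_eq_zero_iff (x i)).1 h2, TensorProduct.zero_tmul]

end FiniteDimensionalCStar

/-! ### The Haar integral as a projection -/

section Integrals

variable {A : Type*} [CStarAlgebra A] [WeakCStarHopfAlgebra A]

/-- A projection generating the annihilator of the kernel of `x ↦ x₁ S(x₂)`. -/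
structure IsHaarProjection (h : A) : Prop where
  star_eq : star h = h
  mul_self : h * h = h
  idConvS_eq_zero_iff : ∀ x, idConvS x = 0 ↔ x * h = 0

namespace IsHaarProjection

variable {h : A} (hh : IsHaarProjection h)
include hh

/-- The involution exchanges the kernels of `sConvId` and `idConvS`, and `h` is self-adjoint. -/
theorem sConvId_eq_zero_iff (x : A) : sConvId x = 0 ↔ h * x = 0 := by
  have h1 : h * x = 0 ↔ star x * h = 0 := by
    rw [← star_eq_zero, star_mul, hh.star_eq]
  rw [h1, ← hh.idConvS_eq_zero_iff, WeakHopf.sConvId_eq_zero_iff, WeakHopf.idConvS_eq_zero_iff]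
  constructor
  · intro H y
    rw [← star_star y, ← star_mul, counit_star, H, star_zero]
  · intro H y
    have := H (star y)
    rwa [← star_mul, counit_star, star_eq_zero] at this

/-- Since `idConvS` and `sConvId` are idempotent, `a - idConvS a` and `a - sConvId a` lie in their
kernels and are annihilated by `h` on the right and left respectively. The normalizations hold
because `1 - h` lies in both kernels. -/
theorem isHaarIntegral : IsHaarIntegral h where
  left a := by
    have : (a - idConvS a) * h = 0 := by
      rw [← hh.idConvS_eq_zero_iff, map_sub, idConvS_of_mem (idConvS_mem a), sub_self]
    rwa [sub_mul, sub_eq_zero] at this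
  right a := by
    have : h * (a - sConvId a) = 0 := by
      rw [← hh.sConvId_eq_zero_iff, map_sub, sConvId_of_mem (sConvId_mem a), sub_self]
    rwa [mul_sub, sub_eq_zero] at this
  sConvId_eq := by
    have : sConvId (1 - h) = 0 := by
      rw [hh.sConvId_eq_zero_iff, mul_sub, mul_one, hh.mul_self, sub_self]
    rwa [map_sub, sConvId_one, sub_eq_zero, eq_comm] at this
  idConvS_eq := by
    have : idConvS (1 - h) = 0 := by
      rw [hh.idConvS_eq_zero_iff, sub_mul, one_mul, hh.mul_self, sub_self]
    rwa [map_sub, idConvS_one, sub_eq_zero, eq_comm] at this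

theorem mul_leftIntegral {l : A} (hl : l ∈ leftIntegrals A) : h * l = l := by
  have := hl h
  rwa [hh.isHaarIntegral.idConvS_eq, one_mul] at this

/-- Normalization of `h` gives `h * l = l`, and since `h` is a right integral, `h * l = h * S(l₁) l₂
= h * dR l`. -/
theorem eq_mul_dR {l : A} (hl : l ∈ leftIntegrals A) : l = h * dR l := by
  rw [dR, ← sConvId_eq_hatEpsR, ← hh.isHaarIntegral.right, hh.mul_leftIntegral hl]

theorem mul_S {b : A} (hb : b ∈ leftSubalg A) : h * S b = h * b := by
  rw [S_of_mem_left hb, ← hh.isHaarIntegral.right]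

end IsHaarProjection

theorem dR_mem (l : A) : dR l ∈ rightSubalg A := ⟨_, rfl⟩

theorem dR_eq_sConvId (l : A) : dR l = sConvId l := (sConvId_eq_hatEpsR l).symm

theorem star_mem_left {b : A} (hb : b ∈ leftSubalg A) : star b ∈ leftSubalg A :=
  (leftStarSubalgebra A).star_mem' hb

theorem star_mem_right {b : A} (hb : b ∈ rightSubalg A) : star b ∈ rightSubalg A :=
  (rightStarSubalgebra A).star_mem' hb

theorem star_S_star_mem_left {c : A} (hc : c ∈ rightSubalg A) : star (S (star c)) ∈ leftSubalg A :=
  star_mem_left <| by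
    rw [S_of_mem_right (star_mem_right hc)]
    exact idConvS_mem _

/-- Behind `h`, an element of `A_R` can be traded for its preimage under `S`, which lies in `A_L`.
-/
theorem IsHaarProjection.mul_star_S_star {h : A} (hh : IsHaarProjection h) {c : A}
    (hc : c ∈ rightSubalg A) : h * star (S (star c)) = h * c := by
  rw [← hh.mul_S (star_S_star_mem_left hc), S_star_S_star]

theorem idConvS_injOn_right {c : A} (hc : c ∈ rightSubalg A) (h : idConvS c = 0) : c = 0 := by
  rw [← S_of_mem_right hc, ← map_zero (S (A := A))] at h
  exact S_injective h

/-! ### Positivity and nondegeneracy -/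

/-- `a ⊗ b ↦ conj (φ(a⋆)) φ(b)`. -/
def dualForm (χ φ : Module.Dual ℂ A) : A ⊗[ℂ] A →ₗ[ℂ] ℂ :=
  LinearMap.mul' ℂ ℂ ∘ₗ TensorProduct.map
    { toFun := fun x => star (χ (star x))
      map_add' := fun x y => by simp
      map_smul' := fun c x => by simp } φ

@[simp] theorem dualForm_tmul (χ φ : Module.Dual ℂ A) (a b : A) :
    dualForm χ φ (a ⊗ₜ b) = star (χ (star a)) * φ b := by simp [dualForm]

theorem dualMul_dualStar (χ φ : Module.Dual ℂ A) (l : A) : dualMul (dualStar χ) φ l =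
    dualForm χ φ (TensorProduct.map S LinearMap.id (comul (R := ℂ) l)) := by
  have : ∀ t : A ⊗[ℂ] A, LinearMap.mul' ℂ ℂ (TensorProduct.map (dualStar χ) φ t) =
      dualForm χ φ (TensorProduct.map S LinearMap.id t) := by
    intro t
    induction t using TensorProduct.induction_on with
    | zero => simp
    | tmul a b => simp [dualStar]
    | add a b ha hb => simp only [map_add, ha, hb]
  exact this _

theorem dualStar_dualStar (φ : Module.Dual ℂ A) : dualStar (dualStar φ) = φ := by
  ext x
  simp [dualStar, star_S_star_S]

/-- The antipode in `dualStar` moves to the first leg of `Δ(l)`, leaving an ordinary positive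
sesquilinear form, which splits into rank one pieces. -/
theorem isPositiveIntegral_iff [FiniteDimensional ℂ A] (l : A) : IsPositiveIntegral l ↔
    ∃ (m : ℕ) (a : Fin m → A),
      TensorProduct.map S LinearMap.id (comul (R := ℂ) l) = ∑ i, star (a i) ⊗ₜ[ℂ] a i := by
  constructor
  · intro h
    refine exists_eq_sum_star_tmul _ (fun φ => dualForm φ φ) (fun φ a b => dualForm_tmul φ φ a b)
      fun φ => ?_
    rw [← dualMul_dualStar]
    exact h φ
  · rintro ⟨m, a, ha⟩ φ
    rw [dualMul_dualStar, ha, map_sum]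
    refine Finset.sum_nonneg fun i _ => ?_
    rw [dualForm_tmul, star_star]
    exact star_mul_self_nonneg _

theorem dual_eq_zero_of_nondegenerate {l : A} (hl : IsNondegenerateIntegral l) {m : ℕ}
    {a : Fin m → A}
    (ha : TensorProduct.map S LinearMap.id (comul (R := ℂ) l) = ∑ i, star (a i) ⊗ₜ[ℂ] a i)
    (φ : Module.Dual ℂ A) (hφ : ∀ i, φ (a i) = 0) : φ = 0 := by
  refine hl.2 φ fun ψ => ?_
  rw [← dualStar_dualStar ψ, dualMul_dualStar, ha, map_sum]
  simp [hφ]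

/-- A functional vanishing on all `a i` pairs to zero with every functional under `l`, hence
vanishes. -/
theorem span_eq_top_of_nondegenerate {l : A} (hl : IsNondegenerateIntegral l) {m : ℕ}
    {a : Fin m → A}
    (ha : TensorProduct.map S LinearMap.id (comul (R := ℂ) l) = ∑ i, star (a i) ⊗ₜ[ℂ] a i) :
    Submodule.span ℂ (Set.range a) = ⊤ := by
  by_contra hne
  obtain ⟨φ, hφ, hle⟩ := Submodule.exists_le_ker_of_lt_top _ (lt_top_iff_ne_top.2 hne)
  exact hφ (dual_eq_zero_of_nondegenerate hl ha φ fun i =>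
    hle (Submodule.subset_span ⟨i, rfl⟩))

theorem dR_eq_sum {l : A} {m : ℕ} {a : Fin m → A}
    (ha : TensorProduct.map S LinearMap.id (comul (R := ℂ) l) = ∑ i, star (a i) ⊗ₜ[ℂ] a i) :
    dR l = ∑ i, star (a i) * a i := by
  rw [dR_eq_sConvId, sConvId_eq_conv, conv_apply, ha]
  simp

variable [PartialOrder A] [StarOrderedRing A] [FiniteDimensional ℂ A]

theorem exists_isHaarProjection : ∃ h : A, IsHaarProjection h := by
  obtain ⟨h, h1, h2, h3⟩ := exists_projection_of_leftIdeal (LinearMap.ker (idConvS (A := A)))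
    fun a x hx => by
      rw [LinearMap.mem_ker] at hx ⊢
      rw [← idConvS_mul_idConvS, hx, mul_zero, map_zero]
  exact ⟨h, h1, h2, h3⟩

theorem dR_nonneg {l : A} (hl : IsPositiveIntegral l) : 0 ≤ dR l := by
  obtain ⟨m, a, ha⟩ := (isPositiveIntegral_iff l).1 hl
  rw [dR_eq_sum ha]
  exact Finset.sum_nonneg fun i _ => star_mul_self_nonneg _

/-- Being antimultiplicative and bijective, `S` conjugates left into right multiplications; this is
why both regular traces enter `regTrace`. -/
theorem regTrace_S (x : A) : regTrace A (S x) = regTrace A x := by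
  let e : A ≃ₗ[ℂ] A := LinearEquiv.ofBijective S ⟨S_injective, S_surjective⟩
  have h1 : LinearMap.mulLeft ℂ (S x) = e.conj (LinearMap.mulRight ℂ x) := by
    ext y
    obtain ⟨z, rfl⟩ := e.surjective y
    simp only [LinearEquiv.conj_apply_apply, LinearEquiv.symm_apply_apply]
    exact (S_mul z x).symm
  have h2 : LinearMap.mulRight ℂ (S x) = e.conj (LinearMap.mulLeft ℂ x) := by
    ext y
    obtain ⟨z, rfl⟩ := e.surjective y
    simp only [LinearEquiv.conj_apply_apply, LinearEquiv.symm_apply_apply]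
    exact (S_mul x z).symm
  rw [regTrace_apply, regTrace_apply, h1, h2, LinearMap.trace_conj', LinearMap.trace_conj', add_comm]

namespace IsHaarProjection

variable {h : A} (hh : IsHaarProjection h)
include hh

/-- With `φ = tr(b ·)` the value is `(tr ⊗ tr)((S(b)⋆ ⊗ b) Δ(h))`. The exchange rule turns `1 ⊗ b`
into `S(b) ⊗ 1`, and `Δ(h) = Δ(h) Δ(h)⋆` with the trace property gives `(tr ⊗ tr)(w w⋆)`. If `w =
0`, then `S(b) = S(b) h₁ S(h₂) = 0`. -/
theorem dualMul_dualStar_self (φ : Module.Dual ℂ A) :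
    0 ≤ dualMul (dualStar φ) φ h ∧ (dualMul (dualStar φ) φ h = 0 → φ = 0) := by
  obtain ⟨b, hb⟩ := exists_regTrace_mul_eq φ
  let w : A ⊗[ℂ] A := (S b ⊗ₜ[ℂ] (1 : A)) * comul (R := ℂ) h
  have h1 : ∀ s : A ⊗[ℂ] A, LinearMap.mul' ℂ ℂ (TensorProduct.map (dualStar φ) φ s) =
      regTrace₂ ((star (S b) ⊗ₜ[ℂ] (1 : A)) * (((1 : A) ⊗ₜ[ℂ] b) * s)) := by
    intro s
    induction s using TensorProduct.induction_on with
    | zero => simp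
    | tmul x y =>
      have h2 : star (φ (star (S x))) = regTrace A (star (S b) * x) := by
        rw [hb, ← regTrace_star, star_mul, star_star, ← S_star_S, ← S_mul, regTrace_S]
      rw [TensorProduct.map_tmul, LinearMap.mul'_apply]
      change star (φ (star (S x))) * φ y = _
      rw [h2, hb y]
      simp
    | add x y hx hy => simp only [map_add, mul_add, hx, hy]
  have h2 : dualMul (dualStar φ) φ h = regTrace₂ (w * star w) := by
    have h3 : comul (R := ℂ) h = comul (R := ℂ) h * star (comul (R := ℂ) h) := by
      rw [← WeakCStarHopfAlgebra.comul_star', ← WeakCStarHopfAlgebra.comul_mul', hh.star_eq,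
        hh.mul_self]
    refine (h1 _).trans ?_
    rw [tmul_comul_leftIntegral hh.isHaarIntegral.left, regTrace₂_mul_comm]
    conv_lhs => rw [h3]
    rw [star_mul, TensorProduct.star_tmul, star_one]
    simp only [w, mul_assoc]
  rw [h2]
  refine ⟨(regTrace₂_mul_star_self w).1, fun h4 => ?_⟩
  have hw := (regTrace₂_mul_star_self w).2 h4
  have h5 : ∀ s : A ⊗[ℂ] A, LinearMap.mul' ℂ A (TensorProduct.map LinearMap.id S
      ((S b ⊗ₜ[ℂ] (1 : A)) * s)) = S b * LinearMap.mul' ℂ A (TensorProduct.map LinearMap.id S s) := by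
    intro t
    induction t using TensorProduct.induction_on with
    | zero => simp
    | tmul c d => simp [mul_assoc]
    | add c d hc hd => simp only [mul_add, map_add, hc, hd]
  have h6 := h5 (comul (R := ℂ) h)
  rw [← conv_apply, ← idConvS_eq_conv, hh.isHaarIntegral.idConvS_eq, mul_one] at h6
  have h7 : S b = 0 := by
    rw [← h6]
    change LinearMap.mul' ℂ A (TensorProduct.map LinearMap.id S w) = 0
    rw [hw, map_zero, map_zero]
  have h8 : b = 0 := S_injective (h7.trans (map_zero _).symm)
  ext x
  rw [hb, h8, zero_mul, map_zero, LinearMap.zero_apply]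

theorem isPositiveIntegral : IsPositiveIntegral h := fun φ => (hh.dualMul_dualStar_self φ).1

theorem isNondegenerateIntegral : IsNondegenerateIntegral h := by
  constructor
  · intro φ hφ
    have := (hh.dualMul_dualStar_self (dualStar φ)).2 (by rw [dualStar_dualStar]; exact hφ _)
    rw [← dualStar_dualStar φ, this]
    ext; simp [dualStar]
  · intro ψ hψ
    exact (hh.dualMul_dualStar_self ψ).2 (hψ _)

theorem dualMul_mul_right {d : A} (hd : d ∈ rightSubalg A) (φ ψ : Module.Dual ℂ A) (x : A) :
    dualMul φ ψ (x * d) = dualMul φ (ψ ∘ₗ LinearMap.mulRight ℂ d) x := by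
  have : ∀ t : A ⊗[ℂ] A, LinearMap.mul' ℂ ℂ (TensorProduct.map φ ψ (t * ((1 : A) ⊗ₜ[ℂ] d))) =
      LinearMap.mul' ℂ ℂ (TensorProduct.map φ (ψ ∘ₗ LinearMap.mulRight ℂ d) t) := by
    intro t
    induction t using TensorProduct.induction_on with
    | zero => simp
    | tmul a b => simp
    | add a b ha hb => simp only [add_mul, map_add, ha, hb]
  refine Eq.trans ?_ (this _)
  rw [← comul_mul_right hd]
  rfl

/-- As `l = h * dR l`, a functional killed by the dual of right multiplication by `dR l` is in the
radical of `l`. So that multiplication is onto, and bijective by finite dimension. -/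
theorem isUnit_dR_of_nondegenerate {l : A} (hl : l ∈ leftIntegrals A)
    (hn : IsNondegenerateIntegral l) : IsUnit (dR l) := by
  have h1 : Function.Injective (LinearMap.mulRight ℂ (dR l)).dualMap := by
    rw [injective_iff_map_eq_zero]
    intro ψ hψ
    refine hn.2 ψ fun φ => ?_
    rw [hh.eq_mul_dR hl, hh.dualMul_mul_right (dR_mem l)]
    change dualMul φ ((LinearMap.mulRight ℂ (dR l)).dualMap ψ) h = 0
    rw [hψ]
    simp [dualMul]
  rw [LinearMap.dualMap_injective_iff] at h1
  obtain ⟨e, he⟩ := h1 1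
  have h2 := LinearMap.injective_iff_surjective.2 h1
  have he : e * dR l = 1 := he
  refine ⟨⟨dR l, e, h2 ?_, he⟩, rfl⟩
  simp only [LinearMap.mulRight_apply]
  rw [mul_assoc, he, one_mul, mul_one]

theorem nondegenerate_of_isUnit {l : A} (hl : l ∈ leftIntegrals A) (hu : IsUnit (dR l)) :
    IsNondegenerateIntegral l := by
  obtain ⟨u, hu⟩ := hu
  constructor
  · intro φ hφ
    refine hh.isNondegenerateIntegral.1 φ fun ψ => ?_
    have := hφ (ψ ∘ₗ LinearMap.mulRight ℂ (↑u⁻¹ : A))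
    rw [hh.eq_mul_dR hl, hh.dualMul_mul_right (dR_mem l)] at this
    have h1 : (ψ ∘ₗ LinearMap.mulRight ℂ (↑u⁻¹ : A)) ∘ₗ LinearMap.mulRight ℂ (dR l) = ψ := by
      ext x; simp [← hu, mul_assoc]
    rwa [h1] at this
  · intro ψ hψ
    have : ψ ∘ₗ LinearMap.mulRight ℂ (dR l) = 0 := by
      refine hh.isNondegenerateIntegral.2 _ fun φ => ?_
      rw [← hh.dualMul_mul_right (dR_mem l), ← hh.eq_mul_dR hl]
      exact hψ φ
    ext x
    have := LinearMap.congr_fun this (x * (↑u⁻¹ : A))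
    simpa [← hu] using this

end IsHaarProjection

theorem isClosed_rightSubalg : IsClosed (rightStarSubalgebra A : Set A) :=
  (Subalgebra.toSubmodule (rightStarSubalgebra A).toSubalgebra).closed_of_finiteDimensional

theorem sqrt_mem_right {c : A} (hc : c ∈ rightSubalg A) : CFC.sqrt c ∈ rightSubalg A := by
  have := isClosed_rightSubalg (A := A)
  by_cases h0 : 0 ≤ c
  · rw [CFC.sqrt_eq_real_sqrt c h0]
    exact cfcₙ_mem (s := rightStarSubalgebra A) _ hc
  · rw [CFC.sqrt_of_not_nonneg h0]
    exact (rightStarSubalgebra A).zero_mem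

theorem negPart_mem_right {c : A} (hc : c ∈ rightSubalg A) : c⁻ ∈ rightSubalg A := by
  have := isClosed_rightSubalg (A := A)
  exact cfcₙ_mem (s := rightStarSubalgebra A) _ hc

/-- Split `dR l = c * c` and move one factor through `S` into `A_L`. Then `Δ(l) = Δ(h)(S⁻¹(c) ⊗ c)`,
and a decomposition of `h` by `a i` yields one of `l` by `a i * c`. -/
theorem IsHaarProjection.isPositiveIntegral_of_dR_nonneg {h : A} (hh : IsHaarProjection h) {l : A}
    (hl : l ∈ leftIntegrals A) (hd : 0 ≤ dR l) : IsPositiveIntegral l := by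
  obtain ⟨m, a, ha⟩ := (isPositiveIntegral_iff h).1 hh.isPositiveIntegral
  rw [isPositiveIntegral_iff]
  let c := CFC.sqrt (dR l)
  have hc : c ∈ rightSubalg A := sqrt_mem_right (dR_mem l)
  have hcs : star c = c := IsSelfAdjoint.of_nonneg (CFC.sqrt_nonneg _)
  have h1 : l = h * star (S (star c)) * c := by
    rw [hh.mul_star_S_star hc, mul_assoc, CFC.sqrt_mul_sqrt_self _ hd, ← hh.eq_mul_dR hl]
  have h2 : comul (R := ℂ) l = comul (R := ℂ) h * (star (S (star c)) ⊗ₜ[ℂ] c) := by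
    rw [h1, comul_mul_right hc, comul_mul_left (star_S_star_mem_left hc), mul_assoc]
    simp
  have h3 : ∀ t : A ⊗[ℂ] A, TensorProduct.map S LinearMap.id (t * (star (S (star c)) ⊗ₜ[ℂ] c)) =
      (c ⊗ₜ[ℂ] (1 : A)) * TensorProduct.map S LinearMap.id t * ((1 : A) ⊗ₜ[ℂ] c) := by
    intro t
    induction t using TensorProduct.induction_on with
    | zero => simp
    | tmul a b => simp [S_mul, S_star_S_star]
    | add a b ha hb => simp only [add_mul, mul_add, map_add, ha, hb]
  refine ⟨m, fun i => a i * c, ?_⟩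
  rw [h2, h3, ha]
  simp [Finset.mul_sum, Finset.sum_mul, hcs]

end Integrals

/-- Polarization with `1 + m` and `1 + im`: the two relations determine the image of `m⋆`. -/
theorem map_star_of_star_map_star_mul_self {R : Type*} [Ring R] [StarRing R] [Algebra ℂ R]
    [StarModule ℂ R] {F : R →ₗ[ℂ] R} (h0 : ∀ x, star (F (star x * x)) = F (star x * x)) (m : R) :
    F (star m) = star (F m) := by
  have e1 : star (F 1) = F 1 := by simpa using h0 1
  have e2 := h0 m
  have h3 : star (1 + m) * (1 + m) = 1 + m + (star m + star m * m) := by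
    rw [star_add, star_one, add_mul, one_mul, mul_add, mul_one]
  have h4 : star (1 + Complex.I • m) * (1 + Complex.I • m) =
      1 + Complex.I • m + (-(Complex.I • star m) + star m * m) := by
    rw [star_add, star_one, star_smul, add_mul, one_mul, mul_add, mul_one, smul_mul_smul_comm]
    simp
  have e3 := h0 (1 + m)
  have e4 := h0 (1 + Complex.I • m)
  rw [h3, map_add, map_add, map_add, star_add, star_add, star_add, e1, e2] at e3
  rw [h4, map_add, map_add, map_add, map_neg, map_smul, map_smul, star_add, star_add, star_add,
    star_neg, star_smul, star_smul, e1, e2, Complex.star_def, Complex.conj_I, neg_smul,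
    neg_smul] at e4
  generalize F 1 = u at e1 e2 e3 e4 ⊢
  generalize F m = v at e1 e2 e3 e4 ⊢
  generalize F (star m) = w at e1 e2 e3 e4 ⊢
  generalize F (star m * m) = z at e1 e2 e3 e4 ⊢
  have e5 : star v + star w = v + w := by
    have := congrArg (fun t => t - u - z) e3
    simpa [add_sub_assoc, add_assoc] using this
  have e6 : star w - star v = v - w := by
    have e7 : Complex.I • (star w - star v) = Complex.I • (v - w) := by
      rw [smul_sub, smul_sub]
      have := congrArg (fun t => t - u - z) e4
      have h1 : u + -(Complex.I • star v) + (- -(Complex.I • star w) + z) - u - z =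
        Complex.I • star w - Complex.I • star v := by abel
      have h2 : u + Complex.I • v + (-(Complex.I • w) + z) - u - z =
        Complex.I • v - Complex.I • w := by abel
      rwa [h1, h2] at this
    exact smul_right_injective _ Complex.I_ne_zero e7
  have e8 : (2 : ℂ) • w = (2 : ℂ) • star v := by
    have := congrArg₂ (fun s t => s - t) e5 e6
    have h1 : star v + star w - (star w - star v) = star v + star v := by abel
    have h2 : v + w - (v - w) = w + w := by abel
    rw [two_smul, two_smul, ← h1, this, h2]
  exact smul_right_injective _ two_ne_zero e8

/-! ### Positive elements of a von Neumann algebra -/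

section VonNeumann

variable {H : Type*} [NormedAddCommGroup H] [InnerProductSpace ℂ H] [CompleteSpace H]
  {M : VonNeumannAlgebra H}

theorem isClosed_vonNeumannAlgebra (M : VonNeumannAlgebra H) :
    IsClosed (M.toStarSubalgebra : Set (H →L[ℂ] H)) := by
  have : (M.toStarSubalgebra : Set (H →L[ℂ] H)) = Set.centralizer (Set.centralizer M) :=
    M.centralizer_centralizer.symm
  rw [this]
  exact Set.isClosed_centralizer _

theorem exists_eq_star_mul_self {m : M.toStarSubalgebra} (hm : (m : H →L[ℂ] H).IsPositive) :
    ∃ x : M.toStarSubalgebra, m = star x * x := by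
  have := isClosed_vonNeumannAlgebra M
  have h0 : 0 ≤ (m : H →L[ℂ] H) := (ContinuousLinearMap.nonneg_iff_isPositive _).2 hm
  have h1 : CFC.sqrt (m : H →L[ℂ] H) ∈ M.toStarSubalgebra := by
    rw [CFC.sqrt_eq_real_sqrt _ h0]
    exact cfcₙ_mem (s := M.toStarSubalgebra) _ m.2
  refine ⟨⟨_, h1⟩, Subtype.ext ?_⟩
  change (m : H →L[ℂ] H) = star (CFC.sqrt (m : H →L[ℂ] H)) * CFC.sqrt (m : H →L[ℂ] H)
  have h2 : star (CFC.sqrt (m : H →L[ℂ] H)) = CFC.sqrt (m : H →L[ℂ] H) :=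
    IsSelfAdjoint.of_nonneg (CFC.sqrt_nonneg _)
  rw [h2, CFC.sqrt_mul_sqrt_self _ h0]

theorem isPositive_sum_star_mul_self {ι : Type*} [Fintype ι] (x : ι → M.toStarSubalgebra) :
    ((∑ i, star (x i) * x i : M.toStarSubalgebra) : H →L[ℂ] H).IsPositive := by
  rw [← ContinuousLinearMap.nonneg_iff_isPositive]
  have : ((∑ i, star (x i) * x i : M.toStarSubalgebra) : H →L[ℂ] H) =
      ∑ i, star (x i : H →L[ℂ] H) * x i := by
    simp
  rw [this]
  exact Finset.sum_nonneg fun i _ => star_mul_self_nonneg _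

theorem eq_zero_of_sum_star_mul_self {ι : Type*} [Fintype ι] {x : ι → M.toStarSubalgebra}
    (h : ∑ i, star (x i) * x i = 0) (i : ι) : x i = 0 := by
  have h1 : ∑ i, star (x i : H →L[ℂ] H) * x i = 0 := by
    have := congrArg (Subtype.val) h
    simpa using this
  have := (Finset.sum_eq_zero_iff_of_nonneg (fun i _ => star_mul_self_nonneg (x i : H →L[ℂ] H))).1
    h1 i (Finset.mem_univ i)
  exact Subtype.ext ((CStarRing.star_mul_self_eq_zero_iff _).1 this)

theorem isPositive_star_mul_self (x : M.toStarSubalgebra) :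
    ((star x * x : M.toStarSubalgebra) : H →L[ℂ] H).IsPositive :=
  (ContinuousLinearMap.nonneg_iff_isPositive _).1 (star_mul_self_nonneg (x : H →L[ℂ] H))

theorem map_star_of_isPositiveMap {F : M.toStarSubalgebra →ₗ[ℂ] M.toStarSubalgebra}
    (hF : IsPositiveMap F) (m : M.toStarSubalgebra) : F (star m) = star (F m) :=
  map_star_of_star_map_star_mul_self
    (fun x => Subtype.ext (hF (star x * x) (isPositive_star_mul_self x)).isSelfAdjoint) m

end VonNeumann

/-! ### The action, its fixed points and the maps `E_l` -/

namespace VNModuleAlgebra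

variable {A : Type*} [CStarAlgebra A] [WeakCStarHopfAlgebra A]
  {H : Type*} [NormedAddCommGroup H] [InnerProductSpace ℂ H] [CompleteSpace H]
  {M : VonNeumannAlgebra H} (T : VNModuleAlgebra A M)

/-- The formula `Δ(b) = Δ(1)(b ⊗ 1)` lets `b` act on the first factor alone. So `A_L` acts by left
multiplications, and likewise `A_R` by right multiplications. -/
theorem act_left_mul {b : A} (hb : b ∈ leftSubalg A) (x y : M.toStarSubalgebra) :
    T.act b (x * y) = T.act b x * y := by
  have : ∀ t : A ⊗[ℂ] A, LinearMap.mul' ℂ _ (TensorProduct.map (T.act.flip x) (T.act.flip y)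
      (t * (b ⊗ₜ[ℂ] (1 : A)))) =
      LinearMap.mul' ℂ _ (TensorProduct.map (T.act.flip (T.act b x)) (T.act.flip y) t) := by
    intro t
    induction t using TensorProduct.induction_on with
    | zero => simp
    | tmul a b => simp [T.mul_act]
    | add a b ha hb => simp only [add_mul, map_add, ha, hb]
  rw [T.act_mul, comul_of_mem_left' hb, this, ← T.act_mul, T.one_act]

theorem act_right_mul {c : A} (hc : c ∈ rightSubalg A) (x y : M.toStarSubalgebra) :
    T.act c (x * y) = x * T.act c y := by
  have : ∀ t : A ⊗[ℂ] A, LinearMap.mul' ℂ _ (TensorProduct.map (T.act.flip x) (T.act.flip y)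
      (t * ((1 : A) ⊗ₜ[ℂ] c))) =
      LinearMap.mul' ℂ _ (TensorProduct.map (T.act.flip x) (T.act.flip (T.act c y)) t) := by
    intro t
    induction t using TensorProduct.induction_on with
    | zero => simp
    | tmul a b => simp [T.mul_act]
    | add a b ha hb => simp only [add_mul, map_add, ha, hb]
  rw [T.act_mul, comul_of_mem_right' hc, this, ← T.act_mul, T.one_act]

theorem act_left {b : A} (hb : b ∈ leftSubalg A) (x : M.toStarSubalgebra) :
    T.act b x = T.act b 1 * x := by
  rw [← T.act_left_mul hb, one_mul]

theorem act_right {c : A} (hc : c ∈ rightSubalg A) (x : M.toStarSubalgebra) :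
    T.act c x = x * T.act c 1 := by
  rw [← T.act_right_mul hc, mul_one]

/-- Invariant elements commute with `M_R`. -/
theorem fixed_mul_act_one {n : M.toStarSubalgebra} (hn : n ∈ T.fixedPoints) (a : A) :
    n * T.act a 1 = T.act a 1 * n := by
  rw [T.act_one a]
  have hb := idConvS_mem a
  set b := idConvS a
  have hc : star (S (star b)) ∈ rightSubalg A := star_mem_right <| by
    rw [S_of_mem_left (star_mem_left hb)]
    exact sConvId_mem _
  have hcb : idConvS (star (S (star b))) = b := by
    rw [← S_of_mem_right hc, S_star_S_star]
  have h1 : T.act (star (S (star b))) 1 = T.act b 1 := by rw [T.act_one, hcb]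
  -- The element `b ▷ 1` equals `S⁻¹(b) ▷ 1`: acting through `A_L` it multiplies `n` on the left,
  -- through `A_R` on the right, and invariance of `n` equates the two.
  rw [← T.act_left hb, ← h1, ← T.act_right hc, hn, hcb]

theorem act_fixed {n : M.toStarSubalgebra} (hn : n ∈ T.fixedPoints) (a : A) :
    T.act a n = T.act a 1 * n := by
  rw [hn a, T.act_left (idConvS_mem a), ← T.act_one]

theorem act_fixed_mul {n : M.toStarSubalgebra} (hn : n ∈ T.fixedPoints) (a : A)
    (m : M.toStarSubalgebra) : T.act a (n * m) = n * T.act a m := by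
  have : ∀ t : A ⊗[ℂ] A, LinearMap.mul' ℂ _ (TensorProduct.map (T.act.flip n) (T.act.flip m) t) =
      n * LinearMap.mul' ℂ _ (TensorProduct.map (T.act.flip 1) (T.act.flip m) t) := by
    intro t
    induction t using TensorProduct.induction_on with
    | zero => simp
    | tmul a b => simp [T.act_fixed hn, ← mul_assoc, T.fixed_mul_act_one hn]
    | add a b ha hb => simp only [mul_add, map_add, ha, hb]
  rw [T.act_mul, this, ← T.act_mul, one_mul]

theorem act_mul_fixed {n : M.toStarSubalgebra} (hn : n ∈ T.fixedPoints) (a : A)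
    (m : M.toStarSubalgebra) : T.act a (m * n) = T.act a m * n := by
  have : ∀ t : A ⊗[ℂ] A, LinearMap.mul' ℂ _ (TensorProduct.map (T.act.flip m) (T.act.flip n) t) =
      LinearMap.mul' ℂ _ (TensorProduct.map (T.act.flip m) (T.act.flip 1) t) * n := by
    intro t
    induction t using TensorProduct.induction_on with
    | zero => simp
    | tmul a b => simp [T.act_fixed hn, ← mul_assoc]
    | add a b ha hb => simp only [add_mul, map_add, ha, hb]
  rw [T.act_mul, this, ← T.act_mul, mul_one]

theorem mem_fixedPoints_of_act_mul {n : M.toStarSubalgebra}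
    (h : ∀ a m, T.act a (m * n) = T.act a m * n) : n ∈ T.fixedPoints := fun a => by
  rw [← one_mul n, h, h, T.act_one]

theorem star_act_star (a : A) (m : M.toStarSubalgebra) :
    T.act a m = star (T.act (star (S a)) (star m)) := by
  rw [← star_star (T.act a m), T.star_act]

/-- The invariant subalgebra as a `⋆`-subalgebra. -/
def fixedStarSubalgebra : StarSubalgebra ℂ M.toStarSubalgebra where
  carrier := T.fixedPoints
  mul_mem' {x y} hx hy := T.mem_fixedPoints_of_act_mul fun a m => by
    rw [← mul_assoc, T.act_mul_fixed hy, T.act_mul_fixed hx, mul_assoc]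
  one_mem' := T.mem_fixedPoints_of_act_mul fun a m => by simp
  add_mem' {x y} hx hy := T.mem_fixedPoints_of_act_mul fun a m => by
    rw [mul_add, map_add, T.act_mul_fixed hy, T.act_mul_fixed hx, mul_add]
  zero_mem' := T.mem_fixedPoints_of_act_mul fun a m => by simp
  algebraMap_mem' r := T.mem_fixedPoints_of_act_mul fun a m => by
    simp [Algebra.algebraMap_eq_smul_one]
  star_mem' {n} hn := T.mem_fixedPoints_of_act_mul fun a m => by
    rw [T.star_act_star, star_mul, star_star, T.act_fixed_mul hn, star_mul, ← T.star_act_star]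

theorem act_leftIntegral_mem {l : A} (hl : l ∈ leftIntegrals A) (m : M.toStarSubalgebra) :
    T.act l m ∈ T.fixedPoints := fun a => by
  rw [← T.mul_act, ← T.mul_act, hl a]

theorem mul_mem_leftIntegrals {l : A} (hl : l ∈ leftIntegrals A) (d : A) :
    l * d ∈ leftIntegrals A := fun a => by
  rw [← mul_assoc, hl a, mul_assoc]

theorem act_mul_left (l : A) {d : A} (hd : d ∈ leftSubalg A) (m : M.toStarSubalgebra) :
    T.act (l * d) m = T.act l (T.act d 1 * m) := by
  rw [T.mul_act, T.act_left hd]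

theorem act_mul_right (l : A) {d : A} (hd : d ∈ rightSubalg A) (m : M.toStarSubalgebra) :
    T.act (l * d) m = T.act l (m * T.act d 1) := by
  rw [T.mul_act, T.act_right hd]

theorem act_one_eq_nL (l : A) : T.act l 1 = T.act (nL l) 1 := by
  rw [T.act_one l, idConvS_eq_hatEpsL, nL]

theorem act_one_eq_nR (l : A) : T.act l 1 = T.act (nR l) 1 := by
  have : idConvS (nR l) = idConvS l := idConvS_eq_of_epsR_eq fun z => counit_mul_nR z l
  rw [T.act_one l, T.act_one (nR l), this]

theorem act_leftIntegral_one_mem_centralizer {l : A} (hl : l ∈ leftIntegrals A) :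
    T.act l 1 ∈ Set.centralizer T.fixedPoints := fun n hn => T.fixed_mul_act_one hn l

theorem act_mul_one_of_mem_left {b : A} (hb : b ∈ leftSubalg A) (a : A) :
    T.act (b * a) 1 = T.act b 1 * T.act a 1 := by
  rw [T.mul_act, T.act_left hb]

/-- The hypothesis says `ε(· b l) = 0`. If `ψ` is inverse to `epsR l`, then `ε(xb) = ε(x₁ b l) ψ(x₂)
= 0` for all `x`. -/
theorem eq_zero_of_mul_idConvS_eq_zero {l b : A} (hl : IsNormalizableIntegral l)
    (hb : b ∈ leftSubalg A) (h : b * idConvS l = 0) : b = 0 := by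
  rw [← idConvS_left_mul hb, idConvS_eq_zero_iff] at h
  obtain ⟨ψ, hψ, -⟩ := hl
  rw [← idConvS_of_mem hb, idConvS_eq_zero_iff]
  intro x
  have h1 : ∀ t : A ⊗[ℂ] A,
      LinearMap.mul' ℂ ℂ (TensorProduct.map (epsR l) ψ (t * (b ⊗ₜ[ℂ] (1 : A)))) = 0 := by
    intro t
    induction t using TensorProduct.induction_on with
    | zero => simp
    | tmul u v => simp [mul_assoc, h u]
    | add a b ha hb => simp only [add_mul, map_add, ha, hb, add_zero]
  rw [← hψ, ← h1 (comul (R := ℂ) x), ← comul_mul_left hb]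
  rfl

/-- Right multiplication by `idConvS l` is injective on the finite dimensional `A_L`, so `idConvS l`
is invertible there, and `b ↦ b ▷ 1` is multiplicative on `A_L`. -/
theorem isUnit_act_one [FiniteDimensional ℂ A] {l : A} (hl : IsNormalizableIntegral l) :
    IsUnit (T.act l 1) := by
  let L := Subalgebra.toSubmodule (leftStarSubalgebra A).toSubalgebra
  have hp : idConvS l ∈ L := idConvS_mem l
  let f : L →ₗ[ℂ] L := (LinearMap.mulRight ℂ (idConvS l)).restrict
    fun x hx => (leftStarSubalgebra A).mul_mem' hx hp
  have hf : Function.Injective f := by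
    rw [injective_iff_map_eq_zero]
    intro b hb
    exact Subtype.ext (eq_zero_of_mul_idConvS_eq_zero hl b.2 (congrArg Subtype.val hb))
  obtain ⟨e, he⟩ := LinearMap.injective_iff_surjective.1 hf ⟨1, (leftStarSubalgebra A).one_mem⟩
  have h1 : (e : A) * idConvS l = 1 := congrArg Subtype.val he
  have h2 : idConvS l * (e : A) = 1 := by
    have h3 : idConvS l * (e : A) - 1 ∈ leftSubalg A :=
      (leftStarSubalgebra A).sub_mem ((leftStarSubalgebra A).mul_mem hp e.2)
        (leftStarSubalgebra A).one_mem
    rw [← sub_eq_zero]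
    refine eq_zero_of_mul_idConvS_eq_zero hl h3 ?_
    rw [sub_mul, mul_assoc, h1, mul_one, one_mul, sub_self]
  rw [T.act_one]
  refine ⟨⟨T.act (idConvS l) 1, T.act e 1, ?_, ?_⟩, rfl⟩
  · rw [← T.act_mul_one_of_mem_left hp, h2, T.one_act]
  · rw [← T.act_mul_one_of_mem_left e.2, h1, T.one_act]

theorem idConvS_eq_one_of_normalized {l : A} (hl : IsNormalizedIntegral l) : idConvS l = 1 := by
  have hl : epsR l = counit (R := ℂ) := hl
  rw [idConvS_eq_hatEpsL, hl, hatEpsL, lid_map_counit_comul]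

theorem normalized_of_idConvS_eq_one {l : A} (hl : idConvS l = 1) : IsNormalizedIntegral l := by
  have : epsR l = counit (R := ℂ) := by
    rw [← epsR_idConvS, hl]
    ext; simp
  exact this

theorem act_one_of_normalized {l : A} (hl : IsNormalizedIntegral l) : T.act l 1 = 1 := by
  rw [T.act_one, idConvS_eq_one_of_normalized hl, T.one_act]

theorem act_fixed_of_normalized {l : A} (hl : IsNormalizedIntegral l) {n : M.toStarSubalgebra}
    (hn : n ∈ T.fixedPoints) : T.act l n = n := by
  rw [T.act_fixed hn, T.act_one_of_normalized hl, one_mul]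

/-! ### Positivity of the maps `E_l` -/

theorem act_star_mul {l : A} {m : ℕ} {a : Fin m → A}
    (ha : TensorProduct.map S LinearMap.id (comul (R := ℂ) l) = ∑ i, star (a i) ⊗ₜ[ℂ] a i)
    (x y : M.toStarSubalgebra) :
    T.act l (star x * y) = ∑ i, star (T.act (a i) x) * T.act (a i) y := by
  let f : A →ₗ[ℂ] M.toStarSubalgebra :=
    { toFun := fun p => star (T.act (star p) x)
      map_add' := fun p q => by simp
      map_smul' := fun c p => by simp }
  have h1 : ∀ t : A ⊗[ℂ] A,
      LinearMap.mul' ℂ _ (TensorProduct.map (T.act.flip (star x)) (T.act.flip y) t) =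
      LinearMap.mul' ℂ _ (TensorProduct.map f (T.act.flip y)
        (TensorProduct.map S LinearMap.id t)) := by
    intro t
    induction t using TensorProduct.induction_on with
    | zero => simp
    | tmul u v =>
      have : T.act u (star x) = star (T.act (star (S u)) x) := by
        rw [T.star_act_star, star_star]
      simp [f, this]
    | add a b ha hb => simp only [map_add, ha, hb]
  rw [T.act_mul, h1, ha]
  simp [f]

section Positivity

variable [FiniteDimensional ℂ A]

theorem isPositiveMap_act {l : A} (hl : IsPositiveIntegral l) : IsPositiveMap (T.act l) := by
  obtain ⟨k, a, ha⟩ := (isPositiveIntegral_iff l).1 hl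
  intro m hm
  obtain ⟨x, rfl⟩ := exists_eq_star_mul_self hm
  rw [T.act_star_mul ha]
  exact isPositive_sum_star_mul_self _

theorem isFaithfulMap_act {l : A} (hl : IsPositiveIntegral l) (hn : IsNondegenerateIntegral l) :
    IsFaithfulMap (T.act l) := by
  obtain ⟨k, a, ha⟩ := (isPositiveIntegral_iff l).1 hl
  intro m hm
  rw [T.act_star_mul ha] at hm
  have h1 := eq_zero_of_sum_star_mul_self hm
  have h2 : (⊤ : Submodule ℂ A) ≤ LinearMap.ker (T.act.flip m) := by
    rw [← span_eq_top_of_nondegenerate hn ha, Submodule.span_le]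
    rintro _ ⟨i, rfl⟩
    exact h1 i
  have h3 : T.act 1 m = 0 := h2 (Submodule.mem_top (x := (1 : A)))
  rwa [T.one_act] at h3

variable [PartialOrder A] [StarOrderedRing A]

/-- A modular relation for `E_h`: trading `c` for `S⁻¹(c)` behind `h` moves a factor from the right
of `m` to the left. -/
theorem act_mul_act_right {h : A} (hh : IsHaarProjection h) {c : A} (hc : c ∈ rightSubalg A)
    (m : M.toStarSubalgebra) :
    T.act h (m * T.act c 1) = T.act h (star (T.act (star c) 1) * m) := by
  rw [T.star_act, star_one, ← T.act_left (star_S_star_mem_left hc), ← T.mul_act,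
    hh.mul_star_S_star hc, T.act_mul_right _ hc]

theorem act_eq_conj_sqrt {h : A} (hh : IsHaarProjection h) {l : A} (hl : l ∈ leftIntegrals A)
    (hd : 0 ≤ dR l) (m : M.toStarSubalgebra) :
    T.act l m = T.act h (star (T.act (CFC.sqrt (dR l)) 1) * m * T.act (CFC.sqrt (dR l)) 1) := by
  have hc : CFC.sqrt (dR l) ∈ rightSubalg A := sqrt_mem_right (dR_mem l)
  have hcs : star (CFC.sqrt (dR l)) = CFC.sqrt (dR l) := IsSelfAdjoint.of_nonneg (CFC.sqrt_nonneg _)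
  have h1 := T.act_mul_act_right hh hc (m * T.act (CFC.sqrt (dR l)) 1)
  rw [hcs, ← mul_assoc] at h1
  rw [← h1, ← T.act_right hc m, ← T.act_right hc, ← T.mul_act, ← T.mul_act, mul_assoc,
    CFC.sqrt_mul_sqrt_self _ hd, ← hh.eq_mul_dR hl]

/-! ### Standard actions -/

omit [FiniteDimensional ℂ A] [PartialOrder A] [StarOrderedRing A] in
theorem IsStandard.eq_zero_of_left {T : VNModuleAlgebra A M} (hT : T.IsStandard) {b : A}
    (hb : b ∈ leftSubalg A) (h : T.act b 1 = 0) : b = 0 :=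
  hT.injOn hb (leftStarSubalgebra A).zero_mem (by simpa using h)

omit [FiniteDimensional ℂ A] [PartialOrder A] [StarOrderedRing A] in
theorem IsStandard.eq_zero_of_right {T : VNModuleAlgebra A M} (hT : T.IsStandard) {c : A}
    (hc : c ∈ rightSubalg A) (h : T.act c 1 = 0) : c = 0 := by
  rw [T.act_one] at h
  exact idConvS_injOn_right hc (hT.eq_zero_of_left (idConvS_mem c) h)

/-- Evaluating at `l⋆ ▷ 1` gives `idConvS (l l⋆) = 0`, that is `l l⋆ h = 0`. Since `h l = l`, this
reads `l l⋆ = 0`. -/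
theorem IsStandard.eq_zero_of_act_eq_zero {T : VNModuleAlgebra A M} (hT : T.IsStandard) {l : A}
    (hl : l ∈ leftIntegrals A) (h0 : ∀ m, T.act l m = 0) : l = 0 := by
  obtain ⟨h, hh⟩ := exists_isHaarProjection (A := A)
  have h1 : T.act (idConvS (l * star l)) 1 = 0 := by
    rw [← T.act_one, T.mul_act, h0]
  have h2 := (hh.idConvS_eq_zero_iff _).1 (hT.eq_zero_of_left (idConvS_mem _) h1)
  have h3 : l * star l * h = l * star l := by
    rw [mul_assoc, ← hh.star_eq, ← star_mul, hh.mul_leftIntegral hl]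
  rw [h3] at h2
  exact (CStarRing.mul_star_self_eq_zero_iff l).1 h2

omit [FiniteDimensional ℂ A] [PartialOrder A] [StarOrderedRing A] in
theorem IsStandard.act_one_eq_one_iff {T : VNModuleAlgebra A M} (hT : T.IsStandard) (l : A) :
    T.act l 1 = 1 ↔ IsNormalizedIntegral l := by
  refine ⟨fun h => normalized_of_idConvS_eq_one ?_, T.act_one_of_normalized⟩
  refine hT.injOn (idConvS_mem l) (leftStarSubalgebra A).one_mem ?_
  change T.act (idConvS l) 1 = T.act 1 1
  rw [← T.act_one, h, T.one_act]

theorem eq_zero_of_forall_act_mul_right {h : A} (hh : IsHaarProjection h) {y : M.toStarSubalgebra}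
    (h0 : ∀ m, T.act h (m * y) = 0) : y = 0 :=
  T.isFaithfulMap_act hh.isPositiveIntegral hh.isNondegenerateIntegral y (h0 _)

theorem eq_zero_of_forall_act_mul_left {h : A} (hh : IsHaarProjection h) {y : M.toStarSubalgebra}
    (h0 : ∀ m, T.act h (y * m) = 0) : y = 0 := by
  rw [← star_eq_zero]
  exact T.isFaithfulMap_act hh.isPositiveIntegral hh.isNondegenerateIntegral (star y)
    (by rw [star_star]; exact h0 _)

/-- Since `E_l = E_h(· (dR l ▷ 1))` with `E_h` faithful, both conditions amount to invertibility of
`dR l`. -/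
theorem IsStandard.isNondegenerateMap_iff {T : VNModuleAlgebra A M} (hT : T.IsStandard) {l : A}
    (hl : l ∈ leftIntegrals A) : IsNondegenerateMap (T.act l) ↔ IsNondegenerateIntegral l := by
  obtain ⟨h, hh⟩ := exists_isHaarProjection (A := A)
  have hd := dR_mem l
  have hE : ∀ m, T.act l m = T.act h (m * T.act (dR l) 1) := fun m => by
    rw [← T.act_mul_right _ hd, ← hh.eq_mul_dR hl]
  have hmul : ∀ {c e : A}, c ∈ rightSubalg A → e ∈ rightSubalg A →
      T.act (c * e) 1 = T.act e 1 * T.act c 1 := fun {c e} hc _ => by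
    rw [T.mul_act, T.act_right hc]
  constructor
  · intro hn
    refine hh.nondegenerate_of_isUnit hl ?_
    let R := Subalgebra.toSubmodule (rightStarSubalgebra A).toSubalgebra
    let f : R →ₗ[ℂ] R := (LinearMap.mulLeft ℂ (dR l)).restrict
      fun x hx => (rightStarSubalgebra A).mul_mem' hd hx
    have key : ∀ c ∈ rightSubalg A, dR l * c = 0 → c = 0 := by
      intro c hc h0
      refine hT.eq_zero_of_right hc (hn.2 _ fun m => ?_)
      rw [hE, mul_assoc, ← hmul hd hc, h0]
      simp
    have hf : Function.Injective f := by
      rw [injective_iff_map_eq_zero]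
      intro b hb
      exact Subtype.ext (key b b.2 (congrArg Subtype.val hb))
    obtain ⟨e, he⟩ := LinearMap.injective_iff_surjective.1 hf ⟨1, (rightStarSubalgebra A).one_mem⟩
    have h1 : dR l * (e : A) = 1 := congrArg Subtype.val he
    refine ⟨⟨dR l, e, h1, ?_⟩, rfl⟩
    rw [← sub_eq_zero]
    refine key _ ((rightStarSubalgebra A).sub_mem ((rightStarSubalgebra A).mul_mem e.2 hd)
        (rightStarSubalgebra A).one_mem) ?_
    rw [mul_sub, ← mul_assoc, h1, mul_one, one_mul, sub_self]
  · intro hn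
    have hu := hh.isUnit_dR_of_nondegenerate hl hn
    have key : ∀ y : M.toStarSubalgebra, T.act (dR l) y = 0 → y = 0 := by
      intro y hy
      obtain ⟨u, hu⟩ := hu
      rw [← T.one_act y, ← u.inv_mul, T.mul_act, hu, hy, map_zero]
    constructor
    · intro m hm
      have h1 : star (T.act (star (dR l)) 1) * m = 0 := by
        refine T.eq_zero_of_forall_act_mul_left hh fun m' => ?_
        rw [mul_assoc, ← T.act_mul_act_right hh hd, ← hE, hm]
      have h2 := congrArg star h1
      rw [star_mul, star_star, star_zero, ← T.act_right (star_mem_right hd)] at h2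
      obtain ⟨u, hu⟩ := hu.star
      rw [← star_eq_zero, ← T.one_act (star m), ← u.inv_mul, T.mul_act, hu, h2, map_zero]
    · intro m hm
      refine key m (T.eq_zero_of_forall_act_mul_right hh fun m' => ?_)
      rw [T.act_right hd, ← mul_assoc, ← hE, hm]

/-- Here `e` is the negative part of `d` and `k = e^{3/2}`; both stay in the closed ⋆-subalgebra
`A_R`. -/
theorem exists_negPart_of_mem_right {d : A} (hd : d ∈ rightSubalg A) (hsa : star d = d) :
    ∃ e ∈ rightSubalg A, ∃ k ∈ rightSubalg A, star e = e ∧ star k = k ∧ d * e = -(e * e) ∧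
      k * k = e * e * e ∧ (k = 0 → 0 ≤ d) := by
  have he : d⁻ ∈ rightSubalg A := negPart_mem_right hd
  have he0 : 0 ≤ d⁻ := CFC.negPart_nonneg _
  have hes : star d⁻ = d⁻ := IsSelfAdjoint.of_nonneg he0
  have hk0 : 0 ≤ d⁻ * d⁻ * d⁻ := by
    have := star_left_conjugate_nonneg he0 d⁻
    rwa [hes] at this
  refine ⟨d⁻, he, CFC.sqrt (d⁻ * d⁻ * d⁻), sqrt_mem_right
    ((rightStarSubalgebra A).mul_mem ((rightStarSubalgebra A).mul_mem he he) he), hes,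
    IsSelfAdjoint.of_nonneg (CFC.sqrt_nonneg _), ?_, CFC.sqrt_mul_sqrt_self _ hk0, fun h5 => ?_⟩
  · conv_lhs => enter [1]; rw [← CFC.posPart_sub_negPart d hsa]
    rw [sub_mul, CFC.posPart_mul_negPart, zero_sub]
  · have h6 : d⁻ * d⁻ * d⁻ = 0 := by
      rw [← CFC.sqrt_mul_sqrt_self _ hk0, h5, mul_zero]
    have h7 : d⁻ * d⁻ = 0 := by
      rw [← CStarRing.star_mul_self_eq_zero_iff, star_mul, hes, ← mul_assoc, h6, zero_mul]
    have h8 : d⁻ = 0 := by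
      rw [← CStarRing.star_mul_self_eq_zero_iff, hes, h7]
    rw [← CFC.posPart_sub_negPart d hsa, h8, sub_zero]
    exact CFC.posPart_nonneg _

theorem neg_act (a : A) (m : M.toStarSubalgebra) : T.act (-a) m = -T.act a m := by
  refine eq_neg_of_add_eq_zero_left ?_
  rw [← LinearMap.add_apply, ← map_add, neg_add_cancel, map_zero, LinearMap.zero_apply]

/-- By the modular relation the left side is `E_h(e d e ▷ 1)` with `d = dR l`, and `e d e = -e³ =
-k²`. -/
theorem act_star_mul_self_eq_neg {h l e k : A} (hh : IsHaarProjection h)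
    (hl : l ∈ leftIntegrals A) (he : e ∈ rightSubalg A) (hk : k ∈ rightSubalg A)
    (hes : star e = e) (hks : star k = k) (hde : dR l * e = -(e * e)) (hkk : k * k = e * e * e) :
    T.act l (star (T.act e 1) * T.act e 1) = -T.act h (star (T.act k 1) * T.act k 1) := by
  have h2 := T.act_mul_act_right hh he (T.act e 1 * T.act (dR l) 1)
  have h3 := T.act_mul_act_right hh hk (T.act k 1)
  have hE : ∀ m, T.act l m = T.act h (m * T.act (dR l) 1) := fun m => by
    rw [← T.act_mul_right _ (dR_mem l), ← hh.eq_mul_dR hl]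
  rw [hes] at h2
  rw [hks] at h3
  have h4 : e * (dR l * e) = -(k * k) := by rw [hde, hkk, mul_neg, mul_assoc]
  have h5 : T.act e 1 * T.act (dR l) 1 * T.act e 1 = T.act (e * (dR l * e)) 1 := by
    rw [T.mul_act e (dR l * e) 1, T.mul_act (dR l) e 1, T.act_right he (T.act (dR l) (T.act e 1)),
      T.act_right (dR_mem l) (T.act e 1)]
  have h6 : T.act k 1 * T.act k 1 = T.act (k * k) 1 := by
    rw [T.mul_act k k 1, T.act_right hk (T.act k 1)]
  rw [h5, h4] at h2
  rw [h6] at h3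
  have h7 : T.act h (T.act (-(k * k)) 1) = -T.act h (T.act (k * k) 1) :=
    calc T.act h (T.act (-(k * k)) 1) = T.act (h * -(k * k)) 1 := (T.mul_act h (-(k * k)) 1).symm
      _ = T.act (-(h * (k * k))) 1 := by rw [mul_neg]
      _ = -T.act (h * (k * k)) 1 := T.neg_act _ _
      _ = -T.act h (T.act (k * k) 1) := congrArg Neg.neg (T.mul_act h (k * k) 1)
  calc _ = _ := (hE _).trans (congrArg (T.act h) (mul_assoc _ _ _))
    _ = _ := h2.symm.trans h7
    _ = _ := congrArg Neg.neg h3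

theorem IsStandard.star_dR_of_isPositiveMap {T : VNModuleAlgebra A M} (hT : T.IsStandard) {h l : A}
    (hh : IsHaarProjection h) (hl : l ∈ leftIntegrals A) (hp : IsPositiveMap (T.act l)) :
    star (dR l) = dR l := by
  have hd := dR_mem l
  have hE : ∀ m, T.act l m = T.act h (m * T.act (dR l) 1) := fun m => by
    rw [← T.act_mul_right _ hd, ← hh.eq_mul_dR hl]
  have h1 : star (T.act (dR l) 1) - star (T.act (star (dR l)) 1) = 0 := by
    refine T.eq_zero_of_forall_act_mul_left hh fun m => ?_
    have h2 := map_star_of_isPositiveMap hp (star m)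
    rw [star_star, hE, hE, ← map_star_of_isPositiveMap (T.isPositiveMap_act hh.isPositiveIntegral),
      star_mul, star_star, T.act_mul_act_right hh hd] at h2
    rw [sub_mul, map_sub, h2, sub_self]
  have h2 : T.act (star (dR l) - dR l) 1 = 0 := by
    rw [← star_sub, star_eq_zero] at h1
    rw [map_sub, LinearMap.sub_apply, ← neg_sub, h1, neg_zero]
  exact sub_eq_zero.1 (hT.eq_zero_of_right
    ((rightStarSubalgebra A).sub_mem (star_mem_right hd) hd) h2)

/-- Testing `E_l` on `(e ▷ 1)⋆(e ▷ 1)`, with `e` the negative part of `dR l`, gives a value that is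
both `≥ 0` and `≤ 0`. Faithfulness of `E_h` and standardness then force `k = 0`, hence `0 ≤ dR l`.
-/
theorem IsStandard.isPositiveMap_iff {T : VNModuleAlgebra A M} (hT : T.IsStandard) {l : A}
    (hl : l ∈ leftIntegrals A) : IsPositiveMap (T.act l) ↔ IsPositiveIntegral l := by
  refine ⟨fun hp => ?_, T.isPositiveMap_act⟩
  obtain ⟨h, hh⟩ := exists_isHaarProjection (A := A)
  refine hh.isPositiveIntegral_of_dR_nonneg hl ?_
  obtain ⟨e, he, k, hk, hes, hks, hde, hkk, hk0⟩ := exists_negPart_of_mem_right (dR_mem l)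
    (hT.star_dR_of_isPositiveMap hh hl hp)
  have h1 := T.act_star_mul_self_eq_neg hh hl he hk hes hks hde hkk
  have h2 : (T.act h (star (T.act k 1) * T.act k 1) : H →L[ℂ] H).IsPositive :=
    T.isPositiveMap_act hh.isPositiveIntegral _ (isPositive_star_mul_self (T.act k 1))
  have h3 : (T.act l (star (T.act e 1) * T.act e 1) : H →L[ℂ] H).IsPositive :=
    hp _ (isPositive_star_mul_self (T.act e 1))
  rw [h1] at h3
  rw [← ContinuousLinearMap.nonneg_iff_isPositive] at h2 h3
  have h4 : T.act h (star (T.act k 1) * T.act k 1) = 0 :=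
    Subtype.ext (le_antisymm (neg_nonneg.1 h3) h2)
  exact hk0 (hT.eq_zero_of_right hk
    (T.isFaithfulMap_act hh.isPositiveIntegral hh.isNondegenerateIntegral _ h4))

end Positivity

end VNModuleAlgebra

end

/-! ### Ultraweak topology through the amplification to square-summable sequences -/

section Amplification

open Filter Topology

variable {H : Type*} [NormedAddCommGroup H] [InnerProductSpace ℂ H] [CompleteSpace H]

variable (H) in
/-- Square-summable sequences in `H`. -/
abbrev L2Seq : Type _ := lp (fun _ : ℕ => H) 2

theorem memℓp_two_iff {ξ : ℕ → H} :
    Memℓp ξ 2 ↔ Summable fun n => ‖ξ n‖ ^ 2 := by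
  rw [memℓp_gen_iff (by norm_num)]
  norm_num

theorem L2Seq.hasSum_norm_sq (ξ : L2Seq H) : HasSum (fun n => ‖ξ n‖ ^ 2) (‖ξ‖ ^ 2) := by
  have := lp.hasSum_norm (p := 2) (by norm_num) ξ
  norm_num at this
  exact this

/-- The diagonal amplification of a bounded linear map, as a linear map. -/
def amplifyLinear (x : H →L[ℂ] H) : L2Seq H →ₗ[ℂ] L2Seq H where
  toFun ξ := ⟨fun n => x (ξ n), memℓp_two_iff.2 <| Summable.of_nonneg_of_le
    (fun _ => by positivity)
    (fun n => by
      have := x.le_opNorm (ξ n)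
      calc ‖x (ξ n)‖ ^ 2 ≤ (‖x‖ * ‖ξ n‖) ^ 2 := by gcongr
        _ = ‖x‖ ^ 2 * ‖ξ n‖ ^ 2 := mul_pow _ _ _)
    ((L2Seq.hasSum_norm_sq ξ).summable.mul_left (‖x‖ ^ 2))⟩
  map_add' ξ η := by ext n; exact map_add x _ _
  map_smul' c ξ := by ext n; exact map_smul x _ _

theorem norm_amplifyLinear_le (x : H →L[ℂ] H) (ξ : L2Seq H) :
    ‖amplifyLinear x ξ‖ ≤ ‖x‖ * ‖ξ‖ := by
  refine le_of_sq_le_sq ?_ (by positivity)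
  rw [mul_pow]
  refine hasSum_le (fun n => ?_) (L2Seq.hasSum_norm_sq (amplifyLinear x ξ))
    ((L2Seq.hasSum_norm_sq ξ).mul_left (‖x‖ ^ 2))
  calc ‖x (ξ n)‖ ^ 2 ≤ (‖x‖ * ‖ξ n‖) ^ 2 := by gcongr; exact x.le_opNorm _
    _ = ‖x‖ ^ 2 * ‖ξ n‖ ^ 2 := mul_pow _ _ _

/-- The diagonal amplification `x ⊗ 1` of `x` to the square-summable sequences. -/
def amplify (x : H →L[ℂ] H) : L2Seq H →L[ℂ] L2Seq H :=
  (amplifyLinear x).mkContinuous ‖x‖ (norm_amplifyLinear_le x)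

theorem amplify_apply (x : H →L[ℂ] H) (ξ : L2Seq H) (n : ℕ) : amplify x ξ n = x (ξ n) := rfl

theorem amplify_one : amplify (1 : H →L[ℂ] H) = 1 := by ext ξ n; rfl

theorem amplify_mul (x y : H →L[ℂ] H) : amplify (x * y) = amplify x * amplify y := by
  ext ξ n; rfl

theorem amplify_add (x y : H →L[ℂ] H) : amplify (x + y) = amplify x + amplify y := by
  ext ξ n; rfl

theorem amplify_sub (x y : H →L[ℂ] H) : amplify (x - y) = amplify x - amplify y := by
  ext ξ n; rfl

theorem amplify_smul (c : ℂ) (x : H →L[ℂ] H) : amplify (c • x) = c • amplify x := by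
  ext ξ n; rfl

theorem amplify_sum {ι : Type*} (s : Finset ι) (x : ι → H →L[ℂ] H) :
    amplify (∑ i ∈ s, x i) = ∑ i ∈ s, amplify (x i) :=
  map_sum (AddMonoidHom.mk' amplify amplify_add) x s

theorem inner_amplify_left (x : H →L[ℂ] H) (ξ η : L2Seq H) :
    ⟪amplify x ξ, η⟫_ℂ = ⟪ξ, amplify (star x) η⟫_ℂ := by
  rw [lp.inner_eq_tsum, lp.inner_eq_tsum]
  exact tsum_congr fun n => (ContinuousLinearMap.adjoint_inner_right x (ξ n) (η n)).symm

theorem amplify_star (x : H →L[ℂ] H) : amplify (star x) = star (amplify x) := by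
  rw [ContinuousLinearMap.star_eq_adjoint (amplify x), ContinuousLinearMap.eq_adjoint_iff]
  intro ξ η
  rw [inner_amplify_left, star_star]

theorem norm_amplify_le (x : H →L[ℂ] H) (ξ : L2Seq H) : ‖amplify x ξ‖ ≤ ‖x‖ * ‖ξ‖ :=
  norm_amplifyLinear_le x ξ

theorem amplify_single (x : H →L[ℂ] H) (n : ℕ) (v : H) :
    amplify x (lp.single 2 n v) = lp.single 2 n (x v) := by
  ext k
  rw [amplify_apply, lp.single_apply, lp.single_apply]
  rcases eq_or_ne k n with rfl | h
  · rw [Pi.single_eq_same, Pi.single_eq_same]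
  · rw [Pi.single_eq_of_ne h, Pi.single_eq_of_ne h, map_zero]

theorem ext_inner_amplify {x y : H →L[ℂ] H}
    (h : ∀ ξ η : L2Seq H, ⟪ξ, amplify x η⟫_ℂ = ⟪ξ, amplify y η⟫_ℂ) : x = y := by
  ext v
  refine ext_inner_left ℂ fun w => ?_
  have := h (lp.single 2 0 w) (lp.single 2 0 v)
  rw [amplify_single, amplify_single] at this
  simpa [lp.inner_single_left] using this

/-- Two square-summable sequences can be interleaved into one. -/
theorem exists_norm_sq_amplify_eq_add (ξ η : L2Seq H) :
    ∃ ζ : L2Seq H, ∀ x : H →L[ℂ] H, ‖amplify x ζ‖ ^ 2 = ‖amplify x ξ‖ ^ 2 + ‖amplify x η‖ ^ 2 := by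
  let f : ℕ → H := fun n => if Even n then ξ (n / 2) else η (n / 2)
  have hf0 : ∀ k, f (2 * k) = ξ k := fun k => by simp [f]
  have hf1 : ∀ k, f (2 * k + 1) = η k := fun k => by
    have h1 : ¬ Even (2 * k + 1) := by simp
    have h2 : (2 * k + 1) / 2 = k := by omega
    simp only [f, if_neg h1, h2]
  have key : ∀ x : H →L[ℂ] H, HasSum (fun n => ‖x (f n)‖ ^ 2)
      (‖amplify x ξ‖ ^ 2 + ‖amplify x η‖ ^ 2) := fun x =>
    HasSum.even_add_odd (by simp only [hf0]; exact L2Seq.hasSum_norm_sq (amplify x ξ))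
      (by simp only [hf1]; exact L2Seq.hasSum_norm_sq (amplify x η))
  exact ⟨⟨f, memℓp_two_iff.2 (key 1).summable⟩, fun x =>
    (L2Seq.hasSum_norm_sq _).unique (key x)⟩

variable {M : VonNeumannAlgebra H}

theorem tendsto_nhds_ultraweak_iff {X : Type*} {l : Filter X} {f : X → M.toStarSubalgebra}
    {y : M.toStarSubalgebra} :
    Tendsto f l (@nhds _ (ultraweakTopology M) y) ↔ ∀ ξ η : L2Seq H,
      Tendsto (fun x => ⟪ξ, amplify (f x : H →L[ℂ] H) η⟫_ℂ) l
        (𝓝 ⟪ξ, amplify (y : H →L[ℂ] H) η⟫_ℂ) := by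
  simp only [nhds_iInf, nhds_induced, tendsto_iInf, tendsto_comap_iff]
  exact ⟨fun h ξ η => h ξ η (L2Seq.hasSum_norm_sq ξ).summable (L2Seq.hasSum_norm_sq η).summable,
    fun h ξ η hξ hη => h ⟨ξ, memℓp_two_iff.2 hξ⟩ ⟨η, memℓp_two_iff.2 hη⟩⟩

theorem IsUltraweaklyContinuous.tendsto {F : M.toStarSubalgebra → M.toStarSubalgebra}
    (hF : IsUltraweaklyContinuous M F) {X : Type*} {l : Filter X} {f : X → M.toStarSubalgebra}
    {y : M.toStarSubalgebra}
    (h : ∀ ξ η : L2Seq H, Tendsto (fun x => ⟪ξ, amplify (f x : H →L[ℂ] H) η⟫_ℂ) l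
        (𝓝 ⟪ξ, amplify (y : H →L[ℂ] H) η⟫_ℂ)) (ξ η : L2Seq H) :
    Tendsto (fun x => ⟪ξ, amplify (F (f x) : H →L[ℂ] H) η⟫_ℂ) l
        (𝓝 ⟪ξ, amplify (F y : H →L[ℂ] H) η⟫_ℂ) :=
  tendsto_nhds_ultraweak_iff.1 ((@Continuous.tendsto _ _ (ultraweakTopology M)
    (ultraweakTopology M) _ hF y).comp (tendsto_nhds_ultraweak_iff.2 h)) ξ η

theorem tendsto_inner_amplify {X : Type*} {l : Filter X} {f : X → M.toStarSubalgebra}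
    {y : M.toStarSubalgebra} (h : Tendsto f l (𝓝 y)) (ξ η : L2Seq H) :
    Tendsto (fun x => ⟪ξ, amplify (f x : H →L[ℂ] H) η⟫_ℂ) l
        (𝓝 ⟪ξ, amplify (y : H →L[ℂ] H) η⟫_ℂ) := by
  have h1 : Continuous fun x : H →L[ℂ] H => amplify x :=
    AddMonoidHomClass.continuous_of_bound (AddMonoidHom.mk' amplify amplify_add) 1 fun x => by
      rw [one_mul]
      exact ContinuousLinearMap.opNorm_le_bound _ (norm_nonneg _) (norm_amplify_le x)
  have h2 : Tendsto (fun x => amplify (f x : H →L[ℂ] H) η) l (𝓝 (amplify (y : H →L[ℂ] H) η)) :=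
    ((h1.clm_apply continuous_const).comp continuous_subtype_val).continuousAt.tendsto.comp h
  exact tendsto_const_nhds.inner h2

/-- Closed graph theorem: norm limits are ultraweak limits, and these are unique. -/
theorem IsUltraweaklyContinuous.continuous {F : M.toStarSubalgebra →ₗ[ℂ] M.toStarSubalgebra}
    (hF : IsUltraweaklyContinuous M F) : Continuous F := by
  have := (isClosed_vonNeumannAlgebra M).completeSpace_coe
  refine LinearMap.continuous_of_seq_closed_graph F fun u x y hu hFu => ?_
  refine Subtype.ext (ext_inner_amplify fun ξ η => ?_)
  exact tendsto_nhds_unique (tendsto_inner_amplify hFu ξ η)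
    (hF.tendsto (tendsto_inner_amplify hu) ξ η)

end Amplification

/-! ### Domination of bimodule maps by the Gram form -/

section SelfDuality

open Filter Topology

/-- Riesz representation on the closed range of `V`: the bound makes `φ` factor through the range,
and Hahn–Banach extends it to the closure. -/
theorem exists_mem_closure_range_inner_eq {E K : Type*} [AddCommGroup E] [Module ℂ E]
    [NormedAddCommGroup K] [InnerProductSpace ℂ K] [CompleteSpace K] (V : E →ₗ[ℂ] K)
    (φ : E →ₗ[ℂ] ℂ) {C : ℝ} (hC0 : 0 ≤ C)
    (hC : ∀ x, ‖φ x‖ ≤ C * ‖V x‖) :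
    ∃ κ ∈ closure (Set.range V), (∀ x, ⟪κ, V x⟫_ℂ = φ x) ∧ ‖κ‖ ≤ C := by
  obtain ⟨g, hg⟩ := V.rangeRestrict.exists_rightInverse_of_surjective V.range_rangeRestrict
  have hg' : ∀ y, V (g y) = y := fun y => congrArg Subtype.val (LinearMap.congr_fun hg y)
  have hφ : ∀ x, φ (g (V.rangeRestrict x)) = φ x := fun x => by
    have h1 := hC (g (V.rangeRestrict x) - x)
    rw [map_sub V, hg', LinearMap.codRestrict_apply, sub_self, norm_zero, mul_zero,
      norm_le_zero_iff, map_sub, sub_eq_zero] at h1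
    exact h1
  let f : StrongDual ℂ (LinearMap.range V) := (φ ∘ₗ g).mkContinuous C fun y => by
    have := hC (g y)
    rwa [hg'] at this
  obtain ⟨f', hf', -⟩ := exists_extension_norm_eq (LinearMap.range V) f
  let W := (LinearMap.range V).topologicalClosure
  have : CompleteSpace W := (LinearMap.range V).isClosed_topologicalClosure.completeSpace_coe
  let κ : W := (InnerProductSpace.toDual ℂ W).symm (f'.comp W.subtypeL)
  have hκ : ∀ x, ⟪(κ : K), V x⟫_ℂ = φ x := fun x => by
    have h1 : V x ∈ W := (LinearMap.range V).le_topologicalClosure ⟨x, rfl⟩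
    have h2 := InnerProductSpace.toDual_symm_apply (𝕜 := ℂ) (x := (⟨V x, h1⟩ : W))
      (y := f'.comp W.subtypeL)
    rw [← hφ, ← LinearMap.comp_apply]
    exact h2.trans (hf' (V.rangeRestrict x))
  have hcl : (κ : K) ∈ closure (Set.range V) := κ.2
  refine ⟨κ, hcl, hκ, ?_⟩
  have h3 : IsClosed {w : K | ‖⟪(κ : K), w⟫_ℂ‖ ≤ C * ‖w‖} :=
    isClosed_le (by fun_prop) (by fun_prop)
  have h4 : ‖⟪(κ : K), (κ : K)⟫_ℂ‖ ≤ C * ‖(κ : K)‖ := by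
    refine closure_minimal (s := Set.range V) ?_ h3 hcl
    rintro _ ⟨x, rfl⟩
    change ‖⟪(κ : K), V x⟫_ℂ‖ ≤ _
    rw [hκ]
    exact hC x
  rw [inner_self_eq_norm_sq_to_K, norm_pow, RCLike.norm_ofReal, abs_norm, sq] at h4
  rcases eq_or_lt_of_le (norm_nonneg (κ : K)) with h5 | h5
  · rwa [← h5]
  · exact le_of_mul_le_mul_right h4 h5

theorem norm_sq_apply_of_star_mul_self_eq {K ι : Type*} [Fintype ι] [NormedAddCommGroup K]
    [InnerProductSpace ℂ K] [CompleteSpace K] {k : K →L[ℂ] K} {d : ι → K →L[ℂ] K} {ε : ℝ}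
    (h : star k * k = ∑ i, star (d i) * d i + (ε : ℂ) • 1) (v : K) :
    ‖k v‖ ^ 2 = ∑ i, ‖d i v‖ ^ 2 + ε * ‖v‖ ^ 2 := by
  have hv : ∀ w : K, ⟪w, w⟫_ℂ = (‖w‖ ^ 2 : ℝ) := fun w => by
    rw [inner_self_eq_norm_sq_to_K]
    norm_cast
  have key : ∀ x : K →L[ℂ] K, ⟪v, (star x * x) v⟫_ℂ = (‖x v‖ ^ 2 : ℝ) := fun x => by
    rw [← hv]
    exact ContinuousLinearMap.adjoint_inner_right x v (x v)
  have h1 := key k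
  rw [h, _root_.add_apply, _root_.sum_apply, inner_add_right, inner_sum, _root_.smul_apply,
    one_apply_eq_self, inner_smul_right, hv, Finset.sum_congr rfl fun i _ => key (d i)] at h1
  exact_mod_cast h1.symm

variable {H : Type*} [NormedAddCommGroup H] [InnerProductSpace ℂ H] [CompleteSpace H]

/-- An invertible element of a closed ⋆-subalgebra approximating an inverse square root. -/
theorem exists_inv_sqrt {B : StarSubalgebra ℂ (H →L[ℂ] H)} (hB : IsClosed (B : Set (H →L[ℂ] H)))
    {b : H →L[ℂ] H} (hb : b ∈ B) (hb0 : 0 ≤ b) {ε : ℝ} (hε : 0 < ε) :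
    ∃ n ∈ B, ∃ k, n * k = 1 ∧ k * n = 1 ∧ star k * k = b + (ε : ℂ) • 1 := by
  have hs : ∀ t ∈ spectrum ℝ b, 0 ≤ t := fun t ht => spectrum_nonneg_of_nonneg hb0 ht
  have hsa : IsSelfAdjoint b := IsSelfAdjoint.of_nonneg hb0
  have hf : ContinuousOn (fun t : ℝ => (√(t + ε))⁻¹) (spectrum ℝ b) := by
    refine ContinuousOn.inv₀ (by fun_prop) fun t ht => ?_
    have := hs t ht
    positivity
  have hg : ContinuousOn (fun t : ℝ => √(t + ε)) (spectrum ℝ b) := by fun_prop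
  have h1 : cfc (fun t : ℝ => (√(t + ε))⁻¹) b * cfc (fun t : ℝ => √(t + ε)) b = 1 := by
    rw [← cfc_mul _ _ b hf hg, ← cfc_one ℝ b hsa]
    refine cfc_congr fun t ht => ?_
    have := hs t ht
    have : √(t + ε) ≠ 0 := by positivity
    simp [this]
  refine ⟨cfc (fun t : ℝ => (√(t + ε))⁻¹) b, cfc_mem (𝕜' := ℂ) (hs := hB) _ hb,
    cfc (fun t : ℝ => √(t + ε)) b, h1, ?_, ?_⟩
  · rw [cfc_commute_cfc _ _ b |>.eq] 
    exact h1
  · have h2 : star (cfc (fun t : ℝ => √(t + ε)) b) = cfc (fun t : ℝ => √(t + ε)) b :=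
      cfc_predicate (p := IsSelfAdjoint) _ b
    rw [h2, ← cfc_mul _ _ b hg hg]
    have h3 : cfc (fun t : ℝ => √(t + ε) * √(t + ε)) b = cfc (fun t : ℝ => t + ε) b :=
      cfc_congr fun t ht => by
        have := hs t ht
        exact Real.mul_self_sqrt (by positivity)
    rw [h3, cfc_add_const ε (fun t => t) b (by fun_prop) hsa, cfc_id' ℝ b hsa,
      Algebra.algebraMap_eq_smul_one]
    rfl

variable {M : VonNeumannAlgebra H} {ι : Type*} [Fintype ι]

/-- A decomposition `E(x⋆y) = ∑ᵢ Dᵢ(x)⋆ Dᵢ(y)` of an `N`-valued map through ultraweakly continuous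
right `N`-linear maps `Dᵢ` whose span contains the identity. -/
structure IsGramDecomposition (N : StarSubalgebra ℂ M.toStarSubalgebra)
    (E : M.toStarSubalgebra →ₗ[ℂ] M.toStarSubalgebra)
    (D : ι → M.toStarSubalgebra →ₗ[ℂ] M.toStarSubalgebra) (c : ι → ℂ) : Prop where
  apply_star_mul : ∀ x y, E (star x * y) = ∑ i, star (D i x) * D i y
  sum_smul : ∀ x, ∑ i, c i • D i x = x
  mem : ∀ x, E x ∈ N
  apply_mul : ∀ i x, ∀ n ∈ N, D i (x * n) = D i x * n
  continuous : ∀ i, IsUltraweaklyContinuous M (D i)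
  isClosed : IsClosed (N : Set M.toStarSubalgebra)

namespace IsGramDecomposition

variable {N : StarSubalgebra ℂ M.toStarSubalgebra}
  {E F : M.toStarSubalgebra →ₗ[ℂ] M.toStarSubalgebra}
  {D : ι → M.toStarSubalgebra →ₗ[ℂ] M.toStarSubalgebra} {c : ι → ℂ}

/-- Cauchy–Schwarz for `x = ∑ cᵢ Dᵢ(x)`: up to a constant, `E(x⋆x)` dominates `x⋆x`. -/
theorem norm_sq_apply_le (h : IsGramDecomposition N E D c) (x : M.toStarSubalgebra) (v : H) :
    ‖(x : H →L[ℂ] H) v‖ ^ 2 ≤ (∑ i, ‖c i‖ ^ 2) * ∑ i, ‖(D i x : H →L[ℂ] H) v‖ ^ 2 := by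
  have h1 : (x : H →L[ℂ] H) v = ∑ i, c i • (D i x : H →L[ℂ] H) v := by
    conv_lhs => rw [← h.sum_smul x]
    simp
  calc ‖(x : H →L[ℂ] H) v‖ ^ 2 ≤ (∑ i, ‖c i‖ * ‖(D i x : H →L[ℂ] H) v‖) ^ 2 := by
        rw [h1]
        gcongr
        exact (norm_sum_le _ _).trans (Finset.sum_le_sum fun i _ => (norm_smul _ _).le)
    _ ≤ _ := Finset.sum_mul_sq_le_sq_mul_sq _ _ _

theorem coe_apply_star_mul_self (h : IsGramDecomposition N E D c) (x : M.toStarSubalgebra) :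
    (E (star x * x) : H →L[ℂ] H) = ∑ i, star (D i x : H →L[ℂ] H) * (D i x : H →L[ℂ] H) := by
  rw [h.apply_star_mul]
  simp

/-- Put `k = (E(x⋆x) + ε)^{1/2}` and `n = k⁻¹`, which lies in `N`. Then `x n` is bounded
independently of `x` and `ε`, so `F(x) = F(x n) k` is dominated by `k`. Let `ε → 0`. -/
theorem exists_norm_sq_amplify_le (h : IsGramDecomposition N E D c)
    (hF : ∀ x, ∀ n ∈ N, F (x * n) = F x * n) (hFc : Continuous F) :
    ∃ C : ℝ, 0 ≤ C ∧ ∀ x (ξ : L2Seq H), ‖amplify (F x : H →L[ℂ] H) ξ‖ ^ 2 ≤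
      C * ∑ i, ‖amplify (D i x : H →L[ℂ] H) ξ‖ ^ 2 := by
  let F' : M.toStarSubalgebra →L[ℂ] M.toStarSubalgebra := ⟨F, hFc⟩
  have hc0 : 0 ≤ ∑ i, ‖c i‖ ^ 2 := Finset.sum_nonneg fun i _ => by positivity
  refine ⟨‖F'‖ ^ 2 * ∑ i, ‖c i‖ ^ 2, by positivity, fun x ξ => ?_⟩
  have key : ∀ ε : ℝ, 0 < ε → ‖amplify (F x : H →L[ℂ] H) ξ‖ ^ 2 ≤
      (‖F'‖ ^ 2 * ∑ i, ‖c i‖ ^ 2) *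
        (∑ i, ‖amplify (D i x : H →L[ℂ] H) ξ‖ ^ 2 + ε * ‖ξ‖ ^ 2) := by
    intro ε hε
    have hcl : IsClosed (N.map M.toStarSubalgebra.subtype : Set (H →L[ℂ] H)) :=
      (isClosed_vonNeumannAlgebra M).isClosedMap_subtype_val _ h.isClosed
    have hb := h.coe_apply_star_mul_self x
    have hb0 : 0 ≤ (E (star x * x) : H →L[ℂ] H) := by
      rw [hb]
      exact Finset.sum_nonneg fun i _ => star_mul_self_nonneg _
    obtain ⟨n, hn, k, hnk, hkn, hk⟩ := exists_inv_sqrt hcl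
      (b := (E (star x * x) : H →L[ℂ] H)) ⟨_, h.mem _, rfl⟩ hb0 hε
    obtain ⟨n, hn, rfl⟩ := hn
    change (n : H →L[ℂ] H) * k = 1 at hnk
    change k * (n : H →L[ℂ] H) = 1 at hkn
    rw [hb] at hk
    have h1 : ‖x * n‖ ≤ √(∑ i, ‖c i‖ ^ 2) := by
      refine ContinuousLinearMap.opNorm_le_bound _ (by positivity) fun v => ?_
      refine le_of_sq_le_sq ?_ (by positivity)
      rw [mul_pow, Real.sq_sqrt hc0]
      refine (h.norm_sq_apply_le (x * n) v).trans ?_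
      gcongr
      have h2 := norm_sq_apply_of_star_mul_self_eq hk ((n : H →L[ℂ] H) v)
      have h3 : k ((n : H →L[ℂ] H) v) = v := congrArg (fun z : H →L[ℂ] H => z v) hkn
      rw [h3] at h2
      rw [h2]
      have h4 : ∀ i, (D i (x * n) : H →L[ℂ] H) v = (D i x : H →L[ℂ] H) ((n : H →L[ℂ] H) v) :=
        fun i => by rw [h.apply_mul i x n hn]; rfl
      simp only [h4]
      have : 0 ≤ ε * ‖(n : H →L[ℂ] H) v‖ ^ 2 := by positivity
      linarith
    have h5 : ‖F (x * n)‖ ≤ ‖F'‖ * √(∑ i, ‖c i‖ ^ 2) :=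
      (F'.le_opNorm (x * n)).trans (by gcongr)
    have h6 : amplify (F x : H →L[ℂ] H) ξ =
        amplify (F (x * n) : H →L[ℂ] H) (amplify k ξ) := by
      rw [hF x n hn]
      change _ = (amplify ((F x : H →L[ℂ] H) * (n : H →L[ℂ] H)) * amplify k) ξ
      rw [← amplify_mul, mul_assoc, hnk, mul_one]
    have hk' : star (amplify k) * amplify k =
        ∑ i, star (amplify (D i x : H →L[ℂ] H)) * amplify (D i x : H →L[ℂ] H) + (ε : ℂ) • 1 := by
      rw [← amplify_star, ← amplify_mul, hk, amplify_add, amplify_sum, amplify_smul, amplify_one]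
      simp only [amplify_mul, amplify_star]
    rw [← norm_sq_apply_of_star_mul_self_eq hk', h6]
    calc ‖amplify (F (x * n) : H →L[ℂ] H) (amplify k ξ)‖ ^ 2
        ≤ ((‖F'‖ * √(∑ i, ‖c i‖ ^ 2)) * ‖amplify k ξ‖) ^ 2 := by
          gcongr
          exact (norm_amplify_le _ _).trans (mul_le_mul_of_nonneg_right h5 (norm_nonneg _))
      _ = _ := by rw [mul_pow, mul_pow, Real.sq_sqrt hc0]
  have ht : Tendsto (fun ε : ℝ => (‖F'‖ ^ 2 * ∑ i, ‖c i‖ ^ 2) *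
      (∑ i, ‖amplify (D i x : H →L[ℂ] H) ξ‖ ^ 2 + ε * ‖ξ‖ ^ 2)) (𝓝[>] 0)
      (𝓝 ((‖F'‖ ^ 2 * ∑ i, ‖c i‖ ^ 2) *
      (∑ i, ‖amplify (D i x : H →L[ℂ] H) ξ‖ ^ 2 + 0 * ‖ξ‖ ^ 2))) :=
    (Continuous.tendsto (by fun_prop) 0).mono_left nhdsWithin_le_nhds
  rw [zero_mul, add_zero] at ht
  exact ge_of_tendsto ht (eventually_mem_nhdsWithin.mono key)

end IsGramDecomposition

end SelfDuality

/-! ### Representing vectors and their equivariance -/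

namespace IsGramDecomposition

open Filter Topology

variable {H : Type*} [NormedAddCommGroup H] [InnerProductSpace ℂ H] [CompleteSpace H]
  {M : VonNeumannAlgebra H} {ι : Type*} [Fintype ι] {N : StarSubalgebra ℂ M.toStarSubalgebra}
  {E F : M.toStarSubalgebra →ₗ[ℂ] M.toStarSubalgebra}
  {D : ι → M.toStarSubalgebra →ₗ[ℂ] M.toStarSubalgebra} {c : ι → ℂ}

/-- The vectors `(Dᵢ(x) ξ)ᵢ`. -/
def orbit (D : ι → M.toStarSubalgebra →ₗ[ℂ] M.toStarSubalgebra) (ξ : L2Seq H) :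
    M.toStarSubalgebra →ₗ[ℂ] PiLp 2 fun _ : ι => L2Seq H where
  toFun x := WithLp.toLp 2 fun i => amplify (D i x : H →L[ℂ] H) ξ
  map_add' x y := by
    ext1 i
    change amplify (D i (x + y) : H →L[ℂ] H) ξ = amplify _ ξ + amplify _ ξ
    rw [map_add]
    exact congrArg (fun z : L2Seq H →L[ℂ] L2Seq H => z ξ) (amplify_add _ _)
  map_smul' a x := by
    ext1 i
    change amplify (D i (a • x) : H →L[ℂ] H) ξ = a • amplify _ ξ
    rw [map_smul]
    exact congrArg (fun z : L2Seq H →L[ℂ] L2Seq H => z ξ) (amplify_smul _ _)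

theorem orbit_apply (ξ : L2Seq H) (x : M.toStarSubalgebra) (i : ι) :
    orbit D ξ x i = amplify (D i x : H →L[ℂ] H) ξ := rfl

theorem inner_orbit (κ : PiLp 2 fun _ : ι => L2Seq H) (ξ : L2Seq H) (x : M.toStarSubalgebra) :
    ⟪κ, orbit D ξ x⟫_ℂ = ∑ i, ⟪amplify (star (D i x : H →L[ℂ] H)) (κ i), ξ⟫_ℂ := by
  rw [PiLp.inner_apply]
  refine Finset.sum_congr rfl fun i _ => ?_
  rw [inner_amplify_left, star_star, orbit_apply]

/-- `κ` represents `ξ ↦ F(·)⋆ ξ` through the adjoints of the `Dᵢ(·)`. -/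
def Represents (F : M.toStarSubalgebra →ₗ[ℂ] M.toStarSubalgebra)
    (D : ι → M.toStarSubalgebra →ₗ[ℂ] M.toStarSubalgebra) (ξ : L2Seq H)
    (κ : PiLp 2 fun _ : ι => L2Seq H) : Prop :=
  κ ∈ closure (Set.range (orbit D ξ)) ∧ ∀ x : M.toStarSubalgebra,
    ∑ i, amplify (star (D i x : H →L[ℂ] H)) (κ i) = amplify (star (F x : H →L[ℂ] H)) ξ

/-- The matrix coefficient `x ↦ ⟪ξ, F(x) ξ⟫`. -/
def vectorForm (F : M.toStarSubalgebra →ₗ[ℂ] M.toStarSubalgebra) (ξ : L2Seq H) :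
    M.toStarSubalgebra →ₗ[ℂ] ℂ where
  toFun x := ⟪ξ, amplify (F x : H →L[ℂ] H) ξ⟫_ℂ
  map_add' x y := by
    rw [map_add, ← inner_add_right]
    exact congrArg (fun z : L2Seq H →L[ℂ] L2Seq H => ⟪ξ, z ξ⟫_ℂ) (amplify_add _ _)
  map_smul' a x := by
    rw [map_smul, RingHom.id_apply, smul_eq_mul, ← inner_smul_right]
    exact congrArg (fun z : L2Seq H →L[ℂ] L2Seq H => ⟪ξ, z ξ⟫_ℂ) (amplify_smul _ _)

/-- Domination and Riesz give `κ` with `⟪κ, D(x) ξ⟫ = ⟪ξ, F(x) ξ⟫`. The vector identity follows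
because the defect lies in the closure of `N ξ` and is orthogonal to `N ξ`. -/
theorem exists_represents (h : IsGramDecomposition N E D c)
    (hF : ∀ x, ∀ n ∈ N, F (x * n) = F x * n) (hFN : ∀ x, F x ∈ N) (hFc : Continuous F) :
    ∃ C : ℝ, ∀ ξ : L2Seq H, ∃ κ, Represents F D ξ κ ∧ ‖κ‖ ≤ C * ‖ξ‖ := by
  obtain ⟨C, hC0, hC⟩ := h.exists_norm_sq_amplify_le hF hFc
  refine ⟨√C, fun ξ => ?_⟩
  have hbound : ∀ x, ‖vectorForm F ξ x‖ ≤ √C * ‖ξ‖ * ‖orbit D ξ x‖ := fun x => by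
    have h1 : ‖amplify (F x : H →L[ℂ] H) ξ‖ ≤ √C * ‖orbit D ξ x‖ := by
      refine le_of_sq_le_sq ?_ (by positivity)
      rw [mul_pow, Real.sq_sqrt hC0, PiLp.norm_sq_eq_of_L2]
      exact hC x ξ
    calc ‖vectorForm F ξ x‖ ≤ ‖ξ‖ * ‖amplify (F x : H →L[ℂ] H) ξ‖ :=
          norm_inner_le_norm (𝕜 := ℂ) ξ (amplify (F x : H →L[ℂ] H) ξ)
      _ ≤ ‖ξ‖ * (√C * ‖orbit D ξ x‖) := by gcongr
      _ = _ := by ring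
  obtain ⟨κ, hκ, hφ, hn⟩ := exists_mem_closure_range_inner_eq (orbit D ξ) (vectorForm F ξ)
    (by positivity) hbound
  refine ⟨κ, ⟨hκ, fun x => ?_⟩, hn⟩
  let δ : (PiLp 2 fun _ : ι => L2Seq H) → L2Seq H := fun w =>
    ∑ i, amplify (star (D i x : H →L[ℂ] H)) (w i) - amplify (star (F x : H →L[ℂ] H)) ξ
  have hδc : Continuous δ := by fun_prop
  have hδN : δ κ ∈ closure ((fun n : M.toStarSubalgebra => amplify (n : H →L[ℂ] H) ξ) '' N) := by
    refine map_mem_closure hδc hκ ?_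
    rintro _ ⟨y, rfl⟩
    refine ⟨E (star x * y) - star (F x), sub_mem (S := StarSubalgebra ℂ M.toStarSubalgebra) (h.mem _) (star_mem (hFN x)), ?_⟩
    have h2 : ((E (star x * y) - star (F x) : M.toStarSubalgebra) : H →L[ℂ] H) =
        ∑ i, star (D i x : H →L[ℂ] H) * (D i y : H →L[ℂ] H) - star (F x : H →L[ℂ] H) := by
      rw [h.apply_star_mul]
      simp
    simp only [δ]
    rw [h2, amplify_sub, amplify_sum, _root_.sub_apply, _root_.sum_apply]
    simp only [amplify_mul, orbit_apply]
    rfl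
  -- Replacing `x` by `x n` in the defining property of `κ` tests the defect against `n ξ`, by right
  -- `N`-linearity.
  have hδ0 : ∀ n ∈ N, ⟪δ κ, amplify (n : H →L[ℂ] H) ξ⟫_ℂ = 0 := fun n hn => by
    have h3 := hφ (x * n)
    have h4 : ⟪κ, orbit D ξ (x * n)⟫_ℂ = 
        ∑ i, ⟪amplify (star (D i x : H →L[ℂ] H)) (κ i), amplify (n : H →L[ℂ] H) ξ⟫_ℂ := by
      rw [PiLp.inner_apply]
      refine Finset.sum_congr rfl fun i _ => ?_
      rw [inner_amplify_left, star_star, orbit_apply, h.apply_mul i x n hn]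
      exact congrArg (fun z : L2Seq H →L[ℂ] L2Seq H => ⟪κ i, z ξ⟫_ℂ) (amplify_mul _ _)
    have h5 : vectorForm F ξ (x * n) =
        ⟪amplify (star (F x : H →L[ℂ] H)) ξ, amplify (n : H →L[ℂ] H) ξ⟫_ℂ := by
      rw [inner_amplify_left, star_star]
      change ⟪ξ, amplify (F (x * n) : H →L[ℂ] H) ξ⟫_ℂ = _
      rw [hF x n hn]
      exact congrArg (fun z : L2Seq H →L[ℂ] L2Seq H => ⟪ξ, z ξ⟫_ℂ) (amplify_mul _ _)
    rw [inner_sub_left, sum_inner, ← h4, h3, h5, sub_self]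
  have h6 : ⟪δ κ, δ κ⟫_ℂ = 0 := by
    refine closure_minimal (t := {w | ⟪δ κ, w⟫_ℂ = 0}) ?_
      (isClosed_eq (by fun_prop) continuous_const) hδN
    rintro _ ⟨n, hn, rfl⟩
    exact hδ0 n hn
  exact sub_eq_zero.1 (inner_self_eq_zero.1 h6)

variable (D) in
/-- The closed span of all orbits. -/
def orbitSpan : Submodule ℂ (PiLp 2 fun _ : ι => L2Seq H) :=
  (⨆ ξ, LinearMap.range (orbit D ξ)).topologicalClosure

theorem Represents.mem_orbitSpan {ξ : L2Seq H} {κ} (h : Represents F D ξ κ) :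
    κ ∈ orbitSpan D :=
  closure_mono (le_iSup (fun ξ => LinearMap.range (orbit D ξ)) ξ) h.1

/-- The difference is orthogonal to every orbit, yet lies in their closed span. -/
theorem eq_of_mem_orbitSpan {κ κ' : PiLp 2 fun _ : ι => L2Seq H} (hκ : κ ∈ orbitSpan D)
    (hκ' : κ' ∈ orbitSpan D) (h : ∀ x : M.toStarSubalgebra,
      ∑ i, amplify (star (D i x : H →L[ℂ] H)) (κ i) =
        ∑ i, amplify (star (D i x : H →L[ℂ] H)) (κ' i)) : κ = κ' := by
  have h1 : orbitSpan D ≤ (Submodule.span ℂ {κ - κ'})ᗮ := by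
    refine Submodule.topologicalClosure_minimal _ (iSup_le fun ξ => ?_)
      (Submodule.isClosed_orthogonal _)
    rintro _ ⟨x, rfl⟩
    rw [Submodule.mem_orthogonal_singleton_iff_inner_right, inner_sub_left, inner_orbit,
      inner_orbit, ← sum_inner, ← sum_inner, h, sub_self]
  have h2 := h1 ((orbitSpan D).sub_mem hκ hκ')
  rw [Submodule.mem_orthogonal_singleton_iff_inner_right, inner_self_eq_zero] at h2
  exact sub_eq_zero.1 h2

/-- Applying `u` to each component of `κ` again gives a representing vector, now of `u ξ`, so
uniqueness applies. -/
theorem Represents.map {ξ : L2Seq H} {κ κ' : PiLp 2 fun _ : ι => L2Seq H}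
    (h : Represents F D ξ κ) (u : L2Seq H →L[ℂ] L2Seq H)
    (hu : ∀ (x : M.toStarSubalgebra) η, u (amplify (x : H →L[ℂ] H) η) = amplify x (u η))
    (h' : Represents F D (u ξ) κ') (i : ι) : κ' i = u (κ i) := by
  have h1 : Represents F D (u ξ) (WithLp.toLp 2 fun i => u (κ i)) := by
    constructor
    · have hc : Continuous fun w : (PiLp 2 fun _ : ι => L2Seq H) =>
          (WithLp.toLp 2 fun i => u (w i) : PiLp 2 fun _ : ι => L2Seq H) := by fun_prop
      refine map_mem_closure (f := fun w => WithLp.toLp 2 fun i => u (w i)) hc h.1 ?_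
      rintro _ ⟨x, rfl⟩
      refine ⟨x, ?_⟩
      ext1 i
      exact (hu (D i x) ξ).symm
    · intro x
      have h2 := h.2 x
      have h3 : ∀ (z : M.toStarSubalgebra) η, amplify (star (z : H →L[ℂ] H)) (u η) =
          u (amplify (star (z : H →L[ℂ] H)) η) := fun z η => (hu (star z) η).symm
      simp only [h3]
      rw [← map_sum, h2]
  have := eq_of_mem_orbitSpan h'.mem_orbitSpan h1.mem_orbitSpan fun x => by rw [h'.2, h1.2]
  rw [this]

theorem Represents.add {ξ η ζ : L2Seq H} {κ κ' κ'' : PiLp 2 fun _ : ι => L2Seq H}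
    (h : Represents F D ξ κ) (h' : Represents F D η κ') (h'' : Represents F D ζ κ'')
    (hζ : ζ = ξ + η) : κ'' = κ + κ' := by
  refine eq_of_mem_orbitSpan h''.mem_orbitSpan
    ((orbitSpan D).add_mem h.mem_orbitSpan h'.mem_orbitSpan) fun x => ?_
  rw [h''.2, hζ, map_add, ← h.2, ← h'.2, ← Finset.sum_add_distrib]
  exact Finset.sum_congr rfl fun i _ => (map_add _ _ _).symm

theorem Represents.smul {ξ ζ : L2Seq H} {κ κ'' : PiLp 2 fun _ : ι => L2Seq H} {a : ℂ}
    (h : Represents F D ξ κ) (h'' : Represents F D ζ κ'')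
    (hζ : ζ = a • ξ) : κ'' = a • κ := by
  refine eq_of_mem_orbitSpan h''.mem_orbitSpan
    ((orbitSpan D).smul_mem a h.mem_orbitSpan) fun x => ?_
  rw [h''.2, hζ, map_smul, ← h.2, Finset.smul_sum]
  exact Finset.sum_congr rfl fun i _ => (map_smul _ _ _).symm

/-- By uniqueness `ξ ↦ κ(ξ)` is linear and commutes with the commutant of the amplified `M`. Matrix
units make its components diagonal, and operators of `M'` place the diagonal entries in `M'' = M`.
-/
theorem exists_represents_amplify (h : IsGramDecomposition N E D c)
    (hF : ∀ x, ∀ n ∈ N, F (x * n) = F x * n) (hFN : ∀ x, F x ∈ N) (hFc : Continuous F) :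
    ∃ y : ι → M.toStarSubalgebra, ∀ ξ : L2Seq H,
      Represents F D ξ (WithLp.toLp 2 fun i => amplify (y i : H →L[ℂ] H) ξ) := by
  obtain ⟨C, hC⟩ := h.exists_represents hF hFN hFc
  choose κ hκ hn using hC
  let s (n : ℕ) : H →L[ℂ] L2Seq H := lp.singleContinuousLinearMap ℂ (fun _ : ℕ => H) 2 n
  let e (n : ℕ) : L2Seq H →L[ℂ] H := lp.evalCLM ℂ (fun _ : ℕ => H) 2 n
  let y₀ (i : ι) : H →L[ℂ] H := LinearMap.mkContinuous
    { toFun := fun v => κ (s 0 v) i 0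
      map_add' := fun v w => by
        rw [(hκ (s 0 v)).add (hκ (s 0 w)) (hκ (s 0 (v + w))) (map_add _ _ _)]
        rfl
      map_smul' := fun a v => by
        rw [(hκ (s 0 v)).smul (hκ (s 0 (a • v))) (map_smul _ _ _)]
        rfl } C fun v => by
      calc ‖κ (s 0 v) i 0‖ ≤ ‖κ (s 0 v) i‖ := lp.norm_apply_le_norm (by norm_num) _ _
        _ ≤ ‖κ (s 0 v)‖ := PiLp.norm_apply_le _ _
        _ ≤ C * ‖s 0 v‖ := hn _
        _ = C * ‖v‖ := by rw [lp.singleContinuousLinearMap_apply, lp.norm_single (by norm_num)]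
  have hy₀ : ∀ i v, y₀ i v = κ (s 0 v) i 0 := fun i v => rfl
  have hcoord : ∀ ξ i n, κ ξ i n = y₀ i (ξ n) := fun ξ i n => by
    -- The matrix unit moving coordinate `n` to coordinate `0` commutes with every amplified
    -- operator.
    have h1 := (hκ ξ).map ((s 0).comp (e n)) (fun x η => (amplify_single _ _ _).symm)
      (hκ _) i
    rw [hy₀]
    change _ = κ (((s 0).comp (e n)) ξ) i 0
    rw [h1]
    exact (lp.single_apply_self (E := fun _ : ℕ => H) 2 0 (κ ξ i n)).symm
  have hmem : ∀ i, y₀ i ∈ M := fun i => by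
    rw [← VonNeumannAlgebra.commutant_commutant M, VonNeumannAlgebra.mem_commutant_iff]
    intro g hg
    rw [VonNeumannAlgebra.mem_commutant_iff] at hg
    ext v
    have h1 := (hκ (s 0 v)).map (amplify g) (fun x η => by
      have := hg x x.2
      change (amplify g * amplify (x : H →L[ℂ] H)) η = (amplify (x : H →L[ℂ] H) * amplify g) η
      rw [← amplify_mul, ← amplify_mul, this]) (hκ _) i
    have h2 : amplify g (s 0 v) = s 0 (g v) := amplify_single g 0 v
    change g (y₀ i v) = y₀ i (g v)
    rw [hy₀, hy₀, ← h2, h1]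
    rfl
  refine ⟨fun i => ⟨y₀ i, hmem i⟩, fun ξ => ?_⟩
  convert hκ ξ using 1
  ext i n
  exact (hcoord ξ i n).symm

end IsGramDecomposition

/-! ### Self-duality: merging the `yᵢ` into one element -/

namespace IsGramDecomposition

open Filter Topology

variable {H : Type*} [NormedAddCommGroup H] [InnerProductSpace ℂ H] [CompleteSpace H]
  {M : VonNeumannAlgebra H} {ι : Type*} [Fintype ι] {N : StarSubalgebra ℂ M.toStarSubalgebra}
  {E F : M.toStarSubalgebra →ₗ[ℂ] M.toStarSubalgebra}
  {D : ι → M.toStarSubalgebra →ₗ[ℂ] M.toStarSubalgebra} {c : ι → ℂ}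

/-- The defect `∑ᵢ ‖Dᵢ(x) ξ - yᵢ ξ‖²`. -/
def defect (D : ι → M.toStarSubalgebra →ₗ[ℂ] M.toStarSubalgebra) (y : ι → M.toStarSubalgebra)
    (ξ : L2Seq H) (x : M.toStarSubalgebra) : ℝ :=
  ∑ i, ‖amplify ((D i x : H →L[ℂ] H) - (y i : H →L[ℂ] H)) ξ‖ ^ 2

theorem defect_nonneg (D : ι → M.toStarSubalgebra →ₗ[ℂ] M.toStarSubalgebra)
    (y : ι → M.toStarSubalgebra) (ξ : L2Seq H) (x : M.toStarSubalgebra) : 0 ≤ defect D y ξ x :=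
  Finset.sum_nonneg fun _ _ => by positivity

/-- Approximation is known for one `ξ` at a time. Interleaving two sequences adds their defects, so
the filters attached to the single `ξ` are directed and have a common proper refinement. -/
theorem exists_filter {y : ι → M.toStarSubalgebra}
    (hy : ∀ ξ : L2Seq H, (WithLp.toLp 2 fun i => amplify (y i : H →L[ℂ] H) ξ) ∈
      closure (Set.range (orbit D ξ))) :
    ∃ l : Filter M.toStarSubalgebra, l.NeBot ∧ ∀ ξ, Tendsto (defect D y ξ) l (𝓝 0) := by
  refine ⟨⨅ ξ, comap (defect D y ξ) (𝓝 0), ?_, fun ξ => tendsto_iff_comap.2 (iInf_le _ ξ)⟩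
  have hle : ∀ {ξ ζ : L2Seq H}, (∀ x, defect D y ξ x ≤ defect D y ζ x) →
      comap (defect D y ζ) (𝓝 0) ≤ comap (defect D y ξ) (𝓝 0) := fun h =>
    tendsto_iff_comap.1 (squeeze_zero (defect_nonneg D y _) h tendsto_comap)
  refine iInf_neBot_of_directed (fun ξ η => ?_) fun ξ => ?_
  · obtain ⟨ζ, hζ⟩ := exists_norm_sq_amplify_eq_add ξ η
    have h1 : ∀ x, defect D y ζ x = defect D y ξ x + defect D y η x := fun x => by
      simp only [defect, hζ, Finset.sum_add_distrib]
    refine ⟨ζ, hle fun x => ?_, hle fun x => ?_⟩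
    · rw [h1]
      exact le_add_of_nonneg_right (defect_nonneg _ _ _ _)
    · rw [h1]
      exact le_add_of_nonneg_left (defect_nonneg _ _ _ _)
  · have h1 : ∀ x, defect D y ξ x =
        dist (orbit D ξ x) (WithLp.toLp 2 fun i => amplify (y i : H →L[ℂ] H) ξ) ^ 2 := fun x => by
      rw [dist_eq_norm, PiLp.norm_sq_eq_of_L2]
      refine Finset.sum_congr rfl fun i _ => ?_
      rw [amplify_sub]
      rfl
    rw [comap_neBot_iff]
    intro t ht
    obtain ⟨ε, hε, hεt⟩ := Metric.mem_nhds_iff.1 ht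
    obtain ⟨_, ⟨x, rfl⟩, hx⟩ := Metric.mem_closure_iff.1 (hy ξ) (√ε) (Real.sqrt_pos.2 hε)
    refine ⟨x, hεt ?_⟩
    rw [Metric.mem_ball, dist_zero_right, Real.norm_of_nonneg (defect_nonneg _ _ _ _), h1,
      dist_comm]
    exact Real.lt_sqrt dist_nonneg |>.1 hx

/-- Along the filter `Dᵢ(x) → yᵢ`, hence `x = ∑ cᵢ Dᵢ(x)` tends ultraweakly to `∑ cᵢ yᵢ`. Continuity
of `Dᵢ` and uniqueness of limits conclude. -/
theorem exists_apply_eq_of_mem_closure (h : IsGramDecomposition N E D c)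
    {y : ι → M.toStarSubalgebra}
    (hy : ∀ ξ : L2Seq H, (WithLp.toLp 2 fun i => amplify (y i : H →L[ℂ] H) ξ) ∈
      closure (Set.range (orbit D ξ))) : ∃ x, ∀ i, D i x = y i := by
  obtain ⟨l, hl, hlt⟩ := exists_filter hy
  have h1 : ∀ i (η ξ : L2Seq H), Tendsto (fun x => ⟪η, amplify (D i x : H →L[ℂ] H) ξ⟫_ℂ) l
      (𝓝 ⟪η, amplify (y i : H →L[ℂ] H) ξ⟫_ℂ) := fun i η ξ => by
    have h2 : Tendsto (fun x => ‖amplify ((D i x : H →L[ℂ] H) - (y i : H →L[ℂ] H)) ξ‖ ^ 2) l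
        (𝓝 0) := squeeze_zero (fun _ => by positivity) (fun x =>
      Finset.single_le_sum (f := fun i =>
        ‖amplify ((D i x : H →L[ℂ] H) - (y i : H →L[ℂ] H)) ξ‖ ^ 2)
        (fun _ _ => by positivity) (Finset.mem_univ i)) (hlt ξ)
    have h3 := h2.sqrt
    simp only [Real.sqrt_sq (norm_nonneg _), Real.sqrt_zero] at h3
    have h4 : Tendsto (fun x => amplify (D i x : H →L[ℂ] H) ξ) l
        (𝓝 (amplify (y i : H →L[ℂ] H) ξ)) := by
      rw [tendsto_iff_norm_sub_tendsto_zero]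
      refine h3.congr fun x => ?_
      rw [amplify_sub]
      rfl
    exact tendsto_const_nhds.inner h4
  let x₀ : M.toStarSubalgebra := ∑ i, c i • y i
  have h5 : ∀ (z : ι → M.toStarSubalgebra) (η ξ : L2Seq H),
      ⟪η, amplify ((∑ i, c i • z i : M.toStarSubalgebra) : H →L[ℂ] H) ξ⟫_ℂ =
        ∑ i, c i * ⟪η, amplify (z i : H →L[ℂ] H) ξ⟫_ℂ := fun z η ξ => by
    have h6 : ((∑ i, c i • z i : M.toStarSubalgebra) : H →L[ℂ] H) =
        ∑ i, c i • (z i : H →L[ℂ] H) := by simp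
    rw [h6, amplify_sum, _root_.sum_apply, inner_sum]
    refine Finset.sum_congr rfl fun i _ => ?_
    rw [amplify_smul, _root_.smul_apply, inner_smul_right]
  have h7 : ∀ η ξ : L2Seq H, Tendsto (fun x : M.toStarSubalgebra =>
      ⟪η, amplify (x : H →L[ℂ] H) ξ⟫_ℂ) l (𝓝 ⟪η, amplify (x₀ : H →L[ℂ] H) ξ⟫_ℂ) := fun η ξ => by
    rw [h5]
    refine (tendsto_finsetSum Finset.univ fun i _ => (h1 i η ξ).const_mul (c i)).congr fun x => ?_
    rw [← h5, h.sum_smul]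
  refine ⟨x₀, fun i => Subtype.ext (ext_inner_amplify fun η ξ => ?_)⟩
  exact tendsto_nhds_unique ((h.continuous i).tendsto h7 η ξ) (h1 i η ξ)

/-- Self-duality: every ultraweakly continuous right `N`-linear map `F` with values in `N` is of
the form `E(y · )`. -/
theorem exists_eq_apply_mul (h : IsGramDecomposition N E D c)
    (hE : ∀ x, E (star x) = star (E x))
    (hF : ∀ x, ∀ n ∈ N, F (x * n) = F x * n) (hFN : ∀ x, F x ∈ N)
    (hFc : IsUltraweaklyContinuous M F) : ∃ y, ∀ x, F x = E (y * x) := by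
  obtain ⟨y, hy⟩ := h.exists_represents_amplify hF hFN hFc.continuous
  obtain ⟨z, hz⟩ := h.exists_apply_eq_of_mem_closure fun ξ => (hy ξ).1
  refine ⟨star z, fun x => ?_⟩
  rw [← star_inj, ← hE, star_mul, star_star,
    h.apply_star_mul]
  refine Subtype.ext (ext_inner_amplify fun η ξ => ?_)
  have h1 := (hy ξ).2 x
  have h2 : ((∑ i, star (D i x) * D i z : M.toStarSubalgebra) : H →L[ℂ] H) =
      ∑ i, star (D i x : H →L[ℂ] H) * (y i : H →L[ℂ] H) := by
    simp [hz]
  rw [h2, amplify_sum, _root_.sum_apply]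
  simp only [amplify_mul]
  exact congrArg (fun w => ⟪η, w⟫_ℂ) h1.symm

end IsGramDecomposition

/-! ### Bimodule maps come from left integrals -/

namespace VNModuleAlgebra

variable {A : Type*} [CStarAlgebra A] [WeakCStarHopfAlgebra A]
  {H : Type*} [NormedAddCommGroup H] [InnerProductSpace ℂ H] [CompleteSpace H]
  {M : VonNeumannAlgebra H} (T : VNModuleAlgebra A M)

theorem isClosed_fixedPoints : IsClosed T.fixedPoints := by
  have : T.fixedPoints = ⋂ a : A, {n | T.act a n = T.act (idConvS a) n} := by
    ext n
    simp [fixedPoints]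
  rw [this]
  exact isClosed_iInter fun a =>
    isClosed_eq (T.continuous_act a).continuous (T.continuous_act _).continuous

theorem act_mem_bimoduleHom {l : A} (hl : l ∈ leftIntegrals A) : T.act l ∈ T.bimoduleHom :=
  ⟨T.act_leftIntegral_mem hl, fun _ hn m => ⟨T.act_fixed_mul hn l m, T.act_mul_fixed hn l m⟩,
    T.continuous_act l⟩

variable [FiniteDimensional ℂ A] [PartialOrder A] [StarOrderedRing A]

/-- Positivity of `h` supplies the `a i`, and nondegeneracy makes them span `A`; the scalars `c` are
coefficients of `1`. -/
theorem exists_isGramDecomposition {h : A} (hh : IsHaarProjection h) :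
    ∃ (k : ℕ) (a : Fin k → A) (c : Fin k → ℂ),
      IsGramDecomposition T.fixedStarSubalgebra (T.act h) (fun i => T.act (a i)) c := by
  obtain ⟨k, a, ha⟩ := (isPositiveIntegral_iff h).1 hh.isPositiveIntegral
  have h1 : (1 : A) ∈ Submodule.span ℂ (Set.range a) := by
    rw [span_eq_top_of_nondegenerate hh.isNondegenerateIntegral ha]
    trivial
  obtain ⟨c, hc⟩ := (Submodule.mem_span_range_iff_exists_fun ℂ).1 h1
  refine ⟨k, a, c, T.act_star_mul ha, fun x => ?_, T.act_leftIntegral_mem hh.isHaarIntegral.left,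
    fun i x n hn => T.act_mul_fixed hn _ _, fun i => T.continuous_act _, T.isClosed_fixedPoints⟩
  calc ∑ i, c i • T.act (a i) x = T.act (∑ i, c i • a i) x := by
        rw [map_sum, LinearMap.sum_apply]
        exact Finset.sum_congr rfl fun i _ => by rw [map_smul, LinearMap.smul_apply]
    _ = x := by rw [hc, T.one_act]

/-- Self-duality uses only right `N`-linearity. Left linearity gives `E_h((n y - y n) m) = 0` for
all `m`, so `y` commutes with `N` because `E_h` is faithful. -/
theorem exists_eq_act_mul {h : A} (hh : IsHaarProjection h)
    {F : M.toStarSubalgebra →ₗ[ℂ] M.toStarSubalgebra} (hF : F ∈ T.bimoduleHom) :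
    ∃ y ∈ Set.centralizer T.fixedPoints, ∀ m, F m = T.act h (y * m) := by
  obtain ⟨hFN, hFb, hFc⟩ := hF
  obtain ⟨k, a, c, hG⟩ := T.exists_isGramDecomposition hh
  obtain ⟨y, hy⟩ := hG.exists_eq_apply_mul
    (map_star_of_isPositiveMap (T.isPositiveMap_act hh.isPositiveIntegral))
    (fun x n hn => (hFb n hn x).2) hFN hFc
  refine ⟨y, fun n hn => ?_, hy⟩
  refine sub_eq_zero.1 (T.eq_zero_of_forall_act_mul_left hh fun m => ?_)
  rw [sub_mul, map_sub, mul_assoc, mul_assoc, T.act_fixed_mul hn, ← hy, ← hy, (hFb n hn m).1,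
    sub_self]

theorem IsStandard.exists_leftIntegral {T : VNModuleAlgebra A M} (hT : T.IsStandard)
    (hM : Set.centralizer T.fixedPoints = T.MR)
    {F : M.toStarSubalgebra →ₗ[ℂ] M.toStarSubalgebra} (hF : F ∈ T.bimoduleHom) :
    ∃ l ∈ leftIntegrals A, T.act l = F := by
  obtain ⟨h, hh⟩ := exists_isHaarProjection (A := A)
  obtain ⟨y, hyN, hy⟩ := T.exists_eq_act_mul hh hF
  rw [hM] at hyN
  obtain ⟨b, hb, rfl⟩ := hT.surjOn hyN
  refine ⟨h * b, mul_mem_leftIntegrals hh.isHaarIntegral.left b, LinearMap.ext fun m => ?_⟩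
  rw [T.act_mul_left h hb, hy]

/-- `l ↦ E_l` as a map from left integrals to bimodule maps. -/
def actBimoduleHom : leftIntegrals A →ₗ[ℂ] T.bimoduleHom where
  toFun l := ⟨T.act l, T.act_mem_bimoduleHom l.2⟩
  map_add' _ _ := Subtype.ext (map_add T.act _ _)
  map_smul' _ _ := Subtype.ext (map_smul T.act _ _)

theorem IsStandard.bijective_actBimoduleHom {T : VNModuleAlgebra A M} (hT : T.IsStandard)
    (hM : Set.centralizer T.fixedPoints = T.MR) : Function.Bijective T.actBimoduleHom := by
  constructor
  · rw [injective_iff_map_eq_zero]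
    intro l hl
    exact Subtype.ext (hT.eq_zero_of_act_eq_zero l.2 fun m =>
      LinearMap.congr_fun (congrArg Subtype.val hl) m)
  · rintro ⟨F, hF⟩
    obtain ⟨l, hl, h⟩ := hT.exists_leftIntegral hM hF
    exact ⟨⟨l, hl⟩, Subtype.ext h⟩

end VNModuleAlgebra

end WeakHopf

end

open WeakHopf in
theorem theorem2p26 {A : Type*} [CStarAlgebra A] [FiniteDimensional ℂ A]
    [PartialOrder A] [StarOrderedRing A] [WeakCStarHopfAlgebra A]
    {H : Type*} [NormedAddCommGroup H] [InnerProductSpace ℂ H] [CompleteSpace H]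
    (M : VonNeumannAlgebra H) (T : VNModuleAlgebra A M) :
    -- (i)
    (∀ l ∈ leftIntegrals A,
      (∀ m, T.E l m ∈ T.fixedPoints) ∧ IsUltraweaklyContinuous M (T.E l) ∧
      ∀ n ∈ T.fixedPoints, ∀ m,
        T.E l (n * m) = n * T.E l m ∧ T.E l (m * n) = T.E l m * n) ∧
    -- (ii)
    (∀ l ∈ leftIntegrals A,
      (∀ d ∈ leftSubalg A, l * d ∈ leftIntegrals A ∧
        ∀ m, T.E (l * d) m = T.E l (T.act d 1 * m)) ∧
      (∀ d ∈ rightSubalg A, l * d ∈ leftIntegrals A ∧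
        ∀ m, T.E (l * d) m = T.E l (m * T.act d 1))) ∧
    -- (iii)
    (∀ l ∈ leftIntegrals A,
      T.E l 1 = T.act (nL l) 1 ∧ T.E l 1 = T.act (nR l) 1 ∧
      T.E l 1 ∈ T.fixedPoints ∩ Set.centralizer T.fixedPoints ∧ T.E l 1 ∈ T.MR ∧
      (IsNormalizableIntegral l → IsUnit (T.E l 1)) ∧
      (IsNormalizedIntegral l →
        T.E l 1 = 1 ∧ Set.range (T.E l) = T.fixedPoints ∧
        ∀ n ∈ T.fixedPoints, T.E l n = n)) ∧
    -- (iv)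
    (∃ h : A, IsHaarIntegral h ∧ ∀ l ∈ leftIntegrals A, IsPositiveIntegral l →
      IsPositiveMap (T.E l) ∧
      0 ≤ dR l ∧
      (∀ m, T.E l m =
        T.E h (star (T.act (CFC.sqrt (dR l)) 1) * m * T.act (CFC.sqrt (dR l)) 1)) ∧
      (IsNondegenerateIntegral l → IsFaithfulMap (T.E l))) ∧
    -- (v)
    (T.IsStandard → Set.centralizer T.fixedPoints = T.MR →
      ∃ Φ : leftIntegrals A ≃ₗ[ℂ] T.bimoduleHom,
        (∀ l : leftIntegrals A,
          (Φ l : M.toStarSubalgebra →ₗ[ℂ] M.toStarSubalgebra) = T.E (l : A)) ∧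
        ∀ l : leftIntegrals A,
          (T.E (l : A) 1 = 1 ↔ IsNormalizedIntegral (l : A)) ∧
          (IsNondegenerateMap (T.E (l : A)) ↔ IsNondegenerateIntegral (l : A)) ∧
          (IsPositiveMap (T.E (l : A)) ↔ IsPositiveIntegral (l : A))) := by

  refine ⟨fun l hl => ?_, fun l hl => ?_, fun l hl => ?_, ?_, fun hT hM => ?_⟩
  · exact ⟨T.act_leftIntegral_mem hl, T.continuous_act l, fun n hn m =>
      ⟨T.act_fixed_mul hn l m, T.act_mul_fixed hn l m⟩⟩
  · exact ⟨fun d hd => ⟨VNModuleAlgebra.mul_mem_leftIntegrals hl d, T.act_mul_left l hd⟩,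
      fun d hd => ⟨VNModuleAlgebra.mul_mem_leftIntegrals hl d, T.act_mul_right l hd⟩⟩
  · refine ⟨T.act_one_eq_nL l, T.act_one_eq_nR l, ⟨T.act_leftIntegral_mem hl 1,
      T.act_leftIntegral_one_mem_centralizer hl⟩, ⟨l, rfl⟩, T.isUnit_act_one, fun hn =>
      ⟨T.act_one_of_normalized hn, Set.Subset.antisymm ?_ ?_,
        fun n hn' => T.act_fixed_of_normalized hn hn'⟩⟩
    · rintro _ ⟨m, rfl⟩
      exact T.act_leftIntegral_mem hl m
    · exact fun n hn' => ⟨n, T.act_fixed_of_normalized hn hn'⟩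
  · obtain ⟨h, hh⟩ := exists_isHaarProjection (A := A)
    exact ⟨h, hh.isHaarIntegral, fun l hl hp => ⟨T.isPositiveMap_act hp, dR_nonneg hp,
      T.act_eq_conj_sqrt hh hl (dR_nonneg hp), T.isFaithfulMap_act hp⟩⟩
  · exact ⟨LinearEquiv.ofBijective T.actBimoduleHom (hT.bijective_actBimoduleHom hM),
      fun l => rfl, fun l => ⟨hT.act_one_eq_one_iff l, hT.isNondegenerateMap_iff l.2,
        hT.isPositiveMap_iff l.2⟩⟩
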